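/- Let $\Lambda$ be the ring of symmetric functions in infinitely many variables, with coefficients in $\mathbb{Q}(z,w)$, with power sums $p_k$, complete symmetric functions $h_\mu$, Schur functions $s_\lambda$ and Hall pairing $\langle\cdot,\cdot\rangle$. For a partition $\mu$ of $n$ let $\tilde H_\mu(\mathbf{x};q,t)$ be the modified Macdonald symmetric function, i.e. the unique symmetric function over $\mathbb{Q}(q,t)$ such that $\tilde H_\mu[X(1-q)]$ is a linear combination of the $s_\lambda$ with $\lambda\trianglerighteq\mu$, $\tilde H_\mu[X(1-t)]$ is a linear combination of the $s_\lambda$ with $\lambda\trianglerighteq\mu'$ (dominance order, $\mu'$ the conjugate partition), and $\langle\tilde H_\mu,s_{(n)}\rangle=1$; here $f[X(1-a)]$ is obtained from $f$ by $p_k\mapsto(1-a^k)p_k$. With $a(s)$, $l(s)$ the arm and leg length of a cell $s$, and with sums over all partitions $\lambda$, put $$\mathcal{H}_\lambda(z,w)=\prod_{s\in\lambda}\frac{(z^{2a(s)+1}-w^{2l(s)+1})^{2}}{(z^{2a(s)+2}-w^{2l(s)})(z^{2a(s)}-w^{2l(s)+2})},\qquad \Omega(z,w)=\sum_{\lambda}\mathcal{H}_\lambda(z,w)\,\tilde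 H_\lambda(\mathbf{x};z^2,w^2)\,T^{|\lambda|}\in\Lambda[[T]].$$ Let $\mathrm{Log}(f)=\sum_{d\ge1}\frac{\mu(d)}{d}\psi_d(\log f)$, where $\mu(d)$ is the Möbius function and $\psi_d$ is the Adams operation $p_k\mapsto p_{dk}$, $z\mapsto z^d$, $w\mapsto w^d$, $T\mapsto T^d$. For $n\ge1$ define $$\mathbb{H}_{(n-1,1)}(z,w)=(z^2-1)(1-w^2)\,\big\langle [T^n]\,\mathrm{Log}\,\Omega(z,w),\;h_{n-1}h_1\big\rangle\in\mathbb{Q}(z,w),$$ and define $\mathbb{H}^{[n]}(z,w)$ for $n\ge0$ by $$\sum_{n\ge0}\mathbb{H}^{[n]}(z,w)\,T^n=\prod_{m\ge1}\frac{(1-zwT^m)^2}{(1-z^2T^m)(1-w^2T^m)}.$$ Finally put $A_0(z,w;T)=\sum_\lambda\mathcal{H}_\lambda(z,w)T^{|\lambda|}$ and $A_1(z,w;T)=\sum_\lambda\mathcal{H}_\lambda(z,w)\phi_\lambda(z^2,w^2)T^{|\lambda|}$, where $\phi_\lambda(z,w)=\sum_{(i,j)\in\lambda}z^{j-1}w^{i-1}$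 ($i$ the row and $j$ the column of a cell, counted from $1$). Then: 1. For every $n\ge1$ the rational function $\mathbb{H}_{(n-1,1)}(z,w)$ can be specialized at $w=z^{-1}$ ($z$ an indeterminate), and $\mathbb{H}_{(n-1,1)}(z,z^{-1})=\mathbb{H}^{[n]}(z,z^{-1})$. 2. In terms of generating functions, for $w=z^{-1}$, $$1+(z^2-1)(1-w^2)\frac{A_1(z,w;T)}{A_0(z,w;T)}=\prod_{m\ge1}\frac{(1-zwT^m)^2}{(1-z^2T^m)(1-w^2T^m)}.$$ 3. For every $n\ge1$ the rational function $\mathbb{H}_{(n-1,1)}(z,w)$ can be specialized at $z=0$ ($w$ an indeterminate), and $\mathbb{H}_{(n-1,1)}(0,w)=\mathbb{H}^{[n]}(0,w)$. -/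

import Mathlib

noncomputable section

namespace HilbChar

/-! ### Partitions, arm and leg lengths

Partitions are drawn as Young diagrams: the cell `(i, j)` lies in row `i` and column `j` (both
counted from `0`), and row `i` has length `λ_{i+1}`. -/

/-- The Young diagram whose row lengths are the parts of `lam`, in weakly decreasing order. -/
def diagram {n : ℕ} (lam : n.Partition) : YoungDiagram :=
  YoungDiagram.ofRowLens (lam.parts.sort (· ≥ ·)) (Multiset.pairwise_sort _ _).sortedGE

/-- The arm length of a cell: the number of cells to its right in the same row. -/
def arm (D : YoungDiagram) (s : ℕ × ℕ) : ℕ := D.rowLen s.1 - (s.2 + 1)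

/-- The leg length of a cell: the number of cells below it in the same column. -/
def leg (D : YoungDiagram) (s : ℕ × ℕ) : ℕ := D.colLen s.2 - (s.1 + 1)

/-- The dominance order: `D ⊵ E`. -/
def Dominates (D E : YoungDiagram) : Prop :=
  ∀ k : ℕ, ∑ i ∈ Finset.range k, E.rowLen i ≤ ∑ i ∈ Finset.range k, D.rowLen i

/-- The partition `(n-1,1)` of `n ≥ 1`; for `n = 1` the zero part is dropped and it is `(1)`. -/
def almostRow (n : ℕ) (hn : 1 ≤ n) : n.Partition :=
  Nat.Partition.ofSums n {n - 1, 1} (by simp; omega)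

/-! ### Symmetric functions -/

/-- The ring of symmetric functions in infinitely many variables, with coefficients in a field `K`
of characteristic zero, as the polynomial ring over `K` in the power sums `p_1, p_2, …`: the
variable `X k` is `p_k`. -/
abbrev Sym (K : Type*) [Field K] : Type _ := MvPolynomial ℕ+ K

section SymmetricFunctions

variable {K : Type*} [Field K]

/-- `z_ρ = ∏ i ^ (m_i) * (m_i)!` for the partition `ρ` in which `i` has multiplicity `m i`. -/
def zee (m : ℕ+ →₀ ℕ) : ℕ := m.prod fun i a => (i : ℕ) ^ a * a.factorial

/-- The Hall pairing: the bilinear form with `⟨p_ρ, p_σ⟩ = δ_{ρσ} z_ρ`. -/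
def hall (f g : Sym K) : K := ∑ m ∈ f.support, f.coeff m * g.coeff m * (zee m : K)

/-- The complete symmetric function `h_n = ∑_{ρ ⊢ n} p_ρ / z_ρ`. -/
def complete (n : ℕ) : Sym K :=
  ∑ rho : n.Partition,
    MvPolynomial.monomial (Multiset.toFinsupp (rho.parts.map Nat.toPNat'))
      ((zee (Multiset.toFinsupp (rho.parts.map Nat.toPNat')) : K)⁻¹)

/-- `h_m` for an integer `m`, zero if `m < 0`. -/
def completeInt (m : ℤ) : Sym K := if 0 ≤ m then complete m.toNat else 0

/-- `h_μ = ∏ h_{μ_i}`. -/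
def completeProd {n : ℕ} (mu : n.Partition) : Sym K := (mu.parts.map complete).prod

/-- The Schur function `s_λ = det (h_{λ_i - i + j})`. -/
def schur (D : YoungDiagram) : Sym K :=
  Matrix.det (Matrix.of fun i j : Fin D.card =>
    completeInt (K := K) ((D.rowLen i : ℤ) - (i : ℤ) + (j : ℤ)))

/-- The plethystic substitution `f ↦ f[X (1 - a)]`, that is `p_k ↦ (1 - a ^ k) p_k`. -/
def plethOneSub (a : K) : Sym K →ₐ[K] Sym K :=
  MvPolynomial.aeval fun k : ℕ+ => MvPolynomial.C (1 - a ^ (k : ℕ)) * MvPolynomial.X k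

/-- The span of the Schur functions `s_λ` with `|λ| = |μ|` and `λ ⊵ μ`. -/
def schurAbove (D : YoungDiagram) : Submodule K (Sym K) :=
  Submodule.span K (schur '' {E | E.card = D.card ∧ Dominates E D})

/-- The defining properties of the (modified) Macdonald symmetric function `H̃_μ(x; q, t)`:
`H̃_μ[X(1-q)]` is a combination of the `s_λ` with `λ ⊵ μ`, `H̃_μ[X(1-t)]` is a combination of the
`s_λ` with `λ ⊵ μ'`, and the coefficient of `s_(n)` in `H̃_μ`, i.e. `⟨H̃_μ, h_n⟩`, is `1`. -/
def IsMacdonald (q t : K) (D : YoungDiagram) (H : Sym K) : Prop :=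
  plethOneSub q H ∈ schurAbove (K := K) D ∧
  plethOneSub t H ∈ schurAbove (K := K) D.transpose ∧
  hall H (complete D.card) = 1

open Classical in
/-- The (modified) Macdonald symmetric function `H̃_μ(x; q, t)`, the unique one with the defining
properties; used for `q`, `t` algebraically independent over `ℚ`. -/
def macdonald (q t : K) (D : YoungDiagram) : Sym K :=
  if h : ∃! H : Sym K, IsMacdonald q t D H then h.choose else 0

/-! ### Functions of two elements `z`, `w` of a field -/

/-- The genus `g` hook function `𝓗_λ(z, w)`. -/
def hook (g : ℕ) (z w : K) (D : YoungDiagram) : K :=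
  ∏ s ∈ D.cells,
    (z ^ (2 * arm D s + 1) - w ^ (2 * leg D s + 1)) ^ (2 * g) /
      ((z ^ (2 * arm D s + 2) - w ^ (2 * leg D s)) *
        (z ^ (2 * arm D s) - w ^ (2 * leg D s + 2)))

/-- `φ_λ(z, w)`, the sum of `z ^ j * w ^ i` over the cells `(i, j)` (rows and columns from `0`). -/
def phi (z w : K) (D : YoungDiagram) : K := ∑ s ∈ D.cells, z ^ s.2 * w ^ s.1

/-- `A_0(z, w; T) = ∑_λ 𝓗_λ(z, w) T ^ |λ|`, in genus one. -/
def seriesA0 (z w : K) : PowerSeries K :=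
  PowerSeries.mk fun n => ∑ lam : n.Partition, hook 1 z w (diagram lam)

/-- `A_1(z, w; T) = ∑_λ 𝓗_λ(z, w) φ_λ(z², w²) T ^ |λ|`, in genus one. -/
def seriesA1 (z w : K) : PowerSeries K :=
  PowerSeries.mk fun n =>
    ∑ lam : n.Partition, hook 1 z w (diagram lam) * phi (z ^ 2) (w ^ 2) (diagram lam)

/-- `ℍ^{[n]}(z, w)`: the coefficient of `T ^ n` in
`∏_{m ≥ 1} (1 - z w T^m)² / ((1 - z² T^m) (1 - w² T^m))`. The factors with `m > n` are congruent to
`1` modulo `T ^ (n + 1)` and do not contribute. -/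
def hilbH (n : ℕ) (z w : K) : K :=
  PowerSeries.coeff n (∏ m ∈ Finset.Icc 1 n,
    (1 - PowerSeries.C (z * w) * PowerSeries.X ^ m) ^ 2 *
      ((1 - PowerSeries.C (z ^ 2) * PowerSeries.X ^ m) *
        (1 - PowerSeries.C (w ^ 2) * PowerSeries.X ^ m))⁻¹)

end SymmetricFunctions

/-! ### The rational functions `ℍ_μ(z, w)`, for one puncture -/

/-- The field `ℚ(z, w)`. -/
abbrev Qzw : Type := FractionRing (MvPolynomial (Fin 2) ℚ)

/-- The variable `z` of `ℚ(z, w)`. -/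
def zVar : Qzw := algebraMap (MvPolynomial (Fin 2) ℚ) Qzw (MvPolynomial.X 0)

/-- The variable `w` of `ℚ(z, w)`. -/
def wVar : Qzw := algebraMap (MvPolynomial (Fin 2) ℚ) Qzw (MvPolynomial.X 1)

/-- The Adams operation on `ℚ(z, w)`: `f(z, w) ↦ f(z ^ d, w ^ d)`. -/
def adamsQ (d : ℕ+) : Qzw →+* Qzw :=
  IsFractionRing.map (A := MvPolynomial (Fin 2) ℚ) (B := MvPolynomial (Fin 2) ℚ)
    (j := (MvPolynomial.expand (d : ℕ) : MvPolynomial (Fin 2) ℚ →ₐ[ℚ] _).toRingHom)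
    (MvPolynomial.expand_injective d.pos)

/-- The Adams operation on symmetric functions over `ℚ(z, w)`:
`p_k ↦ p_{dk}`, `z ↦ z ^ d`, `w ↦ w ^ d`. -/
def adams (d : ℕ+) : Sym Qzw →+* Sym Qzw :=
  MvPolynomial.eval₂Hom (MvPolynomial.C.comp (adamsQ d)) fun k => MvPolynomial.X (d * k)

/-- `Log f = ∑_{d ≥ 1} μ(d) / d • ψ_d (log f)`, where the Adams operation `ψ_d` of the power series
ring acts on coefficients by `adams d` and maps `T` to `T ^ d`; so the coefficient of `T ^ n` is a
sum over the divisors `d` of `n`. -/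
def plethLog (f : PowerSeries (Sym Qzw)) : PowerSeries (Sym Qzw) :=
  PowerSeries.mk fun n => ∑ d ∈ n.divisors,
    ((ArithmeticFunction.moebius d : ℚ) / (d : ℚ)) •
      adams d.toPNat' (PowerSeries.coeff (n / d) (PowerSeries.logOf f))

/-- `Ω(z, w) = ∑_λ 𝓗_λ(z, w) H̃_λ(x; z², w²) T ^ |λ|` in genus `g` with one puncture. -/
def Omega (g : ℕ) : PowerSeries (Sym Qzw) :=
  PowerSeries.mk fun n => ∑ lam : n.Partition,
    hook g zVar wVar (diagram lam) • macdonald (zVar ^ 2) (wVar ^ 2) (diagram lam)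

/-- `ℍ_μ(z, w) = (z² - 1) (1 - w²) ⟨Log Ω(z, w), h_μ⟩` in genus `g` with one puncture. Only the
part of degree `n = |μ|`, which is the coefficient of `T ^ n`, pairs non-trivially with `h_μ`. -/
def charH (g : ℕ) {n : ℕ} (mu : n.Partition) : Qzw :=
  (zVar ^ 2 - 1) * (1 - wVar ^ 2) *
    hall (PowerSeries.coeff n (plethLog (Omega g))) (completeProd mu)

/-- The rational function `f(z, w)` is defined at the point `(a, b)` of a field `L ⊇ ℚ` and its value
there is `v`: it is a quotient of polynomials `P / Q` with `Q(a, b) ≠ 0` and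
`v = P(a, b) / Q(a, b)`. There is at most one such `v`. -/
def HasValueAt {L : Type*} [Field L] [Algebra ℚ L] (f : Qzw) (a b v : L) : Prop :=
  ∃ P Q : MvPolynomial (Fin 2) ℚ,
    MvPolynomial.aeval ![a, b] Q ≠ 0 ∧
    f = algebraMap _ Qzw P / algebraMap _ Qzw Q ∧
    v = MvPolynomial.aeval ![a, b] P / MvPolynomial.aeval ![a, b] Q

end HilbChar

end

/-! Write `q = z²`, `t = w²`. On symmetric functions of degree `n`, pairing with `h_n` is the
evaluation `p_k ↦ 1` (`evOne`), and pairing with `h_{n-1} h_1` is `∂/∂p_1` followed by that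
evaluation (`kappa`). An Adams operation with `d > 1` produces functions free of `p_1`, so only the
ordinary logarithm in `Log` contributes. Since `kappa` is a derivation over `evOne`, it sends `log
Ω` to `kappa Ω / evOne Ω`.

The normalization gives `evOne H̃_λ = 1`. The value `kappa H̃_λ = φ_λ(q,t)` comes from the Macdonald
operator `macOp`: `H̃_λ` is an eigenvector with eigenvalue `1 - (1-q)(1-t) φ_λ`, while `evOne (macOp
f) = evOne f - (1-q)(1-t) kappa f`. Hence `ℍ_{(n-1,1)}` is the coefficient of `T^n` in `(z²-1)(1-w²)
A_1/A_0` (`charH_almostRow`).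

Existence and uniqueness of `H̃_λ` have to be proved along the way. After the substitution `X ↦
X(1-q)` the operator is triangular on Schur functions for dominance, with the stated eigenvalues
(`macOpConj_schur_sub_mem`). It is symmetric in `q` and `t`, which yields the second triangularity
once the eigenvalues are distinct and the eigenvectors have nonzero evaluation. Both are checked at
`t = q⁻¹`, where Schur functions are eigenvectors and `s_λ[1/(1-q)]` is a nonzero multiple of a
Vandermonde determinant; they then hold over `ℚ(z,w)`.

It remains to sum `𝓗_λ (1 - (1-q)(1-t) φ_λ) T^|λ|` and divide by `A_0`. For `w = z⁻¹` all hook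
functions are `1` and the sum over columns is evaluated by the `q`-binomial theorem
(`series_inv_eq`). For `z = 0` the eigenvalue is `t` to the number of parts, the hook function is a
product over part multiplicities, and both series factor over part sizes (`series_zero_eq`). Neither
specialization makes a hook denominator vanish. -/

noncomputable section

namespace HilbChar

/-! ### Weights and complete symmetric functions -/

/-- The weight of a monomial in the power sums, where `p_k` has weight `k`. -/
abbrev wt : (ℕ+ →₀ ℕ) →+ ℕ := Finsupp.weight (fun k : ℕ+ => (k : ℕ))

/-- The exponent vector of the monomial `p_ρ`. -/
def typeVec {n : ℕ} (rho : n.Partition) : ℕ+ →₀ ℕ :=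
  Multiset.toFinsupp (rho.parts.map Nat.toPNat')

lemma wt_toFinsupp (s : Multiset ℕ+) : wt (Multiset.toFinsupp s) = (s.map (fun k : ℕ+ => (k : ℕ))).sum := by
  induction s using Multiset.induction with
  | empty => simp
  | cons a s ih =>
    rw [← Multiset.singleton_add, map_add, map_add, ih, Multiset.toFinsupp_singleton]
    simp [Finsupp.weight_single]

lemma map_toPNat'_map_coe {n : ℕ} (rho : n.Partition) :
    (rho.parts.map Nat.toPNat').map (fun k : ℕ+ => (k : ℕ)) = rho.parts := by
  rw [Multiset.map_map]
  conv_rhs => rw [← Multiset.map_id rho.parts]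
  refine Multiset.map_congr rfl fun x hx => ?_
  simp [Nat.toPNat'_coe, rho.parts_pos hx]

lemma wt_typeVec {n : ℕ} (rho : n.Partition) : wt (typeVec rho) = n := by
  rw [typeVec, wt_toFinsupp, map_toPNat'_map_coe, rho.parts_sum]

lemma typeVec_injective (n : ℕ) : Function.Injective (typeVec (n := n)) := by
  intro a b h
  have h1 := Multiset.toFinsupp.injective h
  ext1
  rw [← map_toPNat'_map_coe a, h1, map_toPNat'_map_coe]

lemma exists_typeVec {n : ℕ} {m : ℕ+ →₀ ℕ} (hm : wt m = n) : ∃ rho : n.Partition, typeVec rho = m := by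
  refine ⟨⟨(Finsupp.toMultiset m).map (fun k : ℕ+ => (k : ℕ)), ?_, ?_⟩, ?_⟩
  · intro i hi
    obtain ⟨k, -, rfl⟩ := Multiset.mem_map.1 hi
    exact k.pos
  · rw [← wt_toFinsupp, Finsupp.toMultiset_toFinsupp, hm]
  · rw [typeVec, Multiset.map_map]
    have : (Nat.toPNat' ∘ fun k : ℕ+ => (k : ℕ)) = id := by
      ext k; simp
    rw [this]
    simp

section Field

variable {K : Type*} [Field K]

lemma coeff_complete (n : ℕ) (m : ℕ+ →₀ ℕ) :
    (complete (K := K) n).coeff m = if wt m = n then (zee m : K)⁻¹ else 0 := by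
  classical
  have : complete (K := K) n = ∑ rho : n.Partition,
      MvPolynomial.monomial (typeVec rho) ((zee (typeVec rho) : K)⁻¹) := rfl
  rw [this, MvPolynomial.coeff_sum]
  simp only [MvPolynomial.coeff_monomial]
  split_ifs with h
  · obtain ⟨rho, rfl⟩ := exists_typeVec h
    rw [Finset.sum_eq_single rho] <;> simp +contextual
    intro b hb hb'
    exact absurd (typeVec_injective _ hb') hb
  · refine Finset.sum_eq_zero fun rho _ => if_neg ?_
    rintro rfl
    exact h (wt_typeVec rho)

lemma complete_zero : complete (K := K) 0 = 1 := by
  ext m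
  rw [coeff_complete, MvPolynomial.coeff_one]
  have : wt m = 0 ↔ 0 = m := by
    rw [eq_comm (a := (0 : ℕ+ →₀ ℕ))]
    constructor
    · intro h
      ext k
      have := Finsupp.le_weight (fun k : ℕ+ => (k : ℕ)) k.ne_zero m
      rw [show Finsupp.weight (fun k : ℕ+ => (k : ℕ)) m = 0 from h] at this
      simpa using this
    · rintro rfl; simp
  simp only [this]
  split_ifs with h
  · subst h; simp [zee]
  · rfl

lemma complete_isHomogeneous (n : ℕ) :
    MvPolynomial.IsWeightedHomogeneous (fun k : ℕ+ => (k : ℕ)) (complete (K := K) n) n := by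
  intro m hm
  rw [coeff_complete] at hm
  by_contra h
  exact hm (if_neg h)

lemma zee_pos (m : ℕ+ →₀ ℕ) : 0 < zee m := by
  refine Finset.prod_pos fun i _ => ?_
  have := i.pos
  positivity

/-- Removing one part `k` divides `z_ρ` by `k m_k`. This ratio drives both Newton's identity and the
pairing with `h_{n-1} h_1`. -/
lemma zee_succ (m : ℕ+ →₀ ℕ) (k : ℕ+) (hk : m k ≠ 0) :
    zee m = k * m k * zee (m - Finsupp.single k 1) := by
  classical
  have h0 : ∀ i : ℕ+, (i : ℕ) ^ 0 * (0).factorial = 1 := by simp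
  have e1 := Finsupp.prod_of_support_subset m (s := m.support) le_rfl
    (fun (i : ℕ+) (a : ℕ) => (i : ℕ) ^ a * a.factorial) (fun i _ => h0 i)
  have e2 := Finsupp.prod_of_support_subset (m - Finsupp.single k 1) (s := m.support)
    (fun i hi => by
      simp only [Finsupp.mem_support_iff, Finsupp.tsub_apply] at hi ⊢
      intro h; simp [h] at hi)
    (fun (i : ℕ+) (a : ℕ) => (i : ℕ) ^ a * a.factorial) (fun i _ => h0 i)
  have hk' : k ∈ m.support := by simpa using hk
  rw [zee, zee, e1, e2, ← Finset.mul_prod_erase _ _ hk', ← Finset.mul_prod_erase _ _ hk', ← mul_assoc]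
  congr 1
  · obtain ⟨a, ha⟩ := Nat.exists_eq_succ_of_ne_zero hk
    simp [ha, Nat.factorial_succ, pow_succ]
    ring
  · refine Finset.prod_congr rfl fun i hi => ?_
    have : i ≠ k := (Finset.mem_erase.1 hi).1
    simp [this.symm]

/-- Generating series of the complete symmetric functions. -/
def hSeries (K : Type*) [Field K] : PowerSeries (Sym K) := PowerSeries.mk complete

/-- Generating series `∑ p_{k+1} u^k` of the power sums. -/
def pSeries (K : Type*) [Field K] : PowerSeries (Sym K) :=
  PowerSeries.mk fun k => MvPolynomial.X k.succPNat

lemma wt_eq_sum_range {n : ℕ} {m : ℕ+ →₀ ℕ} (hm : wt m = n + 1) :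
    ∑ i ∈ Finset.range (n + 1), (i + 1) * m i.succPNat = n + 1 := by
  have hs : ∑ k ∈ m.support, m k * (k : ℕ) = n + 1 := by
    rw [← hm, wt, Finsupp.weight_apply, Finsupp.sum]; simp
  rw [← hs]
  symm
  refine Finset.sum_of_injOn (fun k : ℕ+ => k.natPred) ?_ ?_ ?_ ?_
  · intro a _ b _ h; simpa using h
  · intro k hk
    simp only [Finset.coe_range, Set.mem_Iio]
    have h1 := Finsupp.le_weight_of_ne_zero' (fun k : ℕ+ => (k : ℕ)) (Finsupp.mem_support_iff.1 hk)
    have h2 : Finsupp.weight (fun k : ℕ+ => (k : ℕ)) m = n + 1 := hm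
    have h3 := k.natPred_add_one
    have h4 : (k : ℕ) ≤ n + 1 := h2 ▸ h1
    omega
  · intro i _ hi
    have : i.succPNat ∉ m.support := fun h => hi ⟨_, h, by simp⟩
    simp [Finsupp.notMem_support_iff.1 this]
  · intro k _
    simp [mul_comm]

lemma constantCoeff_hSeries : PowerSeries.constantCoeff (hSeries K) = 1 := by
  rw [← PowerSeries.coeff_zero_eq_constantCoeff_apply, hSeries, PowerSeries.coeff_mk, complete_zero]

variable [CharZero K]

/-- Newton's identity. At the monomial `p^m` the summand with `p_k` contributes `k m_k / z_m`, and
the `k m_k` add up to the weight `n + 1`. -/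
lemma succ_mul_complete (n : ℕ) :
    ((n : Sym K) + 1) * complete (n + 1) =
      ∑ x ∈ Finset.HasAntidiagonal.antidiagonal n, MvPolynomial.X x.1.succPNat * complete x.2 := by
  classical
  ext m
  have hC : ((n : Sym K) + 1) = MvPolynomial.C ((n : K) + 1) := by simp
  rw [hC, MvPolynomial.coeff_C_mul, MvPolynomial.coeff_sum, coeff_complete,
    Finset.Nat.sum_antidiagonal_eq_sum_range_succ
      (fun i j => MvPolynomial.coeff m ((MvPolynomial.X i.succPNat : Sym K) * complete j))]
  have key : ∀ i ∈ Finset.range (n + 1),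
      MvPolynomial.coeff m ((MvPolynomial.X i.succPNat : Sym K) * complete (n - i)) =
        if wt m = n + 1 then (((i + 1) * m i.succPNat : ℕ) : K) * (zee m : K)⁻¹ else 0 := by
    intro i hi
    have hi' := Finset.mem_range.1 hi
    rw [MvPolynomial.coeff_X_mul']
    by_cases h : m i.succPNat = 0
    · simp [h]
    · rw [if_pos (by simpa using h), coeff_complete]
      have hle : Finsupp.single i.succPNat 1 ≤ m := by
        simpa using Nat.one_le_iff_ne_zero.2 h
      have hw : wt (m - Finsupp.single i.succPNat 1) + (i + 1) = wt m := by
        conv_rhs => rw [← tsub_add_cancel_of_le hle, map_add]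
        simp [Finsupp.weight_single]
      have hz := zee_succ m i.succPNat h
      have hz0 : (zee (m - Finsupp.single i.succPNat 1) : K) ≠ 0 := by
        exact_mod_cast (zee_pos _).ne'
      have hm0 : (m i.succPNat : K) ≠ 0 := by exact_mod_cast h
      have hi0 : (i : K) + 1 ≠ 0 := by exact_mod_cast Nat.succ_ne_zero i
      by_cases h2 : wt m = n + 1
      · rw [if_pos h2, if_pos (by omega), hz]
        push_cast
        simp only [Nat.succPNat_coe, Nat.succ_eq_add_one, Nat.cast_add, Nat.cast_one]
        field_simp
      · rw [if_neg h2, if_neg (by omega)]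
  rw [Finset.sum_congr rfl key]
  split_ifs with h
  · rw [← Finset.sum_mul, ← Nat.cast_sum, wt_eq_sum_range h]
    push_cast; ring
  · simp

/-- Newton's identity as the differential equation `H' = P H`. Identities between transforms of `H`
then reduce to comparing logarithmic derivatives, which are linear in the power sums. -/
lemma derivative_hSeries :
    PowerSeries.derivative (Sym K) (hSeries K) = pSeries K * hSeries K := by
  ext1 n
  rw [PowerSeries.coeff_derivative, PowerSeries.coeff_mul, hSeries, pSeries]
  simp only [PowerSeries.coeff_mk]
  rw [mul_comm, succ_mul_complete]

end Field

/-- A linear first order differential equation `F' = P F` has at most one solution with given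
constant term. -/
lemma eq_of_derivative_eq_mul {R : Type*} [CommRing R] [IsDomain R] [CharZero R]
    {P F G : PowerSeries R}
    (hF : PowerSeries.derivative R F = P * F) (hG : PowerSeries.derivative R G = P * G)
    (h0 : PowerSeries.constantCoeff F = PowerSeries.constantCoeff G) : F = G := by
  ext n
  induction n using Nat.strong_induction_on with
  | _ n ih =>
    cases n with
    | zero => simpa using h0
    | succ n =>
      have h1 := congrArg (PowerSeries.coeff n) hF
      have h2 := congrArg (PowerSeries.coeff n) hG
      rw [PowerSeries.coeff_derivative, PowerSeries.coeff_mul] at h1 h2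
      have : ((n : R) + 1) ≠ 0 := by exact_mod_cast Nat.succ_ne_zero n
      apply mul_right_cancel₀ this
      rw [h1, h2]
      refine Finset.sum_congr rfl fun x hx => ?_
      rw [ih x.2 (by have := Finset.HasAntidiagonal.mem_antidiagonal.1 hx; omega)]

lemma derivative_mul {R : Type*} [CommRing R] (F G : PowerSeries R) :
    PowerSeries.derivative R (F * G) =
      F * PowerSeries.derivative R G + G * PowerSeries.derivative R F := by
  rw [Derivation.leibniz, smul_eq_mul, smul_eq_mul]

lemma derivative_map {R S : Type*} [CommRing R] [CommRing S] (f : R →+* S) (F : PowerSeries R) :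
    PowerSeries.derivative S (PowerSeries.map f F) =
      PowerSeries.map f (PowerSeries.derivative R F) := by
  ext n
  simp [PowerSeries.coeff_derivative]

end HilbChar

end

noncomputable section

namespace HilbChar

/-! ### Plethystic substitutions and vertex operators -/

section Field

variable {K : Type*} [Field K]

/-- The inverse `1 / H(u)`, with coefficients `(-1)^k e_k`. -/
def eSeries (K : Type*) [Field K] : PowerSeries (Sym K) := PowerSeries.invOfUnit (hSeries K) 1

lemma hSeries_mul_eSeries : hSeries K * eSeries K = 1 :=
  PowerSeries.mul_invOfUnit _ _ (by simpa using constantCoeff_hSeries)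

/-- The series `H(q u)`. -/
def hSeriesScaled (q : K) : PowerSeries (Sym K) :=
  PowerSeries.mk fun n => MvPolynomial.C (q ^ n) * complete n

/-- The series of the `h_k[X(q-1)]`, i.e. `H(q u) / H(u)`. -/
def qSeries (q : K) : PowerSeries (Sym K) :=
  PowerSeries.map (plethOneSub q : Sym K →+* Sym K) (eSeries K)

/-- The translation `p_k ↦ p_k + c_k y^k`. -/
def translate (c : ℕ+ → K) : Sym K →ₐ[K] Polynomial (Sym K) :=
  MvPolynomial.aeval fun k : ℕ+ =>
    Polynomial.C (MvPolynomial.X k) +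
      Polynomial.C (MvPolynomial.C (c k)) * Polynomial.X ^ (k : ℕ)

/-- The `Sym K`-linear functional on polynomials in `y` with `y^k ↦ a_k`. -/
def contract (a : PowerSeries (Sym K)) : Polynomial (Sym K) →ₗ[Sym K] Sym K :=
  Polynomial.lsum fun k => LinearMap.id.smulRight (PowerSeries.coeff k a)

lemma contract_C_mul_X_pow (a : PowerSeries (Sym K)) (f : Sym K) (k : ℕ) :
    contract a (Polynomial.C f * Polynomial.X ^ k) = f * PowerSeries.coeff k a := by
  rw [contract, Polynomial.C_mul_X_pow_eq_monomial]
  simp [Polynomial.lsum_apply]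

lemma contract_C_mul (a : PowerSeries (Sym K)) (f : Sym K) (g : Polynomial (Sym K)) :
    contract a (Polynomial.C f * g) = f * contract a g := by
  rw [← Polynomial.smul_eq_C_mul, map_smul, smul_eq_mul]

/-- The vertex operator `f ↦ contract a (translate c f)`. -/
def vertexOp (c : ℕ+ → K) (a : PowerSeries (Sym K)) : Sym K →ₗ[K] Sym K :=
  ((contract a).restrictScalars K).comp (translate c).toLinearMap

lemma vertexOp_apply (c : ℕ+ → K) (a : PowerSeries (Sym K)) (f : Sym K) :
    vertexOp c a f = contract a (translate c f) := rfl

/-- The operator `f ↦ [z^0] f[X + (1-q)(1-t)/z] Ω[-zX]`, whose eigenvectors are the modified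
Macdonald functions. -/
def macOp (q t : K) : Sym K →ₗ[K] Sym K :=
  vertexOp (fun k => (1 - q ^ (k : ℕ)) * (1 - t ^ (k : ℕ))) (eSeries K)

/-- The conjugate of `macOp q t` by `plethOneSub q`. -/
def macOpConj (q t : K) : Sym K →ₗ[K] Sym K :=
  vertexOp (fun k => 1 - t ^ (k : ℕ)) (qSeries q)

lemma macOp_comm (q t : K) : macOp q t = macOp t q := by
  simp only [macOp, mul_comm]

lemma plethOneSub_contract (q : K) (g : Polynomial (Sym K)) :
    plethOneSub q (contract (eSeries K) g) =
      contract (qSeries q) (g.map (plethOneSub q : Sym K →+* Sym K)) := by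
  induction g using Polynomial.induction_on' with
  | add f g hf hg => simp [hf, hg]
  | monomial n a =>
    rw [Polynomial.map_monomial, ← Polynomial.C_mul_X_pow_eq_monomial,
      ← Polynomial.C_mul_X_pow_eq_monomial, contract_C_mul_X_pow, contract_C_mul_X_pow, map_mul,
      qSeries, PowerSeries.coeff_map]
    rfl

lemma plethOneSub_X (q : K) (k : ℕ+) :
    plethOneSub q (MvPolynomial.X k) = MvPolynomial.C (1 - q ^ (k : ℕ)) * MvPolynomial.X k := by
  simp [plethOneSub]

lemma translate_X (c : ℕ+ → K) (k : ℕ+) :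
    translate c (MvPolynomial.X k) = Polynomial.C (MvPolynomial.X k) +
      Polynomial.C (MvPolynomial.C (c k)) * Polynomial.X ^ (k : ℕ) := by
  simp [translate]

lemma translate_C (c : ℕ+ → K) (a : K) :
    translate c (MvPolynomial.C a) = Polynomial.C (MvPolynomial.C a) := by
  rw [← MvPolynomial.algebraMap_eq, AlgHom.commutes]
  rfl

/-- On `p_k` both sides are `(1 - q^k)(p_k + (1 - t^k) y^k)`: the factor `1 - q^k` of the shift is
absorbed by the substitution. -/
lemma map_translate (q t : K) (f : Sym K) :
    (translate (fun k => (1 - q ^ (k : ℕ)) * (1 - t ^ (k : ℕ))) f).map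
        (plethOneSub q : Sym K →+* Sym K) =
      translate (fun k => 1 - t ^ (k : ℕ)) (plethOneSub q f) := by
  have hC : ∀ a : K, plethOneSub q (MvPolynomial.C a) = MvPolynomial.C a := fun a => by
    rw [← MvPolynomial.algebraMap_eq, AlgHom.commutes]
  induction f using MvPolynomial.induction_on with
  | C a => simp [hC]
  | add f g hf hg => simp [hf, hg]
  | mul_X f k hf =>
    rw [map_mul, Polynomial.map_mul, hf, map_mul, map_mul, translate_X, plethOneSub_X,
      map_mul (translate _), translate_C, translate_X]
    congr 1
    simp [plethOneSub_X, hC]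
    ring

lemma plethOneSub_macOp (q t : K) (f : Sym K) :
    plethOneSub q (macOp q t f) = macOpConj q t (plethOneSub q f) := by
  rw [macOp, vertexOp_apply, plethOneSub_contract, map_translate, macOpConj, vertexOp_apply]

/-- The coefficients of `(1 - t u y) / (1 - u y)`. -/
def geomCoeff (t : K) (k : ℕ) : K := if k = 0 then 1 else 1 - t

/-- The logarithmic derivative of `(1 - t v)/(1 - v)` is `∑ (1 - t^(k+1)) v^k`; these are its
coefficients cleared of denominators. -/
lemma succ_mul_geomCoeff (t : K) (n : ℕ) :
    ((n : K) + 1) * geomCoeff t (n + 1) =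
      ∑ x ∈ Finset.HasAntidiagonal.antidiagonal n, (1 - t ^ (x.1 + 1)) * geomCoeff t x.2 := by
  rw [Finset.Nat.sum_antidiagonal_eq_sum_range_succ
    (fun i j => (1 - t ^ (i + 1)) * geomCoeff t j), Finset.sum_range_succ]
  have : ∀ i ∈ Finset.range n, (1 - t ^ (i + 1)) * geomCoeff t (n - i) =
      (1 - t) - (1 - t) * t * t ^ i := by
    intro i hi
    have := Finset.mem_range.1 hi
    rw [geomCoeff, if_neg (by omega)]
    ring
  rw [Finset.sum_congr rfl this, Finset.sum_sub_distrib, ← Finset.mul_sum]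
  have hg := mul_geom_sum t n
  simp [geomCoeff]
  linear_combination -t * hg

variable [CharZero K]

lemma derivative_hSeriesScaled (q : K) :
    PowerSeries.derivative (Sym K) (hSeriesScaled q) =
      (PowerSeries.mk fun k => MvPolynomial.C (q ^ (k + 1)) * MvPolynomial.X k.succPNat) *
        hSeriesScaled q := by
  ext1 n
  rw [PowerSeries.coeff_derivative, PowerSeries.coeff_mul, hSeriesScaled]
  simp only [PowerSeries.coeff_mk]
  rw [mul_assoc, mul_comm (complete _), succ_mul_complete, Finset.mul_sum]
  refine Finset.sum_congr rfl fun x hx => ?_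
  have h := Finset.HasAntidiagonal.mem_antidiagonal.1 hx
  rw [show n + 1 = (x.1 + 1) + x.2 by omega, pow_add q (x.1 + 1), map_mul]
  ring

/-- The logarithmic derivatives agree, because `(1 - q^k) p_k + q^k p_k = p_k`. -/
lemma map_plethOneSub_hSeries_mul (q : K) :
    PowerSeries.map (plethOneSub q : Sym K →+* Sym K) (hSeries K) * hSeriesScaled q = hSeries K := by
  refine eq_of_derivative_eq_mul (P := pSeries K) ?_ derivative_hSeries ?_
  · rw [derivative_mul, derivative_map, derivative_hSeries, derivative_hSeriesScaled, map_mul]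
    have : pSeries K = PowerSeries.map (plethOneSub q : Sym K →+* Sym K) (pSeries K) +
        (PowerSeries.mk fun k => MvPolynomial.C (q ^ (k + 1)) * MvPolynomial.X k.succPNat) := by
      ext1 n
      simp [pSeries, plethOneSub_X]
      ring
    conv_rhs => rw [this]
    ring
  · rw [map_mul, constantCoeff_hSeries]
    have h1 : PowerSeries.constantCoeff
        (PowerSeries.map (plethOneSub q : Sym K →+* Sym K) (hSeries K)) = 1 := by
      rw [← PowerSeries.coeff_zero_eq_constantCoeff_apply, PowerSeries.coeff_map,
        PowerSeries.coeff_zero_eq_constantCoeff_apply, constantCoeff_hSeries, map_one]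
    rw [h1, ← PowerSeries.coeff_zero_eq_constantCoeff_apply, hSeriesScaled]
    simp [complete_zero]

lemma qSeries_mul_hSeries (q : K) : qSeries q * hSeries K = hSeriesScaled q := by
  have h1 : qSeries q * PowerSeries.map (plethOneSub q : Sym K →+* Sym K) (hSeries K) = 1 := by
    rw [qSeries, ← map_mul, mul_comm, hSeries_mul_eSeries, map_one]
  calc qSeries q * hSeries K = qSeries q *
      (PowerSeries.map (plethOneSub q : Sym K →+* Sym K) (hSeries K) * hSeriesScaled q) := by
        rw [map_plethOneSub_hSeries_mul]
    _ = hSeriesScaled q := by rw [← mul_assoc, h1, one_mul]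

lemma constantCoeff_qSeries (q : K) : PowerSeries.coeff 0 (qSeries q) = 1 := by
  have h := congrArg PowerSeries.constantCoeff (qSeries_mul_hSeries q)
  rw [map_mul, constantCoeff_hSeries, mul_one] at h
  rw [PowerSeries.coeff_zero_eq_constantCoeff_apply, h,
    ← PowerSeries.coeff_zero_eq_constantCoeff_apply, hSeriesScaled]
  simp [complete_zero]

lemma sum_qSeries_mul_complete (q : K) (n : ℕ) :
    ∑ j ∈ Finset.range (n + 1), PowerSeries.coeff j (qSeries q) * complete (n - j) =
      MvPolynomial.C (q ^ n) * complete n := by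
  have h := congrArg (PowerSeries.coeff n) (qSeries_mul_hSeries q)
  rw [PowerSeries.coeff_mul, Finset.Nat.sum_antidiagonal_eq_sum_range_succ
    (fun i j => PowerSeries.coeff i (qSeries q) * PowerSeries.coeff j (hSeries K))] at h
  simpa [hSeries, hSeriesScaled] using h

/-- Shifting `p_k` by `(1 - t^k) y^k` multiplies `H(u)` by `(1 - t u y)/(1 - u y)`, once more by
comparing logarithmic derivatives. -/
lemma map_translate_hSeries (t : K) :
    PowerSeries.map (translate (fun k => 1 - t ^ (k : ℕ)) : Sym K →+* Polynomial (Sym K))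
        (hSeries K) =
      PowerSeries.map Polynomial.C (hSeries K) *
        PowerSeries.mk fun k => Polynomial.C (MvPolynomial.C (geomCoeff t k)) * Polynomial.X ^ k := by
  set W : PowerSeries (Polynomial (Sym K)) :=
    PowerSeries.mk fun k => Polynomial.C (MvPolynomial.C (geomCoeff t k)) * Polynomial.X ^ k with hW
  set c : ℕ+ → K := fun k => 1 - t ^ (k : ℕ) with hc
  have hdW : PowerSeries.derivative (Polynomial (Sym K)) W =
      (PowerSeries.mk fun k => Polynomial.C (MvPolynomial.C (1 - t ^ (k + 1))) *
        Polynomial.X ^ (k + 1)) * W := by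
    ext1 n
    rw [PowerSeries.coeff_derivative, PowerSeries.coeff_mul, hW]
    simp only [PowerSeries.coeff_mk]
    have : ∀ x ∈ Finset.HasAntidiagonal.antidiagonal n,
        (Polynomial.C (MvPolynomial.C (1 - t ^ (x.1 + 1))) * Polynomial.X ^ (x.1 + 1) *
          (Polynomial.C (MvPolynomial.C (geomCoeff t x.2)) * Polynomial.X ^ x.2) :
            Polynomial (Sym K)) =
        Polynomial.C (MvPolynomial.C ((1 - t ^ (x.1 + 1)) * geomCoeff t x.2)) *
          Polynomial.X ^ (n + 1) := by
      intro x hx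
      have h := Finset.HasAntidiagonal.mem_antidiagonal.1 hx
      rw [show n + 1 = (x.1 + 1) + x.2 by omega, pow_add Polynomial.X, map_mul, map_mul]
      ring
    rw [Finset.sum_congr rfl this, ← Finset.sum_mul, ← map_sum, ← map_sum, ← succ_mul_geomCoeff]
    simp
    ring
  refine eq_of_derivative_eq_mul
    (P := PowerSeries.map (translate c : Sym K →+* Polynomial (Sym K)) (pSeries K)) ?_ ?_ ?_
  · rw [derivative_map, derivative_hSeries, map_mul]
  · rw [derivative_mul, derivative_map, derivative_hSeries, hdW, map_mul]
    have : PowerSeries.map (translate c : Sym K →+* Polynomial (Sym K)) (pSeries K) =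
        PowerSeries.map Polynomial.C (pSeries K) +
        (PowerSeries.mk fun k => Polynomial.C (MvPolynomial.C (1 - t ^ (k + 1))) *
        Polynomial.X ^ (k + 1)) := by
      ext1 n
      simp [pSeries, translate_X, hc]
    rw [this]
    ring
  · rw [map_mul, ← PowerSeries.coeff_zero_eq_constantCoeff_apply,
      ← PowerSeries.coeff_zero_eq_constantCoeff_apply,
      ← PowerSeries.coeff_zero_eq_constantCoeff_apply, hW, hSeries]
    simp [complete_zero, geomCoeff]

lemma translate_complete (t : K) (n : ℕ) :
    translate (fun k => 1 - t ^ (k : ℕ)) (complete (K := K) n) =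
      ∑ k ∈ Finset.range (n + 1), Polynomial.C (complete (n - k)) *
        (Polynomial.C (MvPolynomial.C (geomCoeff t k)) * Polynomial.X ^ k) := by
  have h := congrArg (PowerSeries.coeff n) (map_translate_hSeries t)
  rw [PowerSeries.coeff_mul, ← Finset.Nat.sum_antidiagonal_swap,
    Finset.Nat.sum_antidiagonal_eq_sum_range_succ_mk] at h
  simpa [hSeries] using h

end Field

end HilbChar

end

noncomputable section

namespace HilbChar

/-! ### The action of the conjugated operator on Jacobi–Trudi determinants -/

/-- Multilinearity, altering one row at a time. Terms with `v` in two rows vanish, so the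
determinant is affine in the perturbation. -/
lemma det_add_rankOne_rows {ι R : Type*} [Fintype ι] [DecidableEq ι] [CommRing R]
    (M : Matrix ι ι R) (w v : ι → R) (s : Finset ι) :
    (Matrix.of fun i j => M i j + (if i ∈ s then w i else 0) * v j).det =
      M.det + ∑ i ∈ s, w i * (M.updateRow i v).det := by
  induction s using Finset.induction_on with
  | empty => simp; rfl
  | insert a s ha ih =>
    rw [Finset.sum_insert ha, add_left_comm, ← ih]
    set N : Matrix ι ι R := Matrix.of fun i j => M i j + (if i ∈ s then w i else 0) * v j with hN
    have h1 : (Matrix.of fun i j => M i j + (if i ∈ insert a s then w i else 0) * v j) =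
        N.updateRow a (N a + w a • v) := by
      ext i j
      by_cases hi : i = a
      · subst hi; simp [hN, ha]
      · simp [hN, hi]
    rw [h1, Matrix.det_updateRow_add, Matrix.updateRow_eq_self, Matrix.det_updateRow_smul, add_comm]
    congr 2
    -- Row `a` is now `v`, so the multiples of `v` already added to the rows in `s` can be
    -- subtracted off.
    refine Matrix.det_eq_of_forall_row_eq_smul_add_const (fun i => if i ∈ s then w i else 0) a
      (by simp [ha]) fun i j => ?_
    by_cases hi : i = a
    · subst hi; simp [ha]
    · simp [Matrix.updateRow_ne hi, hN]

lemma det_add_rankOne {ι R : Type*} [Fintype ι] [DecidableEq ι] [CommRing R]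
    (M : Matrix ι ι R) (v w : ι → R) :
    (Matrix.of fun i j => M i j + v i * w j).det =
      M.det + ∑ j, w j * (M.updateCol j v).det := by
  have h := det_add_rankOne_rows M.transpose w v Finset.univ
  simp only [Finset.mem_univ, if_true, Matrix.det_transpose] at h
  rw [← Matrix.det_transpose]
  convert h using 3 with j hj
  · ext i j; simp [mul_comm]
  · rw [Matrix.updateRow_transpose, Matrix.det_transpose]

section Field

variable {K : Type*} [Field K]

lemma completeInt_natCast (n : ℕ) : completeInt (K := K) (n : ℤ) = complete n := by
  simp [completeInt]

lemma completeInt_of_neg {m : ℤ} (h : m < 0) : completeInt (K := K) m = 0 := by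
  rw [completeInt, if_neg (by omega)]

/-- The polynomial `∑_{k ≥ 1} h_{m-k} y^k`. -/
def hTail (K : Type*) [Field K] (m : ℤ) : Polynomial (Sym K) :=
  ∑ k ∈ Finset.range m.toNat, Polynomial.C (completeInt (m - 1 - k)) * Polynomial.X ^ (k + 1)

lemma hTail_succ (m : ℤ) :
    hTail K (m + 1) = Polynomial.X * (Polynomial.C (completeInt m) + hTail K m) := by
  rcases lt_or_ge m 0 with h | h
  · rw [completeInt_of_neg h, hTail, hTail, Int.toNat_of_nonpos (by omega),
      Int.toNat_of_nonpos (by omega)]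
    simp
  · lift m to ℕ using h
    rw [hTail, hTail, show ((m : ℤ) + 1).toNat = m + 1 by omega, Int.toNat_natCast,
      Finset.sum_range_succ', mul_add, Finset.mul_sum, add_comm]
    refine congrArg₂ (· + ·) ?_ ?_
    · simp
    · refine Finset.sum_congr rfl fun k _ => ?_
      rw [show (m : ℤ) + 1 - 1 - ((k + 1 : ℕ) : ℤ) = m - 1 - k by push_cast; ring]
      ring

lemma hTail_add (l : ℤ) (j : ℕ) :
    hTail K (l + j) = Polynomial.X ^ j * hTail K l +
      ∑ k ∈ Finset.range j, Polynomial.X ^ (j - k) * Polynomial.C (completeInt (l + k)) := by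
  induction j with
  | zero => simp
  | succ j ih =>
    rw [show l + ((j + 1 : ℕ) : ℤ) = (l + j) + 1 by push_cast; ring, hTail_succ, ih,
      Finset.sum_range_succ, mul_add, mul_add, Finset.mul_sum]
    have : ∀ k ∈ Finset.range j, (Polynomial.X : Polynomial (Sym K)) *
        (Polynomial.X ^ (j - k) * Polynomial.C (completeInt (l + k))) =
        Polynomial.X ^ (j + 1 - k) * Polynomial.C (completeInt (l + k)) := by
      intro k hk
      have := Finset.mem_range.1 hk
      rw [show j + 1 - k = (j - k) + 1 by omega]
      ring
    rw [Finset.sum_congr rfl this]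
    simp
    ring

variable [CharZero K]

lemma translate_completeInt (t : K) (m : ℤ) :
    translate (fun k => 1 - t ^ (k : ℕ)) (completeInt (K := K) m) =
      Polynomial.C (completeInt m) + Polynomial.C (MvPolynomial.C (1 - t)) * hTail K m := by
  rcases lt_or_ge m 0 with h | h
  · rw [completeInt_of_neg h, hTail, Int.toNat_of_nonpos (by omega)]
    simp
  · lift m to ℕ using h
    rw [completeInt_natCast, translate_complete, hTail, Int.toNat_natCast,
      Finset.sum_range_succ', Finset.mul_sum, add_comm]
    refine congrArg₂ (· + ·) ?_ ?_
    · simp [geomCoeff]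
    · refine Finset.sum_congr rfl fun k hk => ?_
      have := Finset.mem_range.1 hk
      rw [show (m : ℤ) - 1 - k = ((m - (k + 1) : ℕ) : ℤ) by omega, completeInt_natCast, geomCoeff,
        if_neg (by omega)]
      ring

/-- Contraction turns the tail into the terms `j > r` of `∑_j a_j h_{m+r-j} = q^(m+r) h_{m+r}`,
where the `a_j` are the coefficients of `qSeries q`; the terms `j ≤ r` are what is subtracted. -/
lemma contract_hTail (q : K) (m : ℤ) (r : ℕ) :
    contract (qSeries q) (Polynomial.X ^ r * hTail K m) =
      MvPolynomial.C (q ^ (m + r)) * completeInt (m + r) -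
        ∑ j ∈ Finset.range (r + 1), PowerSeries.coeff j (qSeries q) * completeInt (m + r - j) := by
  have h1 : contract (qSeries q) (Polynomial.X ^ r * hTail K m) =
      ∑ k ∈ Finset.range m.toNat,
        PowerSeries.coeff (r + 1 + k) (qSeries q) * completeInt (m - 1 - k) := by
    rw [hTail, Finset.mul_sum, map_sum]
    refine Finset.sum_congr rfl fun k _ => ?_
    rw [mul_left_comm, ← pow_add, contract_C_mul_X_pow, mul_comm,
      show r + (k + 1) = r + 1 + k by ring]
  rw [h1, eq_sub_iff_add_eq]
  rcases lt_or_ge (m + r) 0 with h | h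
  · rw [Int.toNat_of_nonpos (by omega), completeInt_of_neg h]
    simp only [Finset.range_zero, Finset.sum_empty, mul_zero, zero_add]
    exact Finset.sum_eq_zero fun j _ => by rw [completeInt_of_neg (by omega), mul_zero]
  · obtain ⟨n, hn⟩ := Int.eq_ofNat_of_zero_le h
    have h2 := sum_qSeries_mul_complete q n
    have h3 : ∀ j ∈ Finset.range (n + 1), PowerSeries.coeff j (qSeries q) * complete (n - j) =
        PowerSeries.coeff j (qSeries q) * completeInt (m + r - j) := by
      intro j hj
      have := Finset.mem_range.1 hj
      rw [hn, show (n : ℤ) - j = ((n - j : ℕ) : ℤ) by omega, completeInt_natCast]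
    rw [Finset.sum_congr rfl h3] at h2
    rw [show MvPolynomial.C (q ^ (m + r)) * completeInt (m + r) =
      (MvPolynomial.C (q ^ n) * complete n : Sym K) by rw [hn, completeInt_natCast, zpow_natCast],
      ← h2]
    -- For `m < 0 ≤ m + r` the tail is empty and the range `j ≤ r` already contains every nonzero
    -- term.
    rcases lt_or_ge m 0 with h | h
    · rw [Int.toNat_of_nonpos (by omega)]
      simp only [Finset.range_zero, Finset.sum_empty, zero_add]
      symm
      refine Finset.sum_subset (by intro x; simp; omega) fun j _ hj => ?_
      rw [Finset.mem_range] at hj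
      rw [completeInt_of_neg (by omega), mul_zero]
    · rw [show n + 1 = (r + 1) + m.toNat by omega, Finset.sum_range_add _ (r + 1), add_comm]
      refine congrArg₂ (· + ·) rfl ?_
      refine Finset.sum_congr rfl fun k _ => ?_
      rw [show m + r - ((r + 1 + k : ℕ) : ℤ) = m - 1 - k by push_cast; ring]

/-- The Jacobi–Trudi matrix `(h_{l_i + j})`. -/
def jtMatrix (K : Type*) [Field K] {N : ℕ} (l : Fin N → ℤ) : Matrix (Fin N) (Fin N) (Sym K) :=
  Matrix.of fun i j => completeInt (l i + (j : ℤ))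

/-- The transition matrix in the factorization of the translated Jacobi–Trudi matrix. -/
def unitri (t : K) (N : ℕ) : Matrix (Fin N) (Fin N) (Polynomial (Sym K)) :=
  Matrix.of fun k j => if (k : ℕ) = j then 1 else
    if (k : ℕ) < j then Polynomial.C (MvPolynomial.C (1 - t)) * Polynomial.X ^ ((j : ℕ) - k) else 0

end Field

section Field

variable {K : Type*} [Field K]

lemma det_unitri (t : K) (N : ℕ) : (unitri t N).det = 1 := by
  rw [Matrix.det_of_isUpperTriangular]
  · simp [unitri]
  · intro i j hij
    have : (j : ℕ) < i := hij
    simp only [unitri, Matrix.of_apply]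
    rw [if_neg (by omega), if_neg (by omega)]

lemma mul_unitri_apply (t : K) {N : ℕ} (f : ℕ → Polynomial (Sym K)) (j : Fin N) :
    ∑ k : Fin N, f k * unitri t N k j = f j +
      ∑ k ∈ Finset.range j, f k * (Polynomial.C (MvPolynomial.C (1 - t)) * Polynomial.X ^ ((j : ℕ) - k)) := by
  have := Fin.sum_univ_eq_sum_range (fun k => f k * (if k = j then 1 else
    if k < (j : ℕ) then Polynomial.C (MvPolynomial.C (1 - t)) * Polynomial.X ^ ((j : ℕ) - k) else 0)) N
  simp only [unitri, Matrix.of_apply]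
  rw [this]
  have hj := j.2
  obtain ⟨d, hd⟩ := Nat.exists_eq_add_of_lt hj
  have hN : Finset.range N = Finset.range ((j : ℕ) + 1 + d) := by congr 1; omega
  rw [hN, Finset.sum_range_add, Finset.sum_range_succ]
  rw [Finset.sum_eq_zero (s := Finset.range d)]
  · simp only [if_true, mul_one, add_zero]
    rw [add_comm]
    refine congrArg₂ (· + ·) rfl (Finset.sum_congr rfl fun k hk => ?_)
    have := Finset.mem_range.1 hk
    rw [if_neg (by omega), if_pos this]
  · intro k _
    rw [if_neg (by omega), if_neg (by omega), mul_zero]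

variable [CharZero K]

/-- The tail of `h_{l+j}` is `y^j` times the tail of `h_l`, plus combinations of earlier columns. Up
to unitriangular column operations the shifted matrix is therefore the old one plus a rank one
matrix. Undoing these operations on the rank one part leaves the geometric weights `(1-t) t^j`. -/
lemma map_translate_jtMatrix (t : K) {N : ℕ} (l : Fin N → ℤ) :
    (translate (fun k => 1 - t ^ (k : ℕ)) : Sym K →+* Polynomial (Sym K)).mapMatrix (jtMatrix K l) =
      (Matrix.of fun i j : Fin N =>
        (Polynomial.C : Sym K →+* Polynomial (Sym K)).mapMatrix (jtMatrix K l) i j +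
        hTail K (l i) * (Polynomial.C (MvPolynomial.C ((1 - t) * t ^ (j : ℕ))) * Polynomial.X ^ (j : ℕ))) *
      unitri t N := by
  refine Matrix.ext fun i j => ?_
  rw [Matrix.mul_apply]
  simp only [Matrix.of_apply, jtMatrix, RingHom.mapMatrix_apply, Matrix.map_apply]
  rw [mul_unitri_apply t (fun k => Polynomial.C (completeInt (l i + k)) +
        hTail K (l i) * (Polynomial.C (MvPolynomial.C ((1 - t) * t ^ k)) * Polynomial.X ^ k)) j,
    show ((translate (fun k => 1 - t ^ (k : ℕ)) : Sym K →+* Polynomial (Sym K))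
      (completeInt (l i + (j : ℕ)))) = translate (fun k => 1 - t ^ (k : ℕ))
        (completeInt (l i + (j : ℕ))) from rfl, translate_completeInt, hTail_add]
  have hk : ∀ k ∈ Finset.range (j : ℕ), (Polynomial.C (completeInt (l i + k)) +
        hTail K (l i) * (Polynomial.C (MvPolynomial.C ((1 - t) * t ^ k)) * Polynomial.X ^ k)) *
        (Polynomial.C (MvPolynomial.C (1 - t)) * Polynomial.X ^ ((j : ℕ) - k)) =
      Polynomial.C (MvPolynomial.C (1 - t)) * (Polynomial.X ^ ((j : ℕ) - k) *
        Polynomial.C (completeInt (l i + k))) +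
      (Polynomial.C (MvPolynomial.C (1 - t)) * hTail K (l i) * Polynomial.X ^ (j : ℕ)) *
        (Polynomial.C (MvPolynomial.C ((1 - t) * t ^ k))) := by
    intro k hk
    have := Finset.mem_range.1 hk
    obtain ⟨d, hd⟩ := Nat.exists_eq_add_of_lt this
    rw [hd, show k + d + 1 - k = d + 1 by omega]
    ring
  rw [Finset.sum_congr rfl hk, Finset.sum_add_distrib, ← Finset.mul_sum, ← Finset.mul_sum,
    ← map_sum, ← map_sum, ← Finset.mul_sum]
  have hg : (1 - t) * ∑ k ∈ Finset.range (j : ℕ), t ^ k = 1 - t ^ (j : ℕ) := by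
    rw [mul_comm, geom_sum_mul_neg]
  rw [hg]
  simp only [map_sub, map_mul, map_one, map_pow]
  ring

lemma translate_det_jtMatrix (t : K) {N : ℕ} (l : Fin N → ℤ) :
    translate (fun k => 1 - t ^ (k : ℕ)) (jtMatrix K l).det =
      Polynomial.C (jtMatrix K l).det + ∑ r : Fin N,
        Polynomial.C (MvPolynomial.C ((1 - t) * t ^ (r : ℕ))) * (Polynomial.X ^ (r : ℕ) *
          ∑ i, Polynomial.C ((jtMatrix K l).adjugate r i) * hTail K (l i)) := by
  have h := congrArg Matrix.det (map_translate_jtMatrix t l)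
  rw [Matrix.det_mul, det_unitri, mul_one, det_add_rankOne, ← RingHom.map_det,
    ← RingHom.map_det] at h
  rw [show translate (fun k => 1 - t ^ (k : ℕ)) (jtMatrix K l).det =
    (translate (fun k => 1 - t ^ (k : ℕ)) : Sym K →+* Polynomial (Sym K)) (jtMatrix K l).det
    from rfl, h]
  refine congrArg₂ (· + ·) rfl ?_
  refine Finset.sum_congr rfl fun r _ => ?_
  rw [← Matrix.cramer_apply, Matrix.cramer_eq_adjugate_mulVec, ← RingHom.map_adjugate]
  simp only [Matrix.mulVec, dotProduct, RingHom.mapMatrix_apply, Matrix.map_apply]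
  ring

/-- By the rank one formula the shifted determinant is linear in the tails, so it can be contracted
by `contract_hTail` inside Cramer's rule. The subtracted vectors are columns of the matrix itself;
only the one for `j = 0` survives, giving `-det`. The weights `(1-t) t^r` sum to `1 - t^N`, which
leaves `t^N det`. -/
lemma macOpConj_det_jtMatrix (q t : K) {N : ℕ} (l : Fin N → ℤ) :
    macOpConj q t (jtMatrix K l).det =
      MvPolynomial.C (t ^ N) * (jtMatrix K l).det + ∑ r : Fin N,
        MvPolynomial.C ((1 - t) * t ^ (r : ℕ)) * ((jtMatrix K l).updateCol r fun i =>
          MvPolynomial.C (q ^ (l i + (r : ℤ))) * completeInt (l i + (r : ℤ))).det := by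
  rw [macOpConj, vertexOp_apply, translate_det_jtMatrix, map_add, map_sum]
  have h0 : contract (qSeries q) (Polynomial.C (jtMatrix K l).det) = (jtMatrix K l).det := by
    have := contract_C_mul_X_pow (qSeries q) (jtMatrix K l).det 0
    rwa [pow_zero, mul_one, constantCoeff_qSeries, mul_one] at this
  have h1 : ∀ r : Fin N, contract (qSeries q) (Polynomial.C (MvPolynomial.C ((1 - t) * t ^ (r : ℕ))) *
      (Polynomial.X ^ (r : ℕ) * ∑ i, Polynomial.C ((jtMatrix K l).adjugate r i) * hTail K (l i))) =
      MvPolynomial.C ((1 - t) * t ^ (r : ℕ)) * ((jtMatrix K l).updateCol r fun i =>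
          MvPolynomial.C (q ^ (l i + (r : ℤ))) * completeInt (l i + (r : ℤ))).det -
      MvPolynomial.C ((1 - t) * t ^ (r : ℕ)) * (jtMatrix K l).det := by
    intro r
    rw [contract_C_mul, ← mul_sub]
    congr 1
    rw [Finset.mul_sum, map_sum]
    have h2 : ∀ i, contract (qSeries q) (Polynomial.X ^ (r : ℕ) *
        (Polynomial.C ((jtMatrix K l).adjugate r i) * hTail K (l i))) =
        (jtMatrix K l).adjugate r i * (MvPolynomial.C (q ^ (l i + (r : ℤ))) * completeInt (l i + (r : ℤ)) -
        ∑ j ∈ Finset.range ((r : ℕ) + 1),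
          PowerSeries.coeff j (qSeries q) * completeInt (l i + (r : ℤ) - j)) := by
      intro i
      rw [mul_left_comm, contract_C_mul, contract_hTail]
    rw [Finset.sum_congr rfl fun i _ => h2 i]
    have h3 : (jtMatrix K l).cramer (fun i =>
        MvPolynomial.C (q ^ (l i + (r : ℤ))) * completeInt (l i + (r : ℤ)) -
        ∑ j ∈ Finset.range ((r : ℕ) + 1),
          PowerSeries.coeff j (qSeries q) * completeInt (l i + (r : ℤ) - j)) r = ∑ i,
        (jtMatrix K l).adjugate r i * (MvPolynomial.C (q ^ (l i + (r : ℤ))) * completeInt (l i + (r : ℤ)) -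
        ∑ j ∈ Finset.range ((r : ℕ) + 1),
          PowerSeries.coeff j (qSeries q) * completeInt (l i + (r : ℤ) - j)) := by
      rw [Matrix.cramer_eq_adjugate_mulVec]; rfl
    rw [← h3]
    have h4 : (fun i =>
        MvPolynomial.C (q ^ (l i + (r : ℤ))) * completeInt (l i + (r : ℤ)) -
        ∑ j ∈ Finset.range ((r : ℕ) + 1),
          PowerSeries.coeff j (qSeries q) * completeInt (l i + (r : ℤ) - j)) =
        (fun i => MvPolynomial.C (q ^ (l i + (r : ℤ))) * completeInt (l i + (r : ℤ))) -
        ∑ j ∈ Finset.range ((r : ℕ) + 1), PowerSeries.coeff j (qSeries q) •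
          fun i => completeInt (l i + (r : ℤ) - j) := by
      ext1 i; simp
    rw [h4, map_sub, map_sum, Pi.sub_apply, Matrix.cramer_apply, Finset.sum_apply]
    congr 1
    rw [Finset.sum_eq_single 0]
    · rw [map_smul, constantCoeff_qSeries, one_smul, Matrix.cramer_row_self (i := r)]
      · simp
      · intro i; simp [jtMatrix]
    -- For `j > 0` the vector is column `r - j`, so putting it in column `r` gives two equal
    -- columns.
    · intro j hj hj0
      have hj' := Finset.mem_range.1 hj
      have hlt : (r : ℕ) - j < N := by omega
      rw [map_smul, Matrix.cramer_row_self (i := ⟨(r : ℕ) - j, hlt⟩)]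
      · have : r ≠ ⟨(r : ℕ) - j, hlt⟩ := by
          intro h
          have := congrArg Fin.val h
          simp at this
          omega
        simp [this]
      · intro i
        simp only [jtMatrix, Matrix.of_apply]
        congr 1
        push_cast [Nat.cast_sub (show j ≤ (r : ℕ) by omega)]
        ring
    · simp
  rw [h0, Finset.sum_congr rfl fun r _ => h1 r, Finset.sum_sub_distrib, ← Finset.sum_mul,
    ← map_sum, ← Finset.mul_sum, Fin.sum_univ_eq_sum_range (fun r => t ^ r) N,
    show (1 - t) * ∑ k ∈ Finset.range N, t ^ k = 1 - t ^ N by rw [mul_comm, geom_sum_mul_neg]]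
  simp only [map_sub, map_one]
  ring

end Field

end HilbChar

end

noncomputable section

namespace HilbChar

/-! ### Young diagrams and the dominance order -/

section Diagrams

lemma rowLen_eq_zero {D : YoungDiagram} {i : ℕ} (hi : D.card ≤ i) : D.rowLen i = 0 := by
  by_contra h
  have hmem : (i, 0) ∈ D := YoungDiagram.mem_iff_lt_rowLen.2 (Nat.pos_of_ne_zero h)
  have hsub : (Finset.range (i + 1)).image (fun k => (k, 0)) ⊆ D.cells := by
    intro c hc
    obtain ⟨k, hk, rfl⟩ := Finset.mem_image.1 hc
    exact D.up_left_mem (by have := Finset.mem_range.1 hk; omega) le_rfl hmem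
  have := Finset.card_le_card hsub
  rw [Finset.card_image_of_injective _ (fun a b h => by simpa using h), Finset.card_range] at this
  have h2 : D.cells.card = D.card := rfl
  omega

lemma sum_cells_eq {M : Type*} [AddCommMonoid M] (D : YoungDiagram) {N : ℕ} (hN : D.card ≤ N)
    (f : ℕ × ℕ → M) :
    ∑ s ∈ D.cells, f s = ∑ i ∈ Finset.range N, ∑ j ∈ Finset.range (D.rowLen i), f (i, j) := by
  rw [Finset.sum_sigma']
  refine Finset.sum_nbij' (fun s => ⟨s.1, s.2⟩) (fun x => (x.1, x.2)) ?_ ?_ ?_ ?_ ?_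
  · intro s hs
    have hs' : (s.1, s.2) ∈ D := hs
    have h := YoungDiagram.mem_iff_lt_rowLen.1 hs'
    simp only [Finset.mem_sigma, Finset.mem_range]
    refine ⟨?_, h⟩
    by_contra hc
    rw [rowLen_eq_zero (by omega)] at h
    omega
  · intro x hx
    simp only [Finset.mem_sigma, Finset.mem_range] at hx
    exact YoungDiagram.mem_iff_lt_rowLen.2 hx.2
  · intro _ _; rfl
  · intro _ _; rfl
  · intro _ _; rfl

lemma sum_rowLen (D : YoungDiagram) {N : ℕ} (hN : D.card ≤ N) :
    ∑ i ∈ Finset.range N, D.rowLen i = D.card := by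
  have := sum_cells_eq D hN (fun _ => 1)
  simp only [Finset.sum_const, Finset.card_range, smul_eq_mul, mul_one] at this
  exact this.symm

lemma diagram_ext {D E : YoungDiagram} (h : ∀ i, D.rowLen i = E.rowLen i) : D = E := by
  ext ⟨i, j⟩
  rw [YoungDiagram.mem_cells, YoungDiagram.mem_cells, YoungDiagram.mem_iff_lt_rowLen,
    YoungDiagram.mem_iff_lt_rowLen, h]

lemma eq_of_sum_rowLen_eq {D E : YoungDiagram}
    (h : ∀ k, ∑ i ∈ Finset.range k, D.rowLen i = ∑ i ∈ Finset.range k, E.rowLen i) : D = E := by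
  refine diagram_ext fun i => ?_
  have h1 := h (i + 1)
  rw [Finset.sum_range_succ, Finset.sum_range_succ, h i] at h1
  omega

lemma Dominates.refl (D : YoungDiagram) : Dominates D D := fun _ => le_rfl

lemma Dominates.trans {D E F : YoungDiagram} (h : Dominates D E) (h' : Dominates E F) :
    Dominates D F := fun k => (h' k).trans (h k)

lemma Dominates.antisymm {D E : YoungDiagram} (h : Dominates D E) (h' : Dominates E D) : D = E :=
  eq_of_sum_rowLen_eq fun k => le_antisymm (h' k) (h k)

lemma finite_card_eq (n : ℕ) : {D : YoungDiagram | D.card = n}.Finite := by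
  refine Set.Finite.of_finite_image (f := YoungDiagram.cells) ?_ ?_
  · refine Set.Finite.subset (Finset.finite_toSet (Finset.range n ×ˢ Finset.range n).powerset) ?_
    rintro _ ⟨D, hD, rfl⟩
    simp only [Finset.coe_powerset, Set.mem_preimage, Set.mem_powerset_iff, Finset.coe_subset]
    intro s hs
    have hs' : (s.1, s.2) ∈ D := hs
    have hD' : D.card = n := hD
    have h1 := YoungDiagram.mem_iff_lt_rowLen.1 hs'
    rw [Finset.mem_product, Finset.mem_range, Finset.mem_range]
    have hlt : s.1 < n := by
      by_contra hc
      rw [rowLen_eq_zero (by omega)] at h1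
      omega
    refine ⟨hlt, ?_⟩
    have h2 := sum_rowLen D le_rfl
    have h3 := Finset.single_le_sum (f := D.rowLen) (fun i _ => Nat.zero_le _)
      (Finset.mem_range.2 (hD'.symm ▸ hlt))
    omega
  · intro a _ b _ h
    exact YoungDiagram.ext h

/-- The finite set of Young diagrams with `n` cells. -/
def diagrams (n : ℕ) : Finset YoungDiagram := (finite_card_eq n).toFinset

lemma mem_diagrams {n : ℕ} {D : YoungDiagram} : D ∈ diagrams n ↔ D.card = n := by
  simp [diagrams]

/-- Strict dominance of diagrams of the same size. -/
def StrictDom (F E : YoungDiagram) : Prop := F.card = E.card ∧ Dominates F E ∧ F ≠ E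

lemma StrictDom.of_dominates {G F E : YoungDiagram} (hc : G.card = F.card) (h : Dominates G F)
    (h' : StrictDom F E) : StrictDom G E := by
  refine ⟨hc.trans h'.1, h.trans h'.2.1, ?_⟩
  rintro rfl
  exact h'.2.2 (h'.2.1.antisymm h)

/-- Downward induction along the dominance order. -/
lemma dominance_induction {n : ℕ} {P : YoungDiagram → Prop}
    (h : ∀ E, E.card = n → (∀ F, StrictDom F E → P F) → P E) (E : YoungDiagram)
    (hE : E.card = n) : P E := by
  have hfin : Finite {D : YoungDiagram // D.card = n} := (finite_card_eq n).to_subtype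
  let r : {D : YoungDiagram // D.card = n} → {D : YoungDiagram // D.card = n} → Prop :=
    fun F E => StrictDom F.1 E.1
  have hir : Std.Irrefl r := ⟨fun a ha => ha.2.2 rfl⟩
  have htr : IsTrans _ r := ⟨fun a b c hab hbc => StrictDom.of_dominates hab.1 hab.2.1 hbc⟩
  have hwf : WellFounded r := Finite.wellFounded_of_trans_of_irrefl r
  have := hwf.induction (C := fun E => P E.1) ⟨E, hE⟩ fun E ih =>
    h E.1 E.2 fun F hF => ih ⟨F, hF.1.trans E.2⟩ hF
  exact this

/-- The diagram with row lengths a given antitone function with finite support. -/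
lemma exists_diagram {β : ℕ → ℕ} (hβ : Antitone β) {N : ℕ} (hN : ∀ i, N ≤ i → β i = 0) :
    ∃ F : YoungDiagram, ∀ i, F.rowLen i = β i := by
  refine ⟨⟨(Finset.range N ×ˢ Finset.range (β 0)).filter (fun c => c.2 < β c.1), ?_⟩, fun i => ?_⟩
  · rintro ⟨a, b⟩ ⟨a', b'⟩ ⟨h1, h2⟩ h
    simp only [Finset.coe_filter, Finset.mem_product, Finset.mem_range, Set.mem_ofPred_eq] at h ⊢
    simp only at h1 h2
    have := hβ h1
    refine ⟨⟨?_, ?_⟩, ?_⟩ <;> omega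
  · refine eq_of_forall_lt_iff fun j => ?_
    rw [← YoungDiagram.mem_iff_lt_rowLen]
    rw [← YoungDiagram.mem_cells]
    simp only [Finset.mem_filter, Finset.mem_product, Finset.mem_range]
    refine ⟨fun h => h.2, fun h => ⟨⟨?_, h.trans_le (hβ (Nat.zero_le i))⟩, h⟩⟩
    by_contra hc
    rw [hN i (by omega)] at h
    omega

/-- Partial sums become scalar products with an antitone indicator, the form to which the
rearrangement inequality applies. -/
lemma sum_range_eq_sum_ite {N : ℕ} {f : ℕ → ℕ} (hf : ∀ i, N ≤ i → f i = 0) (k : ℕ) :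
    ∑ i ∈ Finset.range k, f i = ∑ i : Fin N, (if (i : ℕ) < k then 1 else 0) * f i := by
  rw [Fin.sum_univ_eq_sum_range (fun i => (if i < k then 1 else 0) * f i) N]
  simp only [ite_mul, one_mul, zero_mul]
  rw [← Finset.sum_filter]
  symm
  refine Finset.sum_subset ?_ ?_
  · intro x hx; simpa using (Finset.mem_filter.1 hx).2
  · intro x hx hx'
    simp only [Finset.mem_filter, Finset.mem_range, not_and, not_lt] at hx hx'
    refine hf x ?_
    by_contra hc
    have := hx' (by omega)
    omega

lemma antitone_indicator (N k : ℕ) :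
    Antitone (fun i : Fin N => if (i : ℕ) < k then 1 else 0 : Fin N → ℕ) := by
  intro i j hij
  have : (i : ℕ) ≤ j := hij
  dsimp only
  split_ifs <;> omega

/-- Sorting a composition yields a diagram whose partial sums dominate those of the composition. -/
lemma exists_sorted_diagram {N : ℕ} (α : Fin N → ℕ) :
    ∃ (F : YoungDiagram) (τ : Equiv.Perm (Fin N)), (∀ i : Fin N, F.rowLen i = α (τ i)) ∧
      F.card = ∑ i, α i ∧ (∀ i, N ≤ i → F.rowLen i = 0) ∧
      ∀ k, ∑ i : Fin N, (if (i : ℕ) < k then 1 else 0) * α i ≤ ∑ i ∈ Finset.range k, F.rowLen i := by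
  obtain ⟨τ, hτ⟩ : ∃ τ : Equiv.Perm (Fin N), Antitone (α ∘ τ) :=
    ⟨Tuple.sort (OrderDual.toDual ∘ α), fun i j hij =>
      Tuple.monotone_sort (OrderDual.toDual ∘ α) hij⟩
  have hβ : Antitone (fun i : ℕ => if h : i < N then α (τ ⟨i, h⟩) else 0) := by
    intro i j hij
    dsimp only
    split_ifs with h1 h2
    · exact hτ (show (⟨i, h2⟩ : Fin N) ≤ ⟨j, h1⟩ from hij)
    · omega
    · exact Nat.zero_le _
    · exact le_rfl
  obtain ⟨F, hF⟩ := exists_diagram hβ (N := N) (fun i hi => dif_neg (by omega))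
  have hFN : ∀ i, N ≤ i → F.rowLen i = 0 := fun i hi => by rw [hF, dif_neg (by omega)]
  have hFα : ∀ i : Fin N, F.rowLen i = α (τ i) := fun i => by rw [hF, dif_pos i.2]
  refine ⟨F, τ, hFα, ?_, hFN, fun k => ?_⟩
  · rw [← sum_rowLen F (le_max_left F.card N), sum_range_eq_sum_ite hFN]
    have : ∀ i : Fin N, (if (i : ℕ) < max F.card N then 1 else 0) * F.rowLen i = α (τ i) := by
      intro i
      rw [if_pos (lt_max_of_lt_right i.2), one_mul, hFα]
    rw [Finset.sum_congr rfl fun i _ => this i]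
    exact Equiv.sum_comp τ α
  · rw [sum_range_eq_sum_ite hFN]
    have hmono : Monovary (fun i : Fin N => if (i : ℕ) < k then 1 else 0 : Fin N → ℕ) (α ∘ τ) :=
      (antitone_indicator N k).monovary hτ
    have := hmono.sum_mul_comp_perm_le_sum_mul (σ := τ⁻¹)
    simpa [hFα] using this

/-- If `σ` fixes everything below `m`, injectivity gives `σ m ≥ m`, and the partial sum up to `m`
gives `σ m ≤ m`. -/
lemma perm_eq_one_of_sum_le {N : ℕ} (σ : Equiv.Perm (Fin N))
    (h : ∀ k : ℕ, ∑ i : Fin N, (if (i : ℕ) < k then 1 else 0) * (σ i : ℕ) ≤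
      ∑ i : Fin N, (if (i : ℕ) < k then 1 else 0) * (i : ℕ)) : σ = 1 := by
  have key : ∀ m (hm : m < N), σ ⟨m, hm⟩ = ⟨m, hm⟩ := by
    intro m
    induction m using Nat.strong_induction_on with
    | _ m ih =>
      intro hm
      have hge : m ≤ (σ ⟨m, hm⟩ : ℕ) := by
        by_contra hc
        have h1 := ih (σ ⟨m, hm⟩ : ℕ) (by omega) (by omega)
        have h2 := congrArg Fin.val (σ.injective h1)
        simp at h2
        omega
      have h1 := h (m + 1)
      have hsplit : ∀ f : Fin N → ℕ, ∑ i : Fin N, (if (i : ℕ) < m + 1 then 1 else 0) * f i =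
          ∑ i : Fin N, (if (i : ℕ) < m then 1 else 0) * f i + f ⟨m, hm⟩ := by
        intro f
        have : ∀ i : Fin N, (if (i : ℕ) < m + 1 then 1 else 0) * f i =
            (if (i : ℕ) < m then 1 else 0) * f i + if i = ⟨m, hm⟩ then f i else 0 := by
          intro i
          by_cases h1 : (i : ℕ) < m
          · rw [if_pos (by omega), if_pos h1, if_neg (fun h => by simp [h] at h1)]; simp
          · by_cases h2 : (i : ℕ) = m
            · rw [if_pos (by omega), if_neg h1, if_pos (Fin.ext h2)]; simp
            · rw [if_neg (by omega), if_neg h1, if_neg (fun h => h2 (by simp [h])), add_zero]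
        rw [Finset.sum_congr rfl fun i _ => this i, Finset.sum_add_distrib, Finset.sum_ite_eq']
        simp
      rw [hsplit, hsplit] at h1
      have h2 : ∑ i : Fin N, (if (i : ℕ) < m then 1 else 0) * (σ i : ℕ) =
          ∑ i : Fin N, (if (i : ℕ) < m then 1 else 0) * (i : ℕ) := by
        refine Finset.sum_congr rfl fun i _ => ?_
        by_cases hi : (i : ℕ) < m
        · rw [ih i hi i.2]
        · simp [hi]
      rw [h2] at h1
      refine Fin.ext ?_
      simp only at h1 ⊢
      omega
  ext i
  rw [key i i.2]
  rfl

lemma sum_le_sum_perm {N : ℕ} (σ : Equiv.Perm (Fin N)) (k : ℕ) :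
    ∑ i : Fin N, (if (i : ℕ) < k then 1 else 0) * (i : ℕ) ≤
      ∑ i : Fin N, (if (i : ℕ) < k then 1 else 0) * (σ i : ℕ) := by
  have h : Antivary (fun i : Fin N => if (i : ℕ) < k then 1 else 0 : Fin N → ℕ)
      (fun i : Fin N => (i : ℕ)) :=
    (antitone_indicator N k).antivary (fun i j hij => hij)
  exact h.sum_mul_le_sum_mul_comp_perm

/-- The composition obtained from a diagram by a permutation as in a Jacobi–Trudi determinant sorts
to a dominating diagram, strictly so unless the permutation is trivial. -/
lemma exists_dominating {E : YoungDiagram} (σ : Equiv.Perm (Fin E.card))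
    (hpos : ∀ i : Fin E.card, (i : ℕ) ≤ E.rowLen i + σ i) :
    ∃ (F : YoungDiagram) (τ : Equiv.Perm (Fin E.card)), F.card = E.card ∧ Dominates F E ∧
      (∀ i : Fin E.card, F.rowLen i + τ i = E.rowLen (τ i) + σ (τ i)) ∧ (F = E → σ = 1) := by
  set α : Fin E.card → ℕ := fun i => E.rowLen i + σ i - i with hα
  have hα' : ∀ i, α i + i = E.rowLen i + σ i := fun i => by
    have := hpos i
    simp only [hα]
    omega
  obtain ⟨F, τ, h1, h2, h3, h4⟩ := exists_sorted_diagram α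
  have hE0 : ∀ i, E.card ≤ i → E.rowLen i = 0 := fun i => rowLen_eq_zero
  -- The partial sums of `α` exceed those of `E` by the partial sums of `σ i - i`, which are
  -- nonnegative. Sorting `α` only increases them further, and equality throughout forces `σ = 1`.
  have hsum : ∀ k, ∑ i : Fin E.card, (if (i : ℕ) < k then 1 else 0) * α i +
      ∑ i : Fin E.card, (if (i : ℕ) < k then 1 else 0) * (i : ℕ) =
      ∑ i ∈ Finset.range k, E.rowLen i +
      ∑ i : Fin E.card, (if (i : ℕ) < k then 1 else 0) * (σ i : ℕ) := by
    intro k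
    rw [sum_range_eq_sum_ite hE0, ← Finset.sum_add_distrib, ← Finset.sum_add_distrib]
    refine Finset.sum_congr rfl fun i _ => ?_
    rw [← mul_add, ← mul_add, hα']
  refine ⟨F, τ, ?_, fun k => ?_, fun i => ?_, fun hFE => ?_⟩
  · have h5 : ∑ i, α i + ∑ i : Fin E.card, (i : ℕ) = E.card + ∑ i : Fin E.card, (σ i : ℕ) := by
      have := hsum E.card
      simpa [sum_rowLen E le_rfl] using this
    rw [Equiv.sum_comp σ (fun i => (i : ℕ))] at h5
    omega
  · have := hsum k
    have := h4 k
    have := sum_le_sum_perm σ k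
    omega
  · rw [h1, hα']
  · refine perm_eq_one_of_sum_le σ fun k => ?_
    have := hsum k
    have := h4 k
    rw [hFE] at this
    omega

end Diagrams

end HilbChar

end

noncomputable section

namespace HilbChar

/-! ### Triangularity of the conjugated operator in the Schur basis -/

section Field

variable {K : Type*} [Field K]

/-- The eigenvalue `1 - (1-q)(1-t) φ_D(q,t)`. -/
def eig (q t : K) (D : YoungDiagram) : K := 1 - (1 - q) * (1 - t) * phi q t D

/-- The product `h_{D}` of complete symmetric functions over the rows of `D`. -/
def hDiag (K : Type*) [Field K] (D : YoungDiagram) : Sym K :=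
  ∏ i : Fin D.card, complete (D.rowLen i)

/-- The span of the Schur functions of the diagrams strictly dominating `D`. -/
def schurStrict (K : Type*) [Field K] (D : YoungDiagram) : Submodule K (Sym K) :=
  Submodule.span K (schur '' {E | StrictDom E D})

lemma schurAbove_le_schurStrict {F E : YoungDiagram} (h : StrictDom F E) :
    schurAbove (K := K) F ≤ schurStrict K E := by
  refine Submodule.span_mono (Set.image_mono ?_)
  rintro G ⟨hc, hd⟩
  exact StrictDom.of_dominates hc hd h

lemma schurStrict_le_schurAbove (E : YoungDiagram) :
    schurStrict K E ≤ schurAbove (K := K) E := by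
  refine Submodule.span_mono (Set.image_mono ?_)
  rintro G ⟨hc, hd, -⟩
  exact ⟨hc, hd⟩

lemma schur_mem_schurAbove (E : YoungDiagram) : schur E ∈ schurAbove (K := K) E :=
  Submodule.subset_span ⟨E, ⟨rfl, Dominates.refl E⟩, rfl⟩

lemma schur_eq_det_jtMatrix (D : YoungDiagram) :
    schur (K := K) D = (jtMatrix K fun i : Fin D.card => (D.rowLen i : ℤ) - (i : ℤ)).det := rfl

lemma det_jtMatrix_eq_sum {N : ℕ} (l : Fin N → ℤ) :
    (jtMatrix K l).det = ∑ σ : Equiv.Perm (Fin N),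
      ((Equiv.Perm.sign σ : ℤ) : Sym K) * ∏ i, completeInt (l i + (σ i : ℕ)) := by
  rw [← Matrix.det_transpose, Matrix.det_apply']
  rfl

/-- In the Leibniz expansion, rescaling column `r` multiplies the term of `σ` by the scalar attached
to row `σ⁻¹ r`. Summing over `r` is then summing over rows. -/
lemma sum_det_updateCol_jtMatrix (q t : K) {N : ℕ} (l : Fin N → ℤ) :
    ∑ r : Fin N, MvPolynomial.C ((1 - t) * t ^ (r : ℕ)) * ((jtMatrix K l).updateCol r fun i =>
          MvPolynomial.C (q ^ (l i + (r : ℤ))) * completeInt (l i + (r : ℤ))).det =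
      ∑ σ : Equiv.Perm (Fin N), MvPolynomial.C
        ((1 - t) * ∑ i, t ^ (σ i : ℕ) * q ^ (l i + (σ i : ℕ))) *
        (((Equiv.Perm.sign σ : ℤ) : Sym K) * ∏ i, completeInt (l i + (σ i : ℕ))) := by
  have h : ∀ r : Fin N, ((jtMatrix K l).updateCol r fun i =>
          MvPolynomial.C (q ^ (l i + (r : ℤ))) * completeInt (l i + (r : ℤ))).det =
      ∑ σ : Equiv.Perm (Fin N), MvPolynomial.C (q ^ (l (σ⁻¹ r) + (r : ℤ))) *
        (((Equiv.Perm.sign σ : ℤ) : Sym K) * ∏ i, completeInt (l i + (σ i : ℕ))) := by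
    intro r
    rw [← Matrix.det_transpose, Matrix.det_apply']
    refine Finset.sum_congr rfl fun σ _ => ?_
    rw [mul_left_comm]
    congr 1
    rw [← Finset.mul_prod_erase _ _ (Finset.mem_univ (σ⁻¹ r)),
      ← Finset.mul_prod_erase _ (fun i => completeInt (l i + (σ i : ℕ)))
        (Finset.mem_univ (σ⁻¹ r)), ← mul_assoc]
    congr 1
    · simp
    · refine Finset.prod_congr rfl fun i hi => ?_
      have hi' : σ i ≠ r := fun h => (Finset.mem_erase.1 hi).1 (by simp [← h])
      simp [Matrix.updateCol_ne hi', jtMatrix]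
  simp only [h, Finset.mul_sum]
  rw [Finset.sum_comm]
  refine Finset.sum_congr rfl fun σ _ => ?_
  rw [← Equiv.sum_comp σ, map_sum, Finset.sum_mul]
  refine Finset.sum_congr rfl fun i _ => ?_
  rw [← mul_assoc, ← map_mul]
  simp [mul_assoc]

/-- The scalar attached to a permutation in the expansion of the operator on a determinant. -/
def permScalar (q t : K) {N : ℕ} (l : Fin N → ℤ) (σ : Equiv.Perm (Fin N)) : K :=
  t ^ N + (1 - t) * ∑ i, t ^ (σ i : ℕ) * q ^ (l i + (σ i : ℕ))

lemma macOpConj_det_jtMatrix_eq_sum [CharZero K] (q t : K) {N : ℕ} (l : Fin N → ℤ) :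
    macOpConj q t (jtMatrix K l).det = ∑ σ : Equiv.Perm (Fin N),
      MvPolynomial.C (permScalar q t l σ) *
        (((Equiv.Perm.sign σ : ℤ) : Sym K) * ∏ i, completeInt (l i + (σ i : ℕ))) := by
  rw [macOpConj_det_jtMatrix, sum_det_updateCol_jtMatrix, det_jtMatrix_eq_sum, Finset.mul_sum,
    ← Finset.sum_add_distrib]
  refine Finset.sum_congr rfl fun σ _ => ?_
  rw [← add_mul, ← map_add, permScalar]

/-- Geometric summation along the rows. Any large `N` is allowed, since empty rows contribute `(1-t)
t^i`, which telescopes against `t^N`. -/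
lemma eig_eq (q t : K) (D : YoungDiagram) {N : ℕ} (hN : D.card ≤ N) :
    eig q t D = t ^ N + (1 - t) * ∑ i ∈ Finset.range N, t ^ i * q ^ D.rowLen i := by
  rw [eig, phi, sum_cells_eq D hN]
  have h : ∀ i, (1 - q) * (1 - t) * ∑ j ∈ Finset.range (D.rowLen i), q ^ j * t ^ i =
      (1 - t) * t ^ i - (1 - t) * (t ^ i * q ^ D.rowLen i) := by
    intro i
    have := geom_sum_mul_neg q (D.rowLen i)
    rw [← Finset.sum_mul]
    linear_combination (1 - t) * t ^ i * this
  rw [Finset.mul_sum, Finset.sum_congr rfl fun i _ => h i, Finset.sum_sub_distrib,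
    ← Finset.mul_sum, ← Finset.mul_sum]
  have := geom_sum_mul_neg t N
  linear_combination -this

lemma permScalar_one (q t : K) (D : YoungDiagram) :
    permScalar q t (fun i : Fin D.card => (D.rowLen i : ℤ) - (i : ℤ)) 1 = eig q t D := by
  rw [permScalar, eig_eq q t D le_rfl, ← Fin.sum_univ_eq_sum_range (fun i => t ^ i * q ^ D.rowLen i)]
  simp

lemma prod_one_eq_hDiag (D : YoungDiagram) :
    ∏ i : Fin D.card, completeInt (K := K)
      ((D.rowLen i : ℤ) - (i : ℤ) + (((1 : Equiv.Perm (Fin D.card)) i : Fin D.card) : ℕ)) =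
      hDiag K D := by
  rw [hDiag]
  refine Finset.prod_congr rfl fun i _ => ?_
  rw [← completeInt_natCast]
  simp

/-- A negative index kills the Leibniz term. Otherwise sorting the indices gives `h_F` with `F ⊵ E`,
strictly unless `σ = 1`. -/
lemma prod_completeInt_eq (E : YoungDiagram) (σ : Equiv.Perm (Fin E.card)) :
    (∏ i : Fin E.card, completeInt (K := K) ((E.rowLen i : ℤ) - (i : ℤ) + (σ i : ℕ)) = 0) ∨
    ∃ F : YoungDiagram, F.card = E.card ∧ Dominates F E ∧ (F = E → σ = 1) ∧
      ∏ i : Fin E.card, completeInt (K := K) ((E.rowLen i : ℤ) - (i : ℤ) + (σ i : ℕ)) =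
        hDiag K F := by
  by_cases hpos : ∀ i : Fin E.card, (i : ℕ) ≤ E.rowLen i + σ i
  · right
    obtain ⟨F, τ, h1, h2, h3, h4⟩ := exists_dominating σ hpos
    refine ⟨F, h1, h2, h4, ?_⟩
    have hD : hDiag K F = ∏ i : Fin E.card, complete (F.rowLen i) := by
      rw [hDiag, Fin.prod_univ_eq_prod_range (fun i => complete (F.rowLen i)), h1,
        Fin.prod_univ_eq_prod_range (fun i => complete (F.rowLen i))]
    rw [hD, ← Equiv.prod_comp τ]
    refine Finset.prod_congr rfl fun i _ => ?_
    rw [← completeInt_natCast]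
    congr 1
    have := h3 i
    omega
  · left
    push Not at hpos
    obtain ⟨i, hi⟩ := hpos
    refine Finset.prod_eq_zero (Finset.mem_univ i) (completeInt_of_neg ?_)
    omega

/-- The Jacobi–Trudi formula reads `s_E = h_E +` terms `± h_F` with `F` strictly above `E`; it is
solved for `h_E` by induction on dominance. -/
lemma hDiag_mem_schurAbove (E : YoungDiagram) : hDiag K E ∈ schurAbove (K := K) E := by
  refine dominance_induction (n := E.card) (P := fun E => hDiag K E ∈ schurAbove (K := K) E)
    (fun E _ ih => ?_) E rfl
  have h := schur_eq_det_jtMatrix (K := K) E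
  rw [det_jtMatrix_eq_sum, ← Finset.add_sum_erase _ _ (Finset.mem_univ 1), prod_one_eq_hDiag] at h
  simp only [Equiv.Perm.sign_one, Units.val_one, Int.cast_one, one_mul] at h
  rw [← sub_eq_iff_eq_add] at h
  rw [← h]
  refine Submodule.sub_mem _ (schur_mem_schurAbove E) (Submodule.sum_mem _ fun σ hσ => ?_)
  have hσ1 : σ ≠ 1 := (Finset.mem_erase.1 hσ).1
  rw [← zsmul_eq_mul]
  refine zsmul_mem ?_ _
  rcases prod_completeInt_eq (K := K) E σ with h0 | ⟨F, h1, h2, h3, h4⟩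
  · rw [h0]; exact Submodule.zero_mem _
  · have hs : StrictDom F E := ⟨h1, h2, fun hFE => hσ1 (h3 hFE)⟩
    rw [h4]
    exact schurStrict_le_schurAbove E (schurAbove_le_schurStrict hs (ih F hs))

/-- The operator multiplies each Leibniz term of `s_E` by its own scalar, which is the eigenvalue
for the identity permutation. Subtracting `eig q t E • s_E` therefore leaves only terms `h_F` with
`F` strictly above `E`. -/
lemma macOpConj_schur_sub_mem [CharZero K] (q t : K) (E : YoungDiagram) :
    macOpConj q t (schur E) - eig q t E • schur E ∈ schurStrict K E := by
  rw [schur_eq_det_jtMatrix, macOpConj_det_jtMatrix_eq_sum, det_jtMatrix_eq_sum, Finset.smul_sum,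
    ← Finset.sum_sub_distrib]
  refine Submodule.sum_mem _ fun σ _ => ?_
  rw [← MvPolynomial.C_mul', ← sub_mul, ← map_sub, MvPolynomial.C_mul']
  by_cases hσ : σ = 1
  · subst hσ
    rw [permScalar_one, sub_self, zero_smul]
    exact Submodule.zero_mem _
  · refine Submodule.smul_mem _ _ ?_
    rw [← zsmul_eq_mul]
    refine zsmul_mem ?_ _
    rcases prod_completeInt_eq (K := K) E σ with h0 | ⟨F, h1, h2, h3, h4⟩
    · rw [h0]; exact Submodule.zero_mem _
    · have hs : StrictDom F E := ⟨h1, h2, fun hFE => hσ (h3 hFE)⟩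
      rw [h4]
      exact schurAbove_le_schurStrict hs (hDiag_mem_schurAbove F)

end Field

end HilbChar

end

noncomputable section

namespace HilbChar

/-! ### Evaluations and the Hall pairing -/

section Field

variable {K : Type*} [Field K]

/-- The evaluation `p_k ↦ 1`. -/
def evOne (K : Type*) [Field K] : Sym K →ₐ[K] K := MvPolynomial.aeval fun _ => 1

/-- The functional `f ↦ (∂f/∂p_1)(1, 1, …)`. -/
def kappa (K : Type*) [Field K] : Sym K →ₗ[K] K :=
  (evOne K).toLinearMap.comp (MvPolynomial.pderiv (1 : ℕ+)).toLinearMap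

lemma kappa_apply (f : Sym K) : kappa K f = evOne K (MvPolynomial.pderiv 1 f) := rfl

lemma kappa_mul (f g : Sym K) : kappa K (f * g) = kappa K f * evOne K g + evOne K f * kappa K g := by
  rw [kappa_apply, kappa_apply, kappa_apply, Derivation.leibniz]
  simp [mul_comm]
  ring

lemma evOne_monomial (m : ℕ+ →₀ ℕ) (a : K) : evOne K (MvPolynomial.monomial m a) = a := by
  simp [evOne, MvPolynomial.aeval_monomial]

lemma evOne_eq_sum (f : Sym K) : evOne K f = ∑ m ∈ f.support, f.coeff m := by
  conv_lhs => rw [MvPolynomial.as_sum f, map_sum]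
  exact Finset.sum_congr rfl fun m _ => evOne_monomial _ _

lemma kappa_eq_sum (f : Sym K) : kappa K f = ∑ m ∈ f.support, f.coeff m * (m 1 : K) := by
  conv_lhs => rw [MvPolynomial.as_sum f, map_sum]
  refine Finset.sum_congr rfl fun m _ => ?_
  rw [kappa_apply, MvPolynomial.pderiv_monomial, evOne_monomial]

/-- The homogeneous symmetric functions of degree `n`. -/
abbrev homog (K : Type*) [Field K] (n : ℕ) : Submodule K (Sym K) :=
  MvPolynomial.weightedHomogeneousSubmodule K (fun k : ℕ+ => (k : ℕ)) n

variable [CharZero K]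

lemma hall_complete {n : ℕ} {f : Sym K} (hf : f ∈ homog K n) : hall f (complete n) = evOne K f := by
  rw [hall, evOne_eq_sum]
  refine Finset.sum_congr rfl fun m hm => ?_
  rw [coeff_complete, if_pos (hf (MvPolynomial.mem_support_iff.1 hm))]
  have : (zee m : K) ≠ 0 := by exact_mod_cast (zee_pos m).ne'
  field_simp

lemma complete_one : complete (K := K) 1 = MvPolynomial.X 1 := by
  have := succ_mul_complete (K := K) 0
  simp only [complete_zero, Nat.cast_zero, zero_add, one_mul, Finset.Nat.antidiagonal_zero,
    Finset.sum_singleton, mul_one] at this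
  exact this

/-- The ratio of `z_m` to the value with one part `1` removed is `m_1`, the weight that `∂/∂p_1` at
`(1, 1, …)` gives to the coefficient of `p^m`. -/
lemma hall_complete_mul_X {n : ℕ} {f : Sym K} (hf : f ∈ homog K (n + 1)) :
    hall f (complete n * MvPolynomial.X 1) = kappa K f := by
  classical
  rw [hall, kappa_eq_sum]
  refine Finset.sum_congr rfl fun m hm => ?_
  rw [mul_assoc]
  congr 1
  rw [MvPolynomial.coeff_mul_X']
  have hw : wt m = n + 1 := hf (MvPolynomial.mem_support_iff.1 hm)
  by_cases h : m 1 = 0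
  · simp [h]
  · have hle : Finsupp.single (1 : ℕ+) 1 ≤ m := by
      simpa using Nat.one_le_iff_ne_zero.2 h
    have hw' : wt (m - Finsupp.single 1 1) + 1 = wt m := by
      conv_rhs => rw [← tsub_add_cancel_of_le hle, map_add]
      simp [Finsupp.weight_single]
    rw [if_pos (by simpa using h), coeff_complete, if_pos (by omega), zee_succ m 1 h]
    have hz0 : (zee (m - Finsupp.single 1 1) : K) ≠ 0 := by exact_mod_cast (zee_pos _).ne'
    push_cast
    simp
    field_simp

lemma completeProd_almostRow (n : ℕ) (hn : 1 ≤ n) :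
    completeProd (K := K) (almostRow n hn) = complete (n - 1) * MvPolynomial.X 1 := by
  have hp : (almostRow n hn).parts = Multiset.filter (· ≠ 0) {n - 1, 1} := rfl
  have h1 : Multiset.filter (fun x => ¬x = 0) {1} = ({1} : Multiset ℕ) := by decide
  rw [completeProd, hp]
  -- For `n = 1` the part `0` has been dropped from the partition, in agreement with `h_0 = 1`.
  by_cases h : n - 1 = 0
  · simp [h, h1, complete_one, complete_zero]
  · simp [h, h1, complete_one]

lemma evOne_complete (n : ℕ) : evOne K (complete n) = 1 := by
  induction n using Nat.strong_induction_on with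
  | _ n ih =>
    cases n with
    | zero => simp [complete_zero]
    | succ n =>
      have h := congrArg (evOne K) (succ_mul_complete (K := K) n)
      rw [map_mul, map_sum] at h
      have h2 : ∀ x ∈ Finset.HasAntidiagonal.antidiagonal n,
          evOne K (MvPolynomial.X x.1.succPNat * complete x.2) = 1 := by
        intro x hx
        rw [map_mul, ih x.2 (by have := Finset.HasAntidiagonal.mem_antidiagonal.1 hx; omega)]
        simp [evOne]
      rw [Finset.sum_congr rfl h2] at h
      have h3 : (n : K) + 1 ≠ 0 := by exact_mod_cast Nat.succ_ne_zero n
      apply mul_left_cancel₀ h3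
      simpa using h

lemma map_evOne_eSeries :
    PowerSeries.map (evOne K : Sym K →+* K) (eSeries K) = 1 - PowerSeries.X := by
  have h1 : PowerSeries.map (evOne K : Sym K →+* K) (hSeries K) = PowerSeries.mk 1 := by
    ext n; simp [hSeries, evOne_complete]
  have h2 := congrArg (PowerSeries.map (evOne K : Sym K →+* K)) (hSeries_mul_eSeries (K := K))
  rw [map_mul, h1, map_one] at h2
  have h3 := PowerSeries.mk_one_mul_one_sub_eq_one K
  calc _ = (PowerSeries.mk 1 * (1 - PowerSeries.X)) *
        PowerSeries.map (evOne K : Sym K →+* K) (eSeries K) := by rw [h3, one_mul]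
    _ = (1 - PowerSeries.X) * (PowerSeries.mk 1 *
        PowerSeries.map (evOne K : Sym K →+* K) (eSeries K)) := by ring
    _ = _ := by rw [h2, mul_one]

/-- At `p_k = 1` the series `1/H(u)` becomes `1 - u`, so only the two lowest powers of `y` survive.
-/
lemma evOne_contract (g : Polynomial (Sym K)) :
    evOne K (contract (eSeries K) g) = evOne K (g.coeff 0) - evOne K (g.coeff 1) := by
  induction g using Polynomial.induction_on' with
  | add f g hf hg => simp only [map_add, hf, hg, Polynomial.coeff_add]; ring
  | monomial n a =>
    rw [← Polynomial.C_mul_X_pow_eq_monomial, contract_C_mul_X_pow, map_mul]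
    have h := congrArg (PowerSeries.coeff n) (map_evOne_eSeries (K := K))
    rw [PowerSeries.coeff_map] at h
    rw [show evOne K (PowerSeries.coeff n (eSeries K)) = _ from h]
    rcases n with _ | _ | n
    · simp
    · simp [PowerSeries.coeff_one, Polynomial.coeff_C]
    · simp [PowerSeries.coeff_one, PowerSeries.coeff_X, Polynomial.coeff_X_pow]

end Field

section Field

variable {K : Type*} [Field K]

/-- First order Taylor expansion: `p_1` is the only variable whose shift is linear in `y`. -/
lemma coeff_translate (c : ℕ+ → K) (f : Sym K) :
    (translate c f).coeff 0 = f ∧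
      (translate c f).coeff 1 = MvPolynomial.C (c 1) * MvPolynomial.pderiv 1 f := by
  induction f using MvPolynomial.induction_on with
  | C a => simp [Polynomial.coeff_C]
  | add f g hf hg =>
    simp only [map_add, Polynomial.coeff_add, hf.1, hf.2, hg.1, hg.2]
    exact ⟨trivial, by ring⟩
  | mul_X f k hf =>
    have h0 : (translate c (MvPolynomial.X k)).coeff 0 = MvPolynomial.X k := by
      simp [translate_X, k.ne_zero.symm]
    have h1 : (translate c (MvPolynomial.X k)).coeff 1 =
        MvPolynomial.C (c 1) * MvPolynomial.pderiv 1 (MvPolynomial.X k) := by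
      rw [translate_X, Polynomial.coeff_add, Polynomial.coeff_C_of_ne_zero one_ne_zero,
        Polynomial.coeff_C_mul, Polynomial.coeff_X_pow, MvPolynomial.pderiv_X]
      by_cases hk : k = 1
      · subst hk; simp
      · have : ¬ (1 = (k : ℕ)) := fun h => hk (PNat.coe_eq_one_iff.1 h.symm)
        simp [this, hk]
    rw [map_mul, Polynomial.mul_coeff_zero, Polynomial.mul_coeff_one, hf.1, hf.2, h0, h1,
      Derivation.leibniz]
    refine ⟨rfl, ?_⟩
    simp only [smul_eq_mul]
    ring

/-- This is what makes the operator useful here: on an eigenvector with `evOne = 1`, the eigenvalue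
determines `kappa`. -/
lemma evOne_macOp [CharZero K] (q t : K) (f : Sym K) :
    evOne K (macOp q t f) = evOne K f - (1 - q) * (1 - t) * kappa K f := by
  rw [macOp, vertexOp_apply, evOne_contract, (coeff_translate _ f).1, (coeff_translate _ f).2,
    map_mul, kappa_apply]
  simp [evOne]

/-! ### Rescaling the power sums -/

/-- The rescaling `p_k ↦ c_k p_k`. -/
def scale (c : ℕ+ → K) : Sym K →ₐ[K] Sym K :=
  MvPolynomial.aeval fun k : ℕ+ => MvPolynomial.C (c k) * MvPolynomial.X k

lemma plethOneSub_eq_scale (q : K) : plethOneSub q = scale fun k : ℕ+ => 1 - q ^ (k : ℕ) := rfl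

lemma scale_comp (c d : ℕ+ → K) (f : Sym K) : scale c (scale d f) = scale (fun k => c k * d k) f := by
  have : (scale c).comp (scale d) = scale (fun k => c k * d k) := by
    refine MvPolynomial.algHom_ext fun k => ?_
    simp [scale, MvPolynomial.algHom_C]
    ring
  exact DFunLike.congr_fun this f

lemma scale_one (f : Sym K) : scale (fun _ => (1 : K)) f = f := by
  simp [scale]

lemma scale_monomial (c : ℕ+ → K) (m : ℕ+ →₀ ℕ) (a : K) :
    scale c (MvPolynomial.monomial m a) = MvPolynomial.monomial m (a * m.prod fun k e => c k ^ e) := by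
  rw [scale, MvPolynomial.aeval_monomial, MvPolynomial.monomial_eq, map_mul, mul_assoc,
    MvPolynomial.algebraMap_eq]
  congr 1
  simp only [mul_pow, Finsupp.prod, map_prod, map_pow, Finset.prod_mul_distrib]

lemma scale_mem_homog (c : ℕ+ → K) {n : ℕ} {f : Sym K} (hf : f ∈ homog K n) :
    scale c f ∈ homog K n := by
  rw [MvPolynomial.as_sum f, map_sum]
  refine Submodule.sum_mem _ fun m hm => ?_
  rw [scale_monomial]
  exact MvPolynomial.isWeightedHomogeneous_monomial _ _ _ (hf (MvPolynomial.mem_support_iff.1 hm))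

/-- The inverse of `plethOneSub q`, that is `f ↦ f[X/(1-q)]`. -/
def plethInv (q : K) : Sym K →ₐ[K] Sym K := scale fun k : ℕ+ => (1 - q ^ (k : ℕ))⁻¹

lemma plethOneSub_plethInv {q : K} (hq : ∀ k : ℕ+, 1 - q ^ (k : ℕ) ≠ 0) (f : Sym K) :
    plethOneSub q (plethInv q f) = f := by
  rw [plethInv, plethOneSub_eq_scale, scale_comp]
  simp only [mul_inv_cancel₀ (hq _)]
  exact scale_one f

lemma plethInv_plethOneSub {q : K} (hq : ∀ k : ℕ+, 1 - q ^ (k : ℕ) ≠ 0) (f : Sym K) :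
    plethInv q (plethOneSub q f) = f := by
  rw [plethInv, plethOneSub_eq_scale, scale_comp]
  simp only [inv_mul_cancel₀ (hq _)]
  exact scale_one f

lemma hDiag_mem_homog (D : YoungDiagram) : hDiag K D ∈ homog K D.card := by
  have h := MvPolynomial.IsWeightedHomogeneous.prod (R := K) (w := fun k : ℕ+ => (k : ℕ))
    (Finset.univ : Finset (Fin D.card)) (fun i => complete (D.rowLen i)) (fun i => D.rowLen i)
    (fun i _ => complete_isHomogeneous _)
  rw [Fin.sum_univ_eq_sum_range (fun i => D.rowLen i), sum_rowLen D le_rfl] at h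
  exact h

lemma schur_mem_homog (D : YoungDiagram) : schur D ∈ homog K D.card := by
  rw [schur_eq_det_jtMatrix, det_jtMatrix_eq_sum]
  refine Submodule.sum_mem _ fun σ _ => ?_
  rw [← zsmul_eq_mul]
  refine zsmul_mem ?_ _
  rcases prod_completeInt_eq (K := K) D σ with h0 | ⟨F, h1, -, -, h4⟩
  · rw [h0]; exact Submodule.zero_mem _
  · rw [h4, ← h1]
    exact hDiag_mem_homog F

lemma schurAbove_le_homog (D : YoungDiagram) : schurAbove (K := K) D ≤ homog K D.card := by
  refine Submodule.span_le.2 ?_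
  rintro _ ⟨E, ⟨hc, -⟩, rfl⟩
  rw [← hc]
  exact schur_mem_homog E

/-- Bounds the dimension in degree `n` by the number of partitions, so that as many independent
eigenvectors form a basis. -/
lemma homog_le_span (n : ℕ) :
    homog K n ≤ Submodule.span K
      (Set.range fun rho : n.Partition => MvPolynomial.monomial (typeVec rho) (1 : K)) := by
  intro f hf
  rw [MvPolynomial.as_sum f]
  refine Submodule.sum_mem _ fun m hm => ?_
  obtain ⟨rho, rfl⟩ := exists_typeVec (hf (MvPolynomial.mem_support_iff.1 hm))
  rw [← mul_one (MvPolynomial.coeff _ f), ← smul_eq_mul, ← MvPolynomial.smul_monomial]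
  exact Submodule.smul_mem _ _ (Submodule.subset_span ⟨rho, rfl⟩)

end Field

end HilbChar

end

noncomputable section

namespace HilbChar

/-! ### Eigenvectors of the Macdonald operator -/

section Field

open Classical in
/-- The diagrams dominating `E`. -/
def above (E : YoungDiagram) : Finset YoungDiagram :=
  (diagrams E.card).filter fun F => Dominates F E

open Classical in
/-- The diagrams strictly dominating `E`. -/
def strictAbove (E : YoungDiagram) : Finset YoungDiagram := (above E).erase E

lemma mem_above {E F : YoungDiagram} : F ∈ above E ↔ F.card = E.card ∧ Dominates F E := by
  simp [above, mem_diagrams]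

lemma mem_strictAbove {E F : YoungDiagram} : F ∈ strictAbove E ↔ StrictDom F E := by
  simp only [strictAbove, Finset.mem_erase, mem_above, StrictDom]
  tauto

lemma above_subset_strictAbove {E F : YoungDiagram} (h : StrictDom F E) :
    above F ⊆ strictAbove E := by
  intro G hG
  rw [mem_above] at hG
  exact mem_strictAbove.2 (StrictDom.of_dominates hG.1 hG.2 h)

variable {K : Type*} [Field K]

/-- The polynomial with roots the eigenvalues of the given diagrams. -/
def eigPoly (q t : K) (s : Finset YoungDiagram) : Polynomial K :=
  ∏ F ∈ s, (Polynomial.X - Polynomial.C (eig q t F))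

lemma eigPoly_dvd (q t : K) {s s' : Finset YoungDiagram} (h : s ⊆ s') :
    eigPoly q t s ∣ eigPoly q t s' := Finset.prod_dvd_prod_of_subset _ _ _ h

lemma eigPoly_above (q t : K) (E : YoungDiagram) :
    eigPoly q t (above E) =
      (Polynomial.X - Polynomial.C (eig q t E)) * eigPoly q t (strictAbove E) := by
  classical
  rw [eigPoly, eigPoly, strictAbove]
  exact (Finset.mul_prod_erase _ (fun F => Polynomial.X - Polynomial.C (eig q t F))
    (mem_above.2 ⟨rfl, Dominates.refl E⟩)).symm

lemma aeval_eq_zero_of_dvd {V : Type*} [AddCommGroup V] [Module K V] (T : Module.End K V)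
    {P Q : Polynomial K} (h : P ∣ Q) {v : V} (hv : Polynomial.aeval T P v = 0) :
    Polynomial.aeval T Q v = 0 := by
  obtain ⟨R, rfl⟩ := h
  rw [mul_comm, map_mul, Module.End.mul_apply, hv, map_zero]

lemma aeval_X_sub_C {V : Type*} [AddCommGroup V] [Module K V] (T : Module.End K V) (e : K) (v : V) :
    Polynomial.aeval T (Polynomial.X - Polynomial.C e) v = T v - e • v := by
  simp [Module.algebraMap_end_apply]

lemma schurAbove_mono {E F : YoungDiagram} (hc : F.card = E.card) (hd : Dominates F E) :
    schurAbove (K := K) F ≤ schurAbove (K := K) E := by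
  refine Submodule.span_mono (Set.image_mono ?_)
  rintro G ⟨hc', hd'⟩
  exact ⟨hc'.trans hc, hd'.trans hd⟩

lemma aeval_mem_of_forall {V : Type*} [AddCommGroup V] [Module K V] (T : Module.End K V)
    (W : Submodule K V) (h : ∀ v ∈ W, T v ∈ W) (P : Polynomial K) {v : V} (hv : v ∈ W) :
    Polynomial.aeval T P v ∈ W := by
  induction P using Polynomial.induction_on' generalizing v with
  | add P Q hP hQ =>
    rw [map_add, LinearMap.add_apply]
    exact W.add_mem (hP hv) (hQ hv)
  | monomial n a =>
    rw [Polynomial.aeval_monomial, Module.End.mul_apply, Module.algebraMap_end_apply]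
    refine W.smul_mem _ ?_
    induction n generalizing v with
    | zero => simpa using hv
    | succ n ih => rw [pow_succ, Module.End.mul_apply]; exact ih (h v hv)

lemma aeval_plethOneSub (q t : K) (P : Polynomial K) (f : Sym K) :
    plethOneSub q (Polynomial.aeval (macOp q t) P f) =
      Polynomial.aeval (macOpConj q t) P (plethOneSub q f) := by
  induction P using Polynomial.induction_on' generalizing f with
  | add P Q hP hQ => simp only [map_add, LinearMap.add_apply, hP, hQ]
  | monomial n a =>
    rw [Polynomial.aeval_monomial, Polynomial.aeval_monomial, Module.End.mul_apply,
      Module.End.mul_apply, Module.algebraMap_end_apply, Module.algebraMap_end_apply, map_smul]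
    congr 1
    induction n generalizing f with
    | zero => simp
    | succ n ih =>
      rw [pow_succ, pow_succ, Module.End.mul_apply, Module.End.mul_apply, ih, plethOneSub_macOp]

variable [CharZero K]

/-- Cayley–Hamilton for a triangular operator: the factor of `E` moves `s_E` into the span of the
strictly higher Schur functions, and by induction the remaining factors kill that span. -/
lemma aeval_eigPoly_schur (q t : K) (E : YoungDiagram) :
    Polynomial.aeval (macOpConj q t) (eigPoly q t (above E)) (schur E) = 0 := by
  refine dominance_induction (n := E.card)
    (P := fun E => Polynomial.aeval (macOpConj q t) (eigPoly q t (above E)) (schur E) = 0)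
    (fun E _ ih => ?_) E rfl
  rw [eigPoly_above, mul_comm, map_mul, Module.End.mul_apply, aeval_X_sub_C]
  have h := macOpConj_schur_sub_mem q t E
  rw [schurStrict] at h
  refine Submodule.span_induction (p := fun x _ =>
    Polynomial.aeval (macOpConj q t) (eigPoly q t (strictAbove E)) x = 0) ?_ ?_ ?_ ?_ h
  · rintro _ ⟨F, hF, rfl⟩
    exact aeval_eq_zero_of_dvd _ (eigPoly_dvd q t (above_subset_strictAbove hF)) (ih F hF)
  · simp
  · intro x y _ _ hx hy; rw [map_add, hx, hy, add_zero]
  · intro a x _ hx; rw [map_smul, hx, smul_zero]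

lemma above_subset_above {E F : YoungDiagram} (hc : F.card = E.card) (hd : Dominates F E) :
    above F ⊆ above E := by
  intro G hG
  rw [mem_above] at hG ⊢
  exact ⟨hG.1.trans hc, hG.2.trans hd⟩

lemma aeval_eigPoly_of_mem (q t : K) {E : YoungDiagram} {f : Sym K}
    (hf : f ∈ schurAbove (K := K) E) :
    Polynomial.aeval (macOpConj q t) (eigPoly q t (above E)) f = 0 := by
  rw [schurAbove] at hf
  refine Submodule.span_induction (p := fun x _ =>
    Polynomial.aeval (macOpConj q t) (eigPoly q t (above E)) x = 0) ?_ ?_ ?_ ?_ hf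
  · rintro _ ⟨F, ⟨hc, hd⟩, rfl⟩
    exact aeval_eq_zero_of_dvd _ (eigPoly_dvd q t (above_subset_above hc hd))
      (aeval_eigPoly_schur q t F)
  · simp
  · intro x y _ _ hx hy; rw [map_add, hx, hy, add_zero]
  · intro a x _ hx; rw [map_smul, hx, smul_zero]

lemma macOpConj_mem_schurAbove (q t : K) {E : YoungDiagram} {f : Sym K}
    (hf : f ∈ schurAbove (K := K) E) : macOpConj q t f ∈ schurAbove (K := K) E := by
  have hle : schurAbove (K := K) E ≤ (schurAbove (K := K) E).comap (macOpConj q t) := by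
    conv_lhs => rw [schurAbove]
    refine Submodule.span_le.2 ?_
    rintro _ ⟨F, ⟨hc, hd⟩, rfl⟩
    have h1 := schurAbove_mono (K := K) hc hd (schurStrict_le_schurAbove F
      (macOpConj_schur_sub_mem q t F))
    have h2 : eig q t F • schur F ∈ schurAbove (K := K) E :=
      Submodule.smul_mem _ _ (Submodule.subset_span ⟨F, ⟨hc, hd⟩, rfl⟩)
    have := Submodule.add_mem _ h1 h2
    rwa [sub_add_cancel] at this
  exact hle hf

/-- The projection of `s_E` to the eigenspace of `macOpConj q t` with eigenvalue `eig q t E`, up to a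
scalar. -/
def conjEigenvec (q t : K) (E : YoungDiagram) : Sym K :=
  Polynomial.aeval (macOpConj q t) (eigPoly q t (strictAbove E)) (schur E)

lemma conjEigenvec_mem (q t : K) (E : YoungDiagram) :
    conjEigenvec q t E ∈ schurAbove (K := K) E :=
  aeval_mem_of_forall _ _ (fun _ hv => macOpConj_mem_schurAbove q t hv) _ (schur_mem_schurAbove E)

/-- The product over all `F ⊵ E` annihilates `s_E`, and here its factor for `E` is split off. No
eigenvalue differences are inverted, so the construction survives specialization; the vector might
still be zero, which genericity will exclude. -/
lemma macOpConj_conjEigenvec (q t : K) (E : YoungDiagram) :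
    macOpConj q t (conjEigenvec q t E) = eig q t E • conjEigenvec q t E := by
  have h := aeval_eigPoly_schur q t E
  rw [eigPoly_above, map_mul, Module.End.mul_apply, aeval_X_sub_C, sub_eq_zero] at h
  exact h

/-- An eigenvector of `macOp q t` with eigenvalue `eig q t E`. -/
def eigenvec (q t : K) (E : YoungDiagram) : Sym K := plethInv q (conjEigenvec q t E)

lemma macOp_eigenvec {q t : K} (hq : ∀ k : ℕ+, 1 - q ^ (k : ℕ) ≠ 0) (E : YoungDiagram) :
    macOp q t (eigenvec q t E) = eig q t E • eigenvec q t E := by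
  have h : plethOneSub q (macOp q t (eigenvec q t E)) =
      plethOneSub q (eig q t E • eigenvec q t E) := by
    rw [plethOneSub_macOp, map_smul, eigenvec, plethOneSub_plethInv hq, macOpConj_conjEigenvec]
  have := congrArg (plethInv q) h
  rwa [plethInv_plethOneSub hq, plethInv_plethOneSub hq] at this

lemma eigenvec_mem_homog (q t : K) (E : YoungDiagram) : eigenvec q t E ∈ homog K E.card :=
  scale_mem_homog _ (schurAbove_le_homog E (conjEigenvec_mem q t E))

lemma aeval_macOp_eigPoly {q t : K} (hq : ∀ k : ℕ+, 1 - q ^ (k : ℕ) ≠ 0) {E : YoungDiagram}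
    {f : Sym K} (hf : plethOneSub q f ∈ schurAbove (K := K) E) :
    Polynomial.aeval (macOp q t) (eigPoly q t (above E)) f = 0 := by
  have h := aeval_eigPoly_of_mem q t hf
  rw [← aeval_plethOneSub] at h
  have := congrArg (plethInv q) h
  rwa [plethInv_plethOneSub hq, map_zero] at this

end Field

/-! ### Conjugate diagrams -/

lemma phi_transpose {K : Type*} [Field K] (q t : K) (D : YoungDiagram) :
    phi q t D.transpose = phi t q D := by
  rw [phi, phi]
  refine Finset.sum_nbij' Prod.swap Prod.swap ?_ ?_ ?_ ?_ ?_
  · intro s hs; exact YoungDiagram.mem_transpose.1 hs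
  · intro s hs; exact YoungDiagram.mem_transpose.2 (by simpa using hs)
  · intro _ _; simp
  · intro _ _; simp
  · intro s _; simp [mul_comm]

lemma eig_transpose {K : Type*} [Field K] (q t : K) (D : YoungDiagram) :
    eig q t D.transpose = eig t q D := by
  rw [eig, eig, phi_transpose]; ring

lemma card_transpose (D : YoungDiagram) : D.transpose.card = D.card := by
  refine Finset.card_nbij' Prod.swap Prod.swap ?_ ?_ ?_ ?_
  · intro s hs; exact YoungDiagram.mem_transpose.1 hs
  · intro s hs; exact YoungDiagram.mem_transpose.2 (by simpa using hs)
  · intro _ _; simp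
  · intro _ _; simp

/-- Both sides count the cells in the first `k` columns. -/
lemma sum_rowLen_transpose (D : YoungDiagram) {N : ℕ} (hN : D.card ≤ N) (k : ℕ) :
    ∑ i ∈ Finset.range k, D.transpose.rowLen i = ∑ i ∈ Finset.range N, min (D.rowLen i) k := by
  have h1 : ∀ j, D.transpose.rowLen j = ∑ i ∈ Finset.range N, if j < D.rowLen i then 1 else 0 := by
    intro j
    rw [← Finset.card_filter, YoungDiagram.rowLen_transpose]
    have : (Finset.range N).filter (fun i => j < D.rowLen i) = Finset.range (D.colLen j) := by
      ext i
      rw [Finset.mem_filter, Finset.mem_range, Finset.mem_range, ← YoungDiagram.mem_iff_lt_rowLen,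
        ← YoungDiagram.mem_iff_lt_colLen]
      refine ⟨fun h => h.2, fun h => ⟨?_, h⟩⟩
      by_contra hc
      have := YoungDiagram.mem_iff_lt_rowLen.1 h
      rw [rowLen_eq_zero (by omega)] at this
      omega
    rw [this, Finset.card_range]
  simp only [h1]
  rw [Finset.sum_comm]
  refine Finset.sum_congr rfl fun i _ => ?_
  rw [← Finset.card_filter]
  have : (Finset.range k).filter (fun j => j < D.rowLen i) = Finset.range (min (D.rowLen i) k) := by
    ext j; simp; omega
  rw [this, Finset.card_range]

/-- Conjugation reverses the dominance order. -/
lemma Dominates.transpose {F E : YoungDiagram} (hc : F.card = E.card) (h : Dominates F E) :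
    Dominates E.transpose F.transpose := by
  intro k
  rw [sum_rowLen_transpose F hc.le, sum_rowLen_transpose E le_rfl]
  have hmin : ∀ D : YoungDiagram, D.card = E.card →
      ∑ i ∈ Finset.range E.card, min (D.rowLen i) k +
        ∑ i ∈ Finset.range E.card, (D.rowLen i - k) = E.card := by
    intro D hD
    rw [← Finset.sum_add_distrib, ← hD]
    conv_rhs => rw [← sum_rowLen D le_rfl]
    exact Finset.sum_congr rfl fun i _ => by omega
  -- It suffices to compare the cells beyond column `k`. The rows of `E` reaching there are the
  -- first `r`, and the first `r` rows of `F` hold at least as many cells.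
  have key : ∑ i ∈ Finset.range E.card, (E.rowLen i - k) ≤
      ∑ i ∈ Finset.range E.card, (F.rowLen i - k) := by
    set r := E.colLen k with hr
    have hlt : ∀ i, k < E.rowLen i ↔ i < r := fun i => by
      rw [← YoungDiagram.mem_iff_lt_rowLen, YoungDiagram.mem_iff_lt_colLen]
    have hrN : r ≤ E.card := by
      by_contra hc
      have := (hlt E.card).2 (by omega)
      rw [rowLen_eq_zero le_rfl] at this
      omega
    have h1 : ∑ i ∈ Finset.range E.card, (E.rowLen i - k) =
        ∑ i ∈ Finset.range r, (E.rowLen i - k) := by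
      symm
      refine Finset.sum_subset (by simpa using hrN) fun i _ hi => ?_
      have := (hlt i).not.2 (by simpa using hi)
      omega
    have h2 : ∑ i ∈ Finset.range r, (F.rowLen i - k) ≤
        ∑ i ∈ Finset.range E.card, (F.rowLen i - k) :=
      Finset.sum_le_sum_of_subset (by simpa using hrN)
    have h3 : ∑ i ∈ Finset.range r, (E.rowLen i - k) + r * k = ∑ i ∈ Finset.range r, E.rowLen i := by
      rw [show r * k = ∑ i ∈ Finset.range r, k by simp, ← Finset.sum_add_distrib]
      refine Finset.sum_congr rfl fun i hi => ?_
      have := (hlt i).2 (Finset.mem_range.1 hi)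
      omega
    have h4 : ∑ i ∈ Finset.range r, F.rowLen i ≤ ∑ i ∈ Finset.range r, (F.rowLen i - k) + r * k := by
      rw [show r * k = ∑ i ∈ Finset.range r, k by simp, ← Finset.sum_add_distrib]
      exact Finset.sum_le_sum fun i _ => by omega
    have := h r
    omega
  have h1 := hmin F hc
  have h2 := hmin E rfl
  omega

end HilbChar

end

noncomputable section

namespace HilbChar

/-! ### Partitions as diagrams -/

lemma rowLen_diagram {n : ℕ} (lam : n.Partition) (i : ℕ) :
    (diagram lam).rowLen i = (lam.parts.sort (· ≥ ·)).getD i 0 := by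
  refine eq_of_forall_lt_iff fun j => ?_
  rw [← YoungDiagram.mem_iff_lt_rowLen, diagram, YoungDiagram.mem_ofRowLens]
  constructor
  · rintro ⟨h, h'⟩
    rwa [List.getD_eq_getElem _ _ h]
  · intro h
    by_cases hi : i < (lam.parts.sort (· ≥ ·)).length
    · rw [List.getD_eq_getElem _ _ hi] at h
      exact ⟨hi, h⟩
    · rw [List.getD_eq_default _ _ (by omega)] at h
      omega

lemma card_diagram {n : ℕ} (lam : n.Partition) : (diagram lam).card = n := by
  set L := lam.parts.sort (· ≥ ·) with hL
  have h0 : ∀ i, L.length ≤ i → (diagram lam).rowLen i = 0 := fun i hi => by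
    rw [rowLen_diagram, List.getD_eq_default _ _ hi]
  rw [← sum_rowLen (diagram lam) (le_max_left _ L.length)]
  have h1 : ∑ i ∈ Finset.range L.length, (diagram lam).rowLen i =
      ∑ i ∈ Finset.range (max (diagram lam).card L.length), (diagram lam).rowLen i := by
    refine Finset.sum_subset (by simp) fun i _ hi => h0 i (by simpa using hi)
  rw [← h1, ← Fin.sum_univ_eq_sum_range (fun i => (diagram lam).rowLen i)]
  have h2 : ∀ i : Fin L.length, (diagram lam).rowLen i = L[i] := fun i => by
    rw [rowLen_diagram, List.getD_eq_getElem _ _ i.2]; rfl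
  simp only [h2]
  have h3 := Fin.sum_univ_getElem L
  rw [show (∑ i : Fin L.length, L[i]) = L.sum from h3, ← Multiset.sum_coe, hL, Multiset.sort_eq,
    lam.parts_sum]

lemma diagram_injective (n : ℕ) : Function.Injective (diagram (n := n)) := by
  intro a b h
  have hpos : ∀ c : n.Partition, ∀ x ∈ c.parts.sort (· ≥ ·), 0 < x := fun c x hx =>
    c.parts_pos ((Multiset.mem_sort _).1 hx)
  have h1 : (diagram a).rowLens = a.parts.sort (· ≥ ·) :=
    YoungDiagram.rowLens_ofRowLens_eq_self (hpos a)
  have h2 : (diagram b).rowLens = b.parts.sort (· ≥ ·) :=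
    YoungDiagram.rowLens_ofRowLens_eq_self (hpos b)
  have h3 : a.parts.sort (· ≥ ·) = b.parts.sort (· ≥ ·) := by rw [← h1, ← h2, h]
  ext1
  rw [← Multiset.sort_eq a.parts (· ≥ ·), h3, Multiset.sort_eq]

/-! ### Existence and uniqueness of the Macdonald functions -/

section Field

variable {K : Type*} [Field K]

lemma mem_homog_of_plethOneSub {q : K} (hq : ∀ k : ℕ+, 1 - q ^ (k : ℕ) ≠ 0) {E : YoungDiagram}
    {f : Sym K} (h1 : plethOneSub q f ∈ schurAbove (K := K) E) : f ∈ homog K E.card := by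
  have := scale_mem_homog (fun k : ℕ+ => (1 - q ^ (k : ℕ))⁻¹) (schurAbove_le_homog E h1)
  rwa [show scale (fun k : ℕ+ => (1 - q ^ (k : ℕ))⁻¹) = plethInv q from rfl,
    plethInv_plethOneSub hq] at this

/-- Genericity of the parameters `q`, `t` in degree `n`. -/
structure Generic (q t : K) (n : ℕ) : Prop where
  hq : ∀ k : ℕ+, 1 - q ^ (k : ℕ) ≠ 0
  ht : ∀ k : ℕ+, 1 - t ^ (k : ℕ) ≠ 0
  inj : ∀ D E : YoungDiagram, D.card = n → E.card = n → eig q t D = eig q t E → D = E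
  evOne_ne : ∀ E : YoungDiagram, E.card = n → evOne K (eigenvec q t E) ≠ 0
  -- Needed to compare the eigenvectors of `macOp q t` obtained from its two triangular forms.
  swap_ne : ∀ E : YoungDiagram, E.card = n → eigenvec t q E ≠ 0

lemma Generic.eigenvec_ne {q t : K} {n : ℕ} (h : Generic q t n) {E : YoungDiagram}
    (hE : E.card = n) : eigenvec q t E ≠ 0 := by
  intro h0
  exact h.evOne_ne E hE (by rw [h0, map_zero])

variable [CharZero K]

/-- The eigenspaces in degree `n` are lines: there are as many distinct eigenvalues as partitions of
`n`, and the dimension is no larger. -/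
lemma Generic.eq_smul_eigenvec {q t : K} {n : ℕ} (h : Generic q t n) (lam : n.Partition)
    {f : Sym K} (hf : f ∈ homog K n) (he : macOp q t f = eig q t (diagram lam) • f) :
    ∃ c : K, f = c • eigenvec q t (diagram lam) := by
  set v : n.Partition → Sym K := fun mu => eigenvec q t (diagram mu) with hv
  have hinj : Function.Injective fun mu : n.Partition => eig q t (diagram mu) := fun a b hab =>
    diagram_injective n (h.inj _ _ (card_diagram a) (card_diagram b) hab)
  have hli : LinearIndependent K v :=
    Module.End.eigenvectors_linearIndependent' (macOp q t) (fun mu => eig q t (diagram mu)) hinj v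
      fun mu => ⟨Module.End.mem_eigenspace_iff.2 (macOp_eigenvec h.hq _),
        h.eigenvec_ne (card_diagram mu)⟩
  have hle : Submodule.span K (Set.range v) ≤ homog K n := by
    refine Submodule.span_le.2 ?_
    rintro _ ⟨mu, rfl⟩
    have := eigenvec_mem_homog q t (diagram mu)
    rwa [card_diagram] at this
  set S := Submodule.span K
    (Set.range fun rho : n.Partition => MvPolynomial.monomial (typeVec rho) (1 : K)) with hS
  have hfin : FiniteDimensional K S := FiniteDimensional.span_of_finite K (Set.finite_range _)
  have hle' : homog K n ≤ S := homog_le_span n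
  have hfr : Module.finrank K S ≤ Module.finrank K (Submodule.span K (Set.range v)) := by
    rw [finrank_span_eq_card hli]
    exact finrank_range_le_card _
  have heq : Submodule.span K (Set.range v) = S :=
    Submodule.eq_of_le_of_finrank_le (hle.trans hle') hfr
  have hfs : f ∈ Submodule.span K (Set.range v) := heq ▸ hle' hf
  obtain ⟨c, rfl⟩ := (Submodule.mem_span_range_iff_exists_fun K).1 hfs
  refine ⟨c lam, ?_⟩
  have h0 : ∑ mu, (c mu * (eig q t (diagram mu) - eig q t (diagram lam))) • v mu = 0 := by
    have h1 : ∀ mu, macOp q t (v mu) = eig q t (diagram mu) • v mu := fun mu =>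
      macOp_eigenvec h.hq _
    rw [map_sum, Finset.smul_sum, ← sub_eq_zero, ← Finset.sum_sub_distrib] at he
    rw [← he]
    refine Finset.sum_congr rfl fun mu _ => ?_
    rw [map_smul, h1, smul_smul, smul_smul, ← sub_smul]
    congr 1
    ring
  have h1 := Fintype.linearIndependent_iff.1 hli _ h0
  rw [Finset.sum_eq_single lam]
  · intro mu _ hmu
    have h2 := h1 mu
    rcases mul_eq_zero.1 h2 with h3 | h3
    · rw [h3, zero_smul]
    · exact absurd (hinj (sub_eq_zero.1 h3)) hmu
  · simp

/-- Each triangularity condition gives a polynomial in the operator that annihilates `f`. One has as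
roots the eigenvalues of the `F ⊵ E`, the other those of the conjugates of the `G ⊵ E'`, which lie
below `E`. Only the eigenvalue of `E` is common, so with that factor removed the polynomials are
coprime and both kill `macOp f - eig E f`. -/
lemma macOp_eq_of_isMacdonald {q t : K} {E : YoungDiagram} (h : Generic q t E.card) {f : Sym K}
    (h1 : plethOneSub q f ∈ schurAbove (K := K) E)
    (h2 : plethOneSub t f ∈ schurAbove (K := K) E.transpose) :
    macOp q t f = eig q t E • f := by
  have k1 := aeval_macOp_eigPoly (t := t) h.hq h1
  have k2 := aeval_macOp_eigPoly (t := q) h.ht h2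
  rw [eigPoly_above, mul_comm, map_mul, Module.End.mul_apply, aeval_X_sub_C] at k1 k2
  rw [macOp_comm t q, eig_transpose] at k2
  have hcop : IsCoprime (eigPoly q t (strictAbove E)) (eigPoly t q (strictAbove E.transpose)) := by
    refine IsCoprime.prod_left fun F hF => IsCoprime.prod_right fun G hG => ?_
    rw [mem_strictAbove] at hF hG
    refine Polynomial.isCoprime_X_sub_C_of_isUnit_sub (IsUnit.mk0 _ (sub_ne_zero.2 fun he => ?_))
    rw [← eig_transpose q t G] at he
    have hFG := h.inj F G.transpose hF.1
      (by rw [card_transpose, hG.1, card_transpose]) he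
    have hFG' : F.transpose = G := by rw [hFG, YoungDiagram.transpose_transpose]
    have hd := hF.2.1.transpose hF.1
    rw [hFG'] at hd
    exact hG.2.2 (hG.2.1.antisymm hd)
  obtain ⟨a, b, hab⟩ := hcop
  have h3 := congrArg (fun P => Polynomial.aeval (macOp q t) P (macOp q t f - eig q t E • f)) hab
  simp only [map_add, map_mul, LinearMap.add_apply, Module.End.mul_apply, map_one,
    Module.End.one_apply, k1, k2, map_zero, add_zero] at h3
  exact sub_eq_zero.1 h3.symm

/-- The eigenvector built through `X(1-q)` has the first triangularity by construction. The one
built through `X(1-t)` from the conjugate diagram has the second, and the same eigenvalue, so the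
two are proportional. Uniqueness is one-dimensionality of the eigenspace plus normalization. -/
lemma existsUnique_isMacdonald {q t : K} {n : ℕ} (h : Generic q t n) (lam : n.Partition) :
    ∃! H : Sym K, IsMacdonald q t (diagram lam) H := by
  have hc := card_diagram lam
  set E := diagram lam with hE
  set v := eigenvec q t E with hv
  have hvh : v ∈ homog K E.card := eigenvec_mem_homog q t E
  have hv0 : evOne K v ≠ 0 := h.evOne_ne E hc
  have hvt : plethOneSub t v ∈ schurAbove (K := K) E.transpose := by
    set v' := eigenvec t q E.transpose with hv'
    have he : macOp q t v' = eig q t E • v' := by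
      rw [macOp_comm, macOp_eigenvec h.ht, eig_transpose]
    have hh : v' ∈ homog K n := by
      have := eigenvec_mem_homog t q E.transpose
      rwa [card_transpose, hc] at this
    obtain ⟨c, hcv⟩ := h.eq_smul_eigenvec lam hh he
    have hc0 : c ≠ 0 := by
      rintro rfl
      rw [zero_smul] at hcv
      exact h.swap_ne E.transpose (by rw [card_transpose, hc]) hcv
    have h1 : v = c⁻¹ • v' := by rw [hcv, smul_smul, inv_mul_cancel₀ hc0, one_smul]
    rw [h1, map_smul]
    refine Submodule.smul_mem _ _ ?_
    rw [hv', eigenvec, plethOneSub_plethInv h.ht]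
    exact conjEigenvec_mem _ _ _
  refine ⟨(evOne K v)⁻¹ • v, ⟨?_, ?_, ?_⟩, ?_⟩
  · rw [map_smul, hv, eigenvec, plethOneSub_plethInv h.hq]
    exact Submodule.smul_mem _ _ (conjEigenvec_mem _ _ _)
  · rw [map_smul]
    exact Submodule.smul_mem _ _ hvt
  · rw [hall_complete (Submodule.smul_mem _ _ hvh), map_smul, smul_eq_mul, inv_mul_cancel₀ hv0]
  · rintro f ⟨h1, h2, h3⟩
    have hfh := mem_homog_of_plethOneSub h.hq h1
    have he := macOp_eq_of_isMacdonald (E := E) (by rwa [hc]) h1 h2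
    obtain ⟨c, hcf⟩ := h.eq_smul_eigenvec lam (by rwa [hc] at hfh) he
    rw [hall_complete hfh, hcf, map_smul, smul_eq_mul] at h3
    rw [hcf, ← hv, eq_inv_of_mul_eq_one_left h3]

lemma Generic.isMacdonald_macdonald {q t : K} {n : ℕ} (h : Generic q t n) (lam : n.Partition) :
    IsMacdonald q t (diagram lam) (macdonald q t (diagram lam)) := by
  have hex := existsUnique_isMacdonald h lam
  rw [macdonald, dif_pos hex]
  exact hex.choose_spec.1

lemma Generic.macdonald_mem_homog {q t : K} {n : ℕ} (h : Generic q t n) (lam : n.Partition) :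
    macdonald q t (diagram lam) ∈ homog K n := by
  have := mem_homog_of_plethOneSub h.hq (h.isMacdonald_macdonald lam).1
  rwa [card_diagram] at this

lemma Generic.evOne_macdonald {q t : K} {n : ℕ} (h : Generic q t n) (lam : n.Partition) :
    evOne K (macdonald q t (diagram lam)) = 1 := by
  have h1 := (h.isMacdonald_macdonald lam).2.2
  rwa [card_diagram, hall_complete (h.macdonald_mem_homog lam)] at h1

/-- The eigenvalue equation evaluated at `p_k = 1`, where `H̃_λ` is `1`. -/
lemma Generic.kappa_macdonald {q t : K} {n : ℕ} (h : Generic q t n) (lam : n.Partition) :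
    kappa K (macdonald q t (diagram lam)) = phi q t (diagram lam) := by
  have hm := h.isMacdonald_macdonald lam
  have he := macOp_eq_of_isMacdonald (E := diagram lam) (by rwa [card_diagram]) hm.1 hm.2.1
  have h1 := congrArg (evOne K) he
  rw [evOne_macOp, map_smul, h.evOne_macdonald, smul_eq_mul, mul_one, eig] at h1
  have hq := h.hq 1
  have ht := h.ht 1
  simp only [PNat.one_coe, pow_one] at hq ht
  exact mul_left_cancel₀ (mul_ne_zero hq ht) (by linear_combination -h1)

end Field

end HilbChar

end

noncomputable section

namespace HilbChar

/-! ### Specialization of coefficients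

A specialization of a field `K` to a field `L` is given by a subring of `K × L`, the pairs
`(f, value of f)`. -/

lemma coeff_eSeries (K : Type*) [Field K] (n : ℕ) : PowerSeries.coeff n (eSeries K) =
    PowerSeries.coeff n (1 : PowerSeries (Sym K)) -
      ∑ k ∈ Finset.range n, complete (k + 1) * PowerSeries.coeff (n - (k + 1)) (eSeries K) := by
  have h := congrArg (PowerSeries.coeff n) (hSeries_mul_eSeries (K := K))
  rw [PowerSeries.coeff_mul, Finset.Nat.sum_antidiagonal_eq_sum_range_succ
    (fun i j => PowerSeries.coeff i (hSeries K) * PowerSeries.coeff j (eSeries K)),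
    Finset.sum_range_succ'] at h
  simp only [hSeries, PowerSeries.coeff_mk, complete_zero, one_mul, Nat.sub_zero] at h
  rw [← h]
  ring

section Spec

variable {K L : Type*} [Field K] [Field L] (S : Subring (K × L))

/-- The pairs of symmetric functions whose coefficients are related by `S`. -/
def symSpec : Subring (Sym K × Sym L) :=
  ((MvPolynomial.map ((RingHom.fst K L).comp S.subtype)).prod
    (MvPolynomial.map (σ := ℕ+) ((RingHom.snd K L).comp S.subtype))).range

variable {S}

lemma C_mem_symSpec {a : K} {b : L} (h : (a, b) ∈ S) :
    ((MvPolynomial.C a : Sym K), (MvPolynomial.C b : Sym L)) ∈ symSpec S :=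
  ⟨MvPolynomial.C ⟨(a, b), h⟩, by simp⟩

lemma X_mem_symSpec (k : ℕ+) :
    ((MvPolynomial.X k : Sym K), (MvPolynomial.X k : Sym L)) ∈ symSpec S :=
  ⟨MvPolynomial.X k, by simp⟩

lemma mul_mem_spec {A B : Type*} [Ring A] [Ring B] {T : Subring (A × B)} {a a' : A} {b b' : B}
    (h : (a, b) ∈ T) (h' : (a', b') ∈ T) : (a * a', b * b') ∈ T := T.mul_mem h h'

lemma add_mem_spec {A B : Type*} [Ring A] [Ring B] {T : Subring (A × B)} {a a' : A} {b b' : B}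
    (h : (a, b) ∈ T) (h' : (a', b') ∈ T) : (a + a', b + b') ∈ T := T.add_mem h h'

lemma sub_mem_spec {A B : Type*} [Ring A] [Ring B] {T : Subring (A × B)} {a a' : A} {b b' : B}
    (h : (a, b) ∈ T) (h' : (a', b') ∈ T) : (a - a', b - b') ∈ T := T.sub_mem h h'

lemma one_mem_spec {A B : Type*} [Ring A] [Ring B] {T : Subring (A × B)} :
    ((1 : A), (1 : B)) ∈ T := T.one_mem

lemma zero_mem_spec {A B : Type*} [Ring A] [Ring B] {T : Subring (A × B)} :
    ((0 : A), (0 : B)) ∈ T := T.zero_mem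

lemma pow_mem_spec {A B : Type*} [Ring A] [Ring B] {T : Subring (A × B)} {a : A} {b : B}
    (h : (a, b) ∈ T) (n : ℕ) : (a ^ n, b ^ n) ∈ T := T.pow_mem h n

lemma sum_mem_spec {A B ι : Type*} [Ring A] [Ring B] {T : Subring (A × B)} {s : Finset ι}
    {f : ι → A} {g : ι → B} (h : ∀ i ∈ s, (f i, g i) ∈ T) : (∑ i ∈ s, f i, ∑ i ∈ s, g i) ∈ T := by
  have := T.sum_mem (t := s) (f := fun i => (f i, g i)) h
  rwa [show ∑ i ∈ s, (f i, g i) = (∑ i ∈ s, f i, ∑ i ∈ s, g i) from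
    Prod.ext (by simp [Prod.fst_sum]) (by simp [Prod.snd_sum])] at this

lemma prod_mem_spec {A B ι : Type*} [CommRing A] [CommRing B] {T : Subring (A × B)} {s : Finset ι}
    {f : ι → A} {g : ι → B} (h : ∀ i ∈ s, (f i, g i) ∈ T) : (∏ i ∈ s, f i, ∏ i ∈ s, g i) ∈ T := by
  have := T.prod_mem (t := s) (f := fun i => (f i, g i)) h
  rwa [show ∏ i ∈ s, (f i, g i) = (∏ i ∈ s, f i, ∏ i ∈ s, g i) from
    Prod.ext (by simp [Prod.fst_prod]) (by simp [Prod.snd_prod])] at this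

lemma intCast_mem_spec {A B : Type*} [Ring A] [Ring B] {T : Subring (A × B)} (n : ℤ) :
    ((n : A), (n : B)) ∈ T := intCast_mem T n

lemma smul_mem_symSpec {a : K} {b : L} (h : (a, b) ∈ S) {f : Sym K} {g : Sym L}
    (hf : (f, g) ∈ symSpec S) : (a • f, b • g) ∈ symSpec S := by
  rw [← MvPolynomial.C_mul', ← MvPolynomial.C_mul']
  exact mul_mem_spec (C_mem_symSpec h) hf

/-- Two families of algebra homomorphisms that are related on generators are related. -/
lemma hom_mem_spec {A B : Type*} [CommRing A] [CommRing B] [Algebra K A] [Algebra L B]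
    {T : Subring (A × B)} (φ : Sym K →ₐ[K] A) (ψ : Sym L →ₐ[L] B)
    (hC : ∀ a b, (a, b) ∈ S → (algebraMap K A a, algebraMap L B b) ∈ T)
    (hX : ∀ k, (φ (MvPolynomial.X k), ψ (MvPolynomial.X k)) ∈ T)
    {f : Sym K} {g : Sym L} (hf : (f, g) ∈ symSpec S) : (φ f, ψ g) ∈ T := by
  obtain ⟨F, hF⟩ := hf
  obtain ⟨rfl, rfl⟩ := Prod.ext_iff.1 hF
  clear hF
  induction F using MvPolynomial.induction_on with
  | C a =>
    have := hC a.1.1 a.1.2 a.2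
    rw [← φ.commutes, ← ψ.commutes] at this
    simpa [MvPolynomial.algebraMap_eq] using this
  | add F G hF hG =>
    have := add_mem_spec hF hG
    rw [← map_add, ← map_add] at this
    simpa using this
  | mul_X F k hF =>
    have := mul_mem_spec hF (hX k)
    rw [← map_mul, ← map_mul] at this
    simpa using this

lemma scale_mem_spec {c : ℕ+ → K} {d : ℕ+ → L} (h : ∀ k, (c k, d k) ∈ S) {f : Sym K} {g : Sym L}
    (hf : (f, g) ∈ symSpec S) : (scale c f, scale d g) ∈ symSpec S := by
  refine hom_mem_spec _ _ (fun a b hab => C_mem_symSpec hab) (fun k => ?_) hf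
  simp only [scale, MvPolynomial.aeval_X]
  exact mul_mem_spec (C_mem_symSpec (h k)) (X_mem_symSpec k)

lemma evOne_mem_spec {f : Sym K} {g : Sym L} (hf : (f, g) ∈ symSpec S) :
    (evOne K f, evOne L g) ∈ S := by
  refine hom_mem_spec _ _ (fun a b hab => hab) (fun k => ?_) hf
  simp only [evOne, MvPolynomial.aeval_X]
  exact one_mem_spec

/-- The pairs of polynomials over symmetric functions with related coefficients. -/
def polySpec {A B : Type*} [CommRing A] [CommRing B] (T : Subring (A × B)) :
    Subring (Polynomial A × Polynomial B) :=
  ((Polynomial.mapRingHom ((RingHom.fst A B).comp T.subtype)).prod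
    (Polynomial.mapRingHom ((RingHom.snd A B).comp T.subtype))).range

lemma C_mem_polySpec {A B : Type*} [CommRing A] [CommRing B] {T : Subring (A × B)} {a : A} {b : B}
    (h : (a, b) ∈ T) : (Polynomial.C a, Polynomial.C b) ∈ polySpec T :=
  ⟨Polynomial.C ⟨(a, b), h⟩, by simp⟩

lemma X_mem_polySpec {A B : Type*} [CommRing A] [CommRing B] {T : Subring (A × B)} :
    ((Polynomial.X : Polynomial A), (Polynomial.X : Polynomial B)) ∈ polySpec T :=
  ⟨Polynomial.X, by simp⟩

lemma translate_mem_spec {c : ℕ+ → K} {d : ℕ+ → L} (h : ∀ k, (c k, d k) ∈ S) {f : Sym K}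
    {g : Sym L} (hf : (f, g) ∈ symSpec S) :
    (translate c f, translate d g) ∈ polySpec (symSpec S) := by
  refine hom_mem_spec _ _ (fun a b hab => C_mem_polySpec (C_mem_symSpec hab)) (fun k => ?_) hf
  rw [translate_X, translate_X]
  exact add_mem_spec (C_mem_polySpec (X_mem_symSpec k))
    (mul_mem_spec (C_mem_polySpec (C_mem_symSpec (h k))) (pow_mem_spec X_mem_polySpec k))

lemma contract_mem_spec {a : PowerSeries (Sym K)} {b : PowerSeries (Sym L)}
    (hab : ∀ n, (PowerSeries.coeff n a, PowerSeries.coeff n b) ∈ symSpec S)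
    {f : Polynomial (Sym K)} {g : Polynomial (Sym L)} (hf : (f, g) ∈ polySpec (symSpec S)) :
    (contract a f, contract b g) ∈ symSpec S := by
  obtain ⟨F, hF⟩ := hf
  obtain ⟨rfl, rfl⟩ := Prod.ext_iff.1 hF
  clear hF
  induction F using Polynomial.induction_on' with
  | add F G hF hG =>
    have := add_mem_spec hF hG
    rw [← map_add, ← map_add] at this
    simpa using this
  | monomial n x =>
    have := mul_mem_spec x.2 (hab n)
    simpa [← Polynomial.C_mul_X_pow_eq_monomial, contract_C_mul_X_pow] using this

/-- The denominators of `h_n` are the integers `z_ρ`, hence the condition on inverses of positive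
integers. -/
lemma complete_mem_spec (hS : ∀ n : ℕ, 0 < n → (((n : K))⁻¹, ((n : L))⁻¹) ∈ S)
    (n : ℕ) : (complete (K := K) n, complete (K := L) n) ∈ symSpec S := by
  refine sum_mem_spec fun rho _ => ?_
  rw [← mul_one ((zee _ : K)⁻¹), ← mul_one ((zee _ : L)⁻¹), ← smul_eq_mul, ← smul_eq_mul,
    ← MvPolynomial.smul_monomial, ← MvPolynomial.smul_monomial]
  refine smul_mem_symSpec (hS _ (zee_pos _)) ⟨MvPolynomial.monomial (typeVec rho) 1, ?_⟩
  simp [typeVec]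

lemma completeInt_mem_spec (hS : ∀ n : ℕ, 0 < n → (((n : K))⁻¹, ((n : L))⁻¹) ∈ S)
    (m : ℤ) :
    (completeInt (K := K) m, completeInt (K := L) m) ∈ symSpec S := by
  rw [completeInt, completeInt]
  split_ifs
  · exact complete_mem_spec hS _
  · exact zero_mem_spec

lemma schur_mem_spec (hS : ∀ n : ℕ, 0 < n → (((n : K))⁻¹, ((n : L))⁻¹) ∈ S)
    (D : YoungDiagram) : (schur (K := K) D, schur (K := L) D) ∈ symSpec S := by
  rw [schur_eq_det_jtMatrix, schur_eq_det_jtMatrix, det_jtMatrix_eq_sum, det_jtMatrix_eq_sum]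
  exact sum_mem_spec fun σ _ => mul_mem_spec (intCast_mem_spec _)
    (prod_mem_spec fun i _ => completeInt_mem_spec hS _)

lemma eSeries_mem_spec (hS : ∀ n : ℕ, 0 < n → (((n : K))⁻¹, ((n : L))⁻¹) ∈ S)
    (n : ℕ) :
    (PowerSeries.coeff n (eSeries K), PowerSeries.coeff n (eSeries L)) ∈ symSpec S := by
  induction n using Nat.strong_induction_on with
  | _ n ih =>
    rw [coeff_eSeries K, coeff_eSeries L]
    refine sub_mem_spec ?_ (sum_mem_spec fun k hk => ?_)
    · rw [PowerSeries.coeff_one, PowerSeries.coeff_one]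
      split_ifs
      · exact one_mem_spec
      · exact zero_mem_spec
    · have := Finset.mem_range.1 hk
      exact mul_mem_spec (complete_mem_spec hS _) (ih _ (by omega))

lemma macOpConj_mem_spec (hS : ∀ n : ℕ, 0 < n → (((n : K))⁻¹, ((n : L))⁻¹) ∈ S)
    {q t : K} {q' t' : L} (hq : (q, q') ∈ S) (ht : (t, t') ∈ S) {f : Sym K}
    {g : Sym L} (hf : (f, g) ∈ symSpec S) :
    (macOpConj q t f, macOpConj q' t' g) ∈ symSpec S := by
  rw [macOpConj, macOpConj, vertexOp_apply, vertexOp_apply]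
  refine contract_mem_spec (fun n => ?_) (translate_mem_spec (fun k => ?_) hf)
  · rw [qSeries, qSeries, PowerSeries.coeff_map, PowerSeries.coeff_map]
    exact scale_mem_spec (fun k => sub_mem_spec one_mem_spec (pow_mem_spec hq k))
      (eSeries_mem_spec hS n)
  · exact sub_mem_spec one_mem_spec (pow_mem_spec ht k)

lemma phi_mem_spec {q t : K} {q' t' : L} (hq : (q, q') ∈ S) (ht : (t, t') ∈ S)
    (D : YoungDiagram) : (phi q t D, phi q' t' D) ∈ S :=
  sum_mem_spec fun _ _ => mul_mem_spec (pow_mem_spec hq _) (pow_mem_spec ht _)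

lemma eig_mem_spec {q t : K} {q' t' : L} (hq : (q, q') ∈ S) (ht : (t, t') ∈ S)
    (D : YoungDiagram) : (eig q t D, eig q' t' D) ∈ S :=
  sub_mem_spec one_mem_spec (mul_mem_spec (mul_mem_spec (sub_mem_spec one_mem_spec hq)
    (sub_mem_spec one_mem_spec ht)) (phi_mem_spec hq ht D))

/-- The vector arises from `s_E` by operations polynomial in `q` and `t`, so its formation commutes
with specialization. -/
lemma conjEigenvec_mem_spec (hS : ∀ n : ℕ, 0 < n → (((n : K))⁻¹, ((n : L))⁻¹) ∈ S)
    {q t : K} {q' t' : L} (hq : (q, q') ∈ S) (ht : (t, t') ∈ S)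
    (E : YoungDiagram) : (conjEigenvec q t E, conjEigenvec q' t' E) ∈ symSpec S := by
  classical
  rw [conjEigenvec, conjEigenvec]
  generalize strictAbove E = s
  induction s using Finset.induction_on with
  | empty => simpa [eigPoly] using schur_mem_spec hS E
  | insert F _ hF ih =>
    rw [eigPoly, eigPoly, Finset.prod_insert hF, Finset.prod_insert hF, map_mul, map_mul,
      Module.End.mul_apply, Module.End.mul_apply, aeval_X_sub_C, aeval_X_sub_C]
    exact sub_mem_spec (macOpConj_mem_spec hS hq ht ih) (smul_mem_symSpec (eig_mem_spec hq ht F) ih)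

lemma evOne_eigenvec_mem_spec (hS : ∀ n : ℕ, 0 < n → (((n : K))⁻¹, ((n : L))⁻¹) ∈ S)
    {q t : K} {q' t' : L} (hq : (q, q') ∈ S) (ht : (t, t') ∈ S)
    (hinv : ∀ k : ℕ+, ((1 - q ^ (k : ℕ))⁻¹, (1 - q' ^ (k : ℕ))⁻¹) ∈ S) (E : YoungDiagram) :
    (evOne K (eigenvec q t E), evOne L (eigenvec q' t' E)) ∈ S :=
  evOne_mem_spec (scale_mem_spec hinv (conjEigenvec_mem_spec hS hq ht E))

end Spec

end HilbChar

end

noncomputable section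

namespace HilbChar

/-! ### The specialization `t = q⁻¹` -/

section Inverse

variable {L : Type*} [Field L]

/-- For `t = q⁻¹` the powers with exponent `σ i` cancel. All Leibniz terms get the same scalar, and
Schur functions become eigenvectors. -/
lemma permScalar_inv {q : L} (hq : q ≠ 0) {N : ℕ} (l : Fin N → ℤ) (σ : Equiv.Perm (Fin N)) :
    permScalar q q⁻¹ l σ = (q⁻¹) ^ N + (1 - q⁻¹) * ∑ i, q ^ (l i) := by
  rw [permScalar]
  congr 2
  refine Finset.sum_congr rfl fun i _ => ?_
  rw [zpow_add₀ hq, zpow_natCast, mul_left_comm, ← mul_pow, inv_mul_cancel₀ hq, one_pow, mul_one]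

lemma macOpConj_schur_inv [CharZero L] {q : L} (hq : q ≠ 0) (E : YoungDiagram) :
    macOpConj q q⁻¹ (schur E) = eig q q⁻¹ E • schur E := by
  rw [← permScalar_one, schur_eq_det_jtMatrix, macOpConj_det_jtMatrix_eq_sum, det_jtMatrix_eq_sum,
    Finset.smul_sum]
  refine Finset.sum_congr rfl fun σ _ => ?_
  rw [permScalar_inv hq, permScalar_inv hq, MvPolynomial.C_mul']

lemma conjEigenvec_inv [CharZero L] {q : L} (hq : q ≠ 0) (E : YoungDiagram) :
    conjEigenvec q q⁻¹ E =
      (∏ F ∈ strictAbove E, (eig q q⁻¹ E - eig q q⁻¹ F)) • schur E := by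
  classical
  rw [conjEigenvec]
  generalize strictAbove E = s
  induction s using Finset.induction_on with
  | empty => simp [eigPoly]
  | insert F s hF ih =>
    rw [eigPoly, Finset.prod_insert hF, map_mul, Module.End.mul_apply, ← eigPoly, ih,
      aeval_X_sub_C, map_smul, macOpConj_schur_inv hq, Finset.prod_insert hF, smul_smul, smul_smul,
      ← sub_smul]
    congr 1
    ring

/-! ### Distinctness of the eigenvalues at `t = q⁻¹` -/

/-- The exponents `i + n - λ_i` of a diagram with `n` cells. -/
def betaExp (n : ℕ) (D : YoungDiagram) (i : Fin n) : ℕ := i + n - D.rowLen i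

lemma rowLen_le_card (D : YoungDiagram) (i : ℕ) : D.rowLen i ≤ D.card := by
  rw [← sum_rowLen D (le_max_left D.card (i + 1))]
  exact Finset.single_le_sum (f := D.rowLen) (fun _ _ => Nat.zero_le _)
    (Finset.mem_range.2 (lt_max_of_lt_right (Nat.lt_succ_self i)))

lemma betaExp_strictMono {n : ℕ} {D : YoungDiagram} (hD : D.card = n) : StrictMono (betaExp n D) := by
  intro i j hij
  have h1 := D.rowLen_anti i j (le_of_lt hij)
  have h2 := rowLen_le_card D i
  have : (i : ℕ) < j := hij
  simp only [betaExp]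
  omega

/-- The extra factor `q⁻¹ ^ n` makes all exponents nonnegative, so the eigenvalue becomes a
polynomial in `q⁻¹` whose exponents encode the row lengths. -/
lemma eig_inv_mul {q : L} (hq : q ≠ 0) {n : ℕ} {D : YoungDiagram} (hD : D.card = n) :
    (eig q q⁻¹ D - q⁻¹ ^ n) * q⁻¹ ^ n = (1 - q⁻¹) * ∑ i, q⁻¹ ^ betaExp n D i := by
  rw [eig_eq q q⁻¹ D hD.le, ← Fin.sum_univ_eq_sum_range (fun i => q⁻¹ ^ i * q ^ D.rowLen i),
    add_sub_cancel_left, mul_assoc, Finset.sum_mul]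
  congr 1
  refine Finset.sum_congr rfl fun i _ => ?_
  have h2 := rowLen_le_card D i
  have h3 : q⁻¹ ^ ((i : ℕ) + n) = q⁻¹ ^ betaExp n D i * q⁻¹ ^ D.rowLen i := by
    rw [← pow_add, betaExp, Nat.sub_add_cancel (by omega)]
  rw [mul_right_comm, ← pow_add, h3, mul_assoc, ← mul_pow, inv_mul_cancel₀ hq, one_pow, mul_one]

/-- By transcendence the two polynomials coincide. No cancellation occurs among nonnegative
coefficients, so they have the same exponent set, which determines an increasing sequence. -/
lemma eq_of_sum_pow_eq {n : ℕ} {f g : Fin n → ℕ} (hf : StrictMono f) (hg : StrictMono g)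
    [Algebra ℚ L] {x : L} (hx : Transcendental ℚ x) (h : ∑ i, x ^ f i = ∑ i, x ^ g i) : f = g := by
  have hpoly : (∑ i, Polynomial.X ^ f i : Polynomial ℚ) = ∑ i, Polynomial.X ^ g i := by
    apply transcendental_iff_injective.1 hx
    simpa using h
  have hmem : ∀ (f : Fin n → ℕ) (k : ℕ),
      (∑ i, Polynomial.X ^ f i : Polynomial ℚ).coeff k ≠ 0 ↔ k ∈ Set.range f := by
    intro f k
    simp only [Polynomial.finsetSum_coeff, Polynomial.coeff_X_pow, Set.mem_range]
    rw [Ne, Finset.sum_eq_zero_iff_of_nonneg (fun i _ => by split_ifs <;> norm_num)]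
    simp [eq_comm]
  apply (StrictMono.range_inj hf hg).1
  ext k
  rw [← hmem, ← hmem, hpoly]

lemma eig_inv_injective [Algebra ℚ L] {q : L} (hq : Transcendental ℚ q⁻¹) {n : ℕ}
    {D E : YoungDiagram} (hD : D.card = n) (hE : E.card = n) (h : eig q q⁻¹ D = eig q q⁻¹ E) :
    D = E := by
  have hq0 : q ≠ 0 := by
    rintro rfl
    rw [inv_zero] at hq
    exact hq (isAlgebraic_zero)
  have h1 : (1 : L) - q⁻¹ ≠ 0 := by
    intro h0
    rw [← sub_eq_zero.1 h0] at hq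
    exact hq (isAlgebraic_one)
  have h2 := eig_inv_mul hq0 hD
  rw [h, eig_inv_mul hq0 hE] at h2
  have h3 := eq_of_sum_pow_eq (betaExp_strictMono hE) (betaExp_strictMono hD) hq
    (mul_left_cancel₀ h1 h2)
  refine diagram_ext fun i => ?_
  by_cases hi : i < n
  · have h4 := congrFun h3 ⟨i, hi⟩
    have h5 := rowLen_le_card D i
    have h6 := rowLen_le_card E i
    simp only [betaExp] at h4
    omega
  · rw [rowLen_eq_zero (by omega), rowLen_eq_zero (by omega)]

/-! ### Nonvanishing of the principal specialization of Schur functions -/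

/-- The principal specialization `h_n[1/(1-q)]`. -/
def principal (q : L) (n : ℕ) : L := evOne L (plethInv q (complete n))

lemma principal_zero (q : L) : principal q 0 = 1 := by
  simp [principal, complete_zero]

variable [CharZero L]

/-- Specializing `H[X(1-q)](u) H(qu) = H(u)` turns its first factor into `1/(1-u)`, so the
generating series `P` satisfies `P(qu) = (1-u) P(u)`. -/
lemma principal_succ {q : L} (hq : ∀ k : ℕ+, 1 - q ^ (k : ℕ) ≠ 0) (n : ℕ) :
    principal q n = (1 - q ^ (n + 1)) * principal q (n + 1) := by
  set η : Sym L →+* L := (evOne L : Sym L →+* L).comp (plethInv q : Sym L →+* Sym L) with hη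
  have h := congrArg (PowerSeries.map η) (map_plethOneSub_hSeries_mul q)
  rw [map_mul] at h
  have h1 : PowerSeries.map η (PowerSeries.map (plethOneSub q : Sym L →+* Sym L) (hSeries L)) =
      PowerSeries.mk 1 := by
    ext k
    simp [hη, hSeries, plethInv_plethOneSub hq, evOne_complete]
  rw [h1] at h
  have h2 := congrArg (fun F => F * (1 - PowerSeries.X)) h
  rw [mul_right_comm, PowerSeries.mk_one_mul_one_sub_eq_one, one_mul, mul_sub, mul_one] at h2
  have h3 := congrArg (PowerSeries.coeff (n + 1)) h2
  rw [map_sub, PowerSeries.coeff_succ_mul_X] at h3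
  have h4 : η (MvPolynomial.C (q ^ (n + 1))) = q ^ (n + 1) := by
    simp [hη, evOne]
  simp only [hSeriesScaled, hSeries, PowerSeries.coeff_map, PowerSeries.coeff_mk, map_mul, h4] at h3
  have h5 : ∀ m, η (complete m) = principal q m := fun m => rfl
  rw [h5, h5] at h3
  linear_combination h3

lemma principal_ne_zero {q : L} (hq : ∀ k : ℕ+, 1 - q ^ (k : ℕ) ≠ 0) (n : ℕ) :
    principal q n ≠ 0 := by
  induction n with
  | zero => rw [principal_zero]; exact one_ne_zero
  | succ n ih =>
    rw [principal_succ hq] at ih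
    exact right_ne_zero_of_mul ih

/-- Iterating the recursion gives `∏_{r<k} (1 - q^(x-r))`, written as a degree `k` polynomial in
`q^x`. For `k > x` the factor `r = x` vanishes, matching `h_m = 0` for `m < 0`. -/
lemma principal_sub {q : L} (hq : ∀ k : ℕ+, 1 - q ^ (k : ℕ) ≠ 0) (hq0 : q ≠ 0) (x k : ℕ) :
    evOne L (plethInv q (completeInt ((x : ℤ) - k))) =
      principal q x * ((∏ r ∈ Finset.range k, -(q ^ r)⁻¹) *
        (∏ r ∈ Finset.range k, (Polynomial.X - Polynomial.C (q ^ r))).eval (q ^ x)) := by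
  rw [Polynomial.eval_prod, ← Finset.prod_mul_distrib]
  simp only [Polynomial.eval_sub, Polynomial.eval_X, Polynomial.eval_C]
  have hf : ∀ r, -(q ^ r)⁻¹ * (q ^ x - q ^ r) = 1 - q ^ x * (q ^ r)⁻¹ := fun r => by
    have : q ^ r ≠ 0 := pow_ne_zero _ hq0
    field_simp
    ring
  simp only [hf]
  rcases lt_or_ge x k with h | h
  · rw [completeInt_of_neg (by omega), Finset.prod_eq_zero (Finset.mem_range.2 h)]
    · simp
    · rw [mul_inv_cancel₀ (pow_ne_zero _ hq0), sub_self]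
  · induction k with
    | zero => simp [completeInt_natCast, principal]
    | succ k ih =>
      have ih' := ih (by omega)
      rw [Finset.prod_range_succ, ← mul_assoc, ← ih',
        show (x : ℤ) - k = ((x - k : ℕ) : ℤ) by omega,
        show (x : ℤ) - (k + 1 : ℕ) = ((x - (k + 1) : ℕ) : ℤ) by omega, completeInt_natCast,
        completeInt_natCast]
      have h1 := principal_succ hq (x - (k + 1))
      rw [show x - (k + 1) + 1 = x - k by omega] at h1
      rw [show evOne L (plethInv q (complete (x - (k + 1)))) = principal q (x - (k + 1)) from rfl,
        show evOne L (plethInv q (complete (x - k))) = principal q (x - k) from rfl, h1,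
        ← div_eq_mul_inv, div_eq_of_eq_mul (pow_ne_zero k hq0)
          (show q ^ x = q ^ (x - k) * q ^ k by rw [← pow_add, Nat.sub_add_cancel (by omega)])]
      ring

/-- With `x_i = λ_i + N - 1 - i`, the Jacobi–Trudi matrix with columns reversed becomes, up to
nonzero row and column factors, the matrix of monic degree `k` polynomials at `q^(x_i)`. Its
determinant is a Vandermonde determinant with distinct nodes. -/
lemma evOne_plethInv_schur_ne {q : L} (hq : ∀ k : ℕ+, 1 - q ^ (k : ℕ) ≠ 0) (hq0 : q ≠ 0)
    (E : YoungDiagram) : evOne L (plethInv q (schur E)) ≠ 0 := by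
  set N := E.card with hN
  set η : Sym L →+* L := (evOne L : Sym L →+* L).comp (plethInv q : Sym L →+* Sym L) with hη
  have h0 : evOne L (plethInv q (schur E)) = η (schur E) := rfl
  rw [h0, schur_eq_det_jtMatrix, RingHom.map_det]
  set x : Fin N → ℕ := fun i => E.rowLen i + (N - 1 - i) with hx
  set p : Fin N → Polynomial L := fun k =>
    ∏ r ∈ Finset.range k, (Polynomial.X - Polynomial.C (q ^ r)) with hp
  set c : Fin N → L := fun k => ∏ r ∈ Finset.range (k : ℕ), -(q ^ r)⁻¹ with hc
  have hmat : η.mapMatrix (jtMatrix L fun i : Fin N => (E.rowLen i : ℤ) - (i : ℤ)) =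
      (Matrix.of fun i j => principal q (x i) * (Matrix.of fun i j => c j *
        (Matrix.of fun i j => (p j).eval (q ^ x i)) i j) i j).submatrix id Fin.revPerm := by
    ext i j
    simp only [RingHom.mapMatrix_apply, Matrix.map_apply, Matrix.submatrix_apply, Matrix.of_apply,
      jtMatrix, id, hc, hp]
    rw [← principal_sub hq hq0]
    have hi := i.2
    have hj := j.2
    have : (E.rowLen i : ℤ) - (i : ℤ) + (j : ℤ) = ((x i : ℕ) : ℤ) - ((Fin.revPerm j : Fin N) : ℕ) := by
      simp only [hx, Fin.revPerm_apply, Fin.val_rev]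
      omega
    rw [this]
    rfl
  rw [hmat, Matrix.det_permute', Matrix.det_mul_column, Matrix.det_mul_row]
  have hdeg : ∀ i : Fin N, (p i).natDegree = i := fun i => by
    simp only [hp]
    rw [Polynomial.natDegree_prod_of_monic _ _ fun r _ => Polynomial.monic_X_sub_C _]
    simp [-map_pow]
  have hmon : ∀ i : Fin N, (p i).Monic := fun i =>
    Polynomial.monic_prod_of_monic _ _ fun r _ => Polynomial.monic_X_sub_C _
  rw [← Matrix.det_eval_matrixOfPolynomials_eq_det_vandermonde _ p hdeg hmon]
  refine mul_ne_zero ?_ (mul_ne_zero ?_ (mul_ne_zero ?_ ?_))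
  · rcases Int.units_eq_one_or (Equiv.Perm.sign (Fin.revPerm : Equiv.Perm (Fin N))) with h | h <;>
      simp [h]
  · exact Finset.prod_ne_zero_iff.2 fun i _ => principal_ne_zero hq _
  · exact Finset.prod_ne_zero_iff.2 fun i _ => Finset.prod_ne_zero_iff.2 fun r _ =>
      neg_ne_zero.2 (inv_ne_zero (pow_ne_zero _ hq0))
  · rw [Matrix.det_vandermonde_ne_zero_iff]
    have hpow : ∀ a b : ℕ, a < b → q ^ a ≠ q ^ b := by
      intro a b hab h
      obtain ⟨d, rfl⟩ := Nat.exists_eq_add_of_lt hab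
      rw [add_assoc, pow_add] at h
      have := mul_left_cancel₀ (pow_ne_zero a hq0) ((mul_one (q ^ a)).trans h)
      exact hq (Nat.succPNat d) (by simp [← this])
    have hxs : ∀ i j : Fin N, i < j → x j < x i := by
      intro i j hij
      have h1 := E.rowLen_anti i j (le_of_lt hij)
      have h2 : (i : ℕ) < j := hij
      have h3 := j.2
      simp only [hx]
      omega
    intro i j hij
    rcases lt_trichotomy i j with h | h | h
    · exact absurd hij.symm (hpow _ _ (hxs i j h))
    · exact h
    · exact absurd hij (hpow _ _ (hxs j i h))

lemma evOne_eigenvec_inv_ne [Algebra ℚ L] {q : L} (hq : ∀ k : ℕ+, 1 - q ^ (k : ℕ) ≠ 0)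
    (hq0 : q ≠ 0) (htr : Transcendental ℚ q⁻¹) (E : YoungDiagram) :
    evOne L (eigenvec q q⁻¹ E) ≠ 0 := by
  rw [eigenvec, conjEigenvec_inv hq0, map_smul, map_smul, smul_eq_mul]
  refine mul_ne_zero (Finset.prod_ne_zero_iff.2 fun F hF => sub_ne_zero.2 fun h => ?_)
    (evOne_plethInv_schur_ne hq hq0 E)
  have hF' := mem_strictAbove.1 hF
  exact hF'.2.2 (eig_inv_injective htr hF'.1 rfl h.symm)

end Inverse

end HilbChar

end

noncomputable section

namespace HilbChar

/-! ### Values of rational functions -/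

section Values

variable {L : Type*} [Field L] [Algebra ℚ L]

lemma algebraMap_ne_zero_of_aeval {a b : L} {Q : MvPolynomial (Fin 2) ℚ}
    (h : MvPolynomial.aeval ![a, b] Q ≠ 0) : algebraMap (MvPolynomial (Fin 2) ℚ) Qzw Q ≠ 0 := by
  intro h0
  have : Q = 0 := by
    apply IsFractionRing.injective (MvPolynomial (Fin 2) ℚ) Qzw
    rw [h0, map_zero]
  rw [this, map_zero] at h
  exact h rfl

/-- The pairs `(f, f(a, b))`, for `f` defined at `(a, b)`. -/
def specAt (a b : L) : Subring (Qzw × L) where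
  carrier := {x | HasValueAt x.1 a b x.2}
  mul_mem' := by
    rintro ⟨f, v⟩ ⟨g, u⟩ ⟨P, Q, hQ, hf, hv⟩ ⟨P', Q', hQ', hg, hu⟩
    simp only at hf hv hg hu
    refine ⟨P * P', Q * Q', by rw [map_mul]; exact mul_ne_zero hQ hQ', ?_, ?_⟩
    · simp only [Prod.mk_mul_mk, hf, hg, map_mul]
      rw [div_mul_div_comm]
    · simp only [Prod.mk_mul_mk, hv, hu, map_mul]
      rw [div_mul_div_comm]
  one_mem' := ⟨1, 1, by simp, by simp, by simp⟩
  add_mem' := by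
    rintro ⟨f, v⟩ ⟨g, u⟩ ⟨P, Q, hQ, hf, hv⟩ ⟨P', Q', hQ', hg, hu⟩
    simp only at hf hv hg hu
    have h1 := algebraMap_ne_zero_of_aeval hQ
    have h2 := algebraMap_ne_zero_of_aeval hQ'
    refine ⟨P * Q' + Q * P', Q * Q', by rw [map_mul]; exact mul_ne_zero hQ hQ', ?_, ?_⟩
    · simp only [Prod.mk_add_mk, hf, hg, map_mul, map_add]
      rw [div_add_div _ _ h1 h2]
    · simp only [Prod.mk_add_mk, hv, hu, map_mul, map_add]
      rw [div_add_div _ _ hQ hQ']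
  zero_mem' := ⟨0, 1, by simp, by simp, by simp⟩
  neg_mem' := by
    rintro ⟨f, v⟩ ⟨P, Q, hQ, hf, hv⟩
    simp only at hf hv
    refine ⟨-P, Q, hQ, ?_, ?_⟩
    · simp only [Prod.neg_mk, hf, map_neg, neg_div]
    · simp only [Prod.neg_mk, hv, map_neg, neg_div]

variable {a b : L}

lemma mem_specAt {f : Qzw} {v : L} : (f, v) ∈ specAt a b ↔ HasValueAt f a b v := Iff.rfl

lemma zVar_mem_specAt : (zVar, a) ∈ specAt a b := ⟨MvPolynomial.X 0, 1, by simp, by simp [zVar], by simp⟩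

lemma wVar_mem_specAt : (wVar, b) ∈ specAt a b := ⟨MvPolynomial.X 1, 1, by simp, by simp [wVar], by simp⟩

lemma eq_zero_of_mem_specAt {v : L} (h : ((0 : Qzw), v) ∈ specAt a b) : v = 0 := by
  obtain ⟨P, Q, hQ, hf, hv⟩ := h
  have hQ' := algebraMap_ne_zero_of_aeval hQ
  simp only at hf hv
  have h1 := (div_eq_zero_iff.1 hf.symm).resolve_right hQ'
  have : P = 0 := by
    apply IsFractionRing.injective (MvPolynomial (Fin 2) ℚ) Qzw
    rw [h1, map_zero]
  rw [hv, this, map_zero, zero_div]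

/-- Genericity over `ℚ(z,w)` is a list of nonvanishing statements, so by this principle a single
point suffices. -/
lemma ne_zero_of_mem_specAt {f : Qzw} {v : L} (h : (f, v) ∈ specAt a b) (hv : v ≠ 0) : f ≠ 0 := by
  rintro rfl
  exact hv (eq_zero_of_mem_specAt h)

lemma inv_mem_specAt {f : Qzw} {v : L} (h : (f, v) ∈ specAt a b) (hv : v ≠ 0) :
    (f⁻¹, v⁻¹) ∈ specAt a b := by
  obtain ⟨P, Q, hQ, hf, hv'⟩ := h
  simp only at hf hv'
  refine ⟨Q, P, fun h0 => hv ?_, ?_, ?_⟩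
  · rw [hv', h0, zero_div]
  · simp only [hf, inv_div]
  · simp only [hv', inv_div]

lemma natCast_inv_mem_specAt (n : ℕ) (hn : 0 < n) :
    (((n : Qzw))⁻¹, ((n : L))⁻¹) ∈ specAt a b := by
  have : CharZero L := algebraRat.charZero L
  exact inv_mem_specAt (natCast_mem (specAt a b) n) (by exact_mod_cast hn.ne')

end Values

/-! ### Genericity of the parameters `z²` and `w²` -/

lemma transcendental_X_sq : Transcendental ℚ ((RatFunc.X : RatFunc ℚ) ^ 2) := by
  refine Transcendental.pow ?_ (by norm_num)
  rw [transcendental_iff_injective]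
  have h : (Polynomial.aeval (RatFunc.X : RatFunc ℚ) : Polynomial ℚ →ₐ[ℚ] RatFunc ℚ).toRingHom =
      algebraMap (Polynomial ℚ) (RatFunc ℚ) := by
    refine Polynomial.ringHom_ext (fun r => ?_) ?_
    · simp
    · simp
  intro p p' hp
  apply RatFunc.algebraMap_injective ℚ
  rw [← h]
  exact hp

lemma transcendental_X_inv_sq : Transcendental ℚ (((RatFunc.X : RatFunc ℚ)⁻¹) ^ 2) := by
  rw [inv_pow]
  intro h
  exact transcendental_X_sq (by simpa using h.inv)

lemma one_sub_pow_ne_zero {L : Type*} [Field L] [Algebra ℚ L] {q : L} (hq : Transcendental ℚ q)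
    (k : ℕ+) : 1 - q ^ (k : ℕ) ≠ 0 := by
  intro h
  refine (hq.pow k.pos) ?_
  rw [← sub_eq_zero.1 h]
  exact isAlgebraic_one

/-- `z²` and `w²` are generic parameters. -/
lemma generic_zVar_wVar (n : ℕ) : Generic (zVar ^ 2) (wVar ^ 2) n := by
  -- The test point is `(x, x⁻¹)`, where the parameters `x²` and `x⁻²` are inverse to each other and
  -- transcendental.
  set x : RatFunc ℚ := RatFunc.X with hx
  have hx0 : x ≠ 0 := RatFunc.X_ne_zero
  have hzS : (zVar ^ 2, x ^ 2) ∈ specAt x x⁻¹ := pow_mem_spec zVar_mem_specAt 2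
  have hwS : (wVar ^ 2, x⁻¹ ^ 2) ∈ specAt x x⁻¹ := pow_mem_spec wVar_mem_specAt 2
  have ht1 := transcendental_X_sq
  have ht2 := transcendental_X_inv_sq
  rw [← hx] at ht1 ht2
  have hi1 : (x ^ 2)⁻¹ = x⁻¹ ^ 2 := (inv_pow x 2).symm
  have hi2 : (x⁻¹ ^ 2)⁻¹ = x ^ 2 := by rw [inv_pow, inv_inv]
  have hq := one_sub_pow_ne_zero ht1
  have ht := one_sub_pow_ne_zero ht2
  have hsub : ∀ {f : Qzw} {v : RatFunc ℚ}, (f, v) ∈ specAt x x⁻¹ → ∀ k : ℕ+,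
      (1 - f ^ (k : ℕ), 1 - v ^ (k : ℕ)) ∈ specAt x x⁻¹ := fun h k =>
    sub_mem_spec one_mem_spec (pow_mem_spec h k)
  have hS := natCast_inv_mem_specAt (a := x) (b := x⁻¹)
  refine ⟨fun k => ne_zero_of_mem_specAt (hsub hzS k) (hq k),
    fun k => ne_zero_of_mem_specAt (hsub hwS k) (ht k), fun D E hD hE h => ?_, fun E _ => ?_,
    fun E _ => ?_⟩
  · have h1 := sub_mem_spec (eig_mem_spec hzS hwS D) (eig_mem_spec hzS hwS E)
    rw [h, sub_self] at h1
    have h2 := sub_eq_zero.1 (eq_zero_of_mem_specAt h1)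
    rw [← hi1] at h2
    exact eig_inv_injective (by rwa [hi1]) hD hE h2
  · refine ne_zero_of_mem_specAt (evOne_eigenvec_mem_spec hS hzS hwS
      (fun k => inv_mem_specAt (hsub hzS k) (hq k)) E) ?_
    rw [← hi1]
    exact evOne_eigenvec_inv_ne hq (pow_ne_zero 2 hx0) (by rwa [hi1]) E
  · intro h0
    refine ne_zero_of_mem_specAt (evOne_eigenvec_mem_spec hS hwS hzS
      (fun k => inv_mem_specAt (hsub hwS k) (ht k)) E) ?_ (by rw [h0, map_zero])
    rw [← hi2]
    exact evOne_eigenvec_inv_ne ht (pow_ne_zero 2 (inv_ne_zero hx0)) (by rwa [hi2]) E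

end HilbChar

end

noncomputable section

namespace HilbChar

/-! ### The plethystic logarithm -/

/-- The chain rule, with `(1 + X) log' = 1` evaluated at `X = f - 1`. -/
lemma mul_derivative_logOf {A : Type*} [CommRing A] [Algebra ℚ A] {f : PowerSeries A}
    (hf : PowerSeries.constantCoeff f = 1) :
    f * PowerSeries.derivative A (PowerSeries.logOf f) = PowerSeries.derivative A f := by
  have hs : PowerSeries.HasSubst (f - 1) := by
    refine PowerSeries.HasSubst.of_constantCoeff_zero' ?_
    rw [map_sub, hf, map_one, sub_self]
  have h1 : (1 + PowerSeries.X) * PowerSeries.derivative A (PowerSeries.log A) = 1 := by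
    rw [PowerSeries.deriv_log]
    ext n
    rw [add_mul, one_mul, map_add]
    cases n with
    | zero => simp
    | succ n =>
      rw [PowerSeries.coeff_succ_X_mul, PowerSeries.coeff_mk, PowerSeries.coeff_mk, ← map_add,
        PowerSeries.coeff_one, if_neg (by omega), pow_succ]
      simp
  have h2 := congrArg (PowerSeries.subst (f - 1)) h1
  rw [PowerSeries.subst_mul hs, PowerSeries.subst_add hs, PowerSeries.subst_X hs,
    ← PowerSeries.coe_substAlgHom hs, map_one, PowerSeries.coe_substAlgHom hs] at h2
  rw [PowerSeries.logOf_eq, PowerSeries.derivative_subst hs, map_sub, ← mul_assoc]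
  rw [show (1 : PowerSeries A) + (f - 1) = f by ring] at h2
  rw [h2, one_mul]
  simp

/-- Power series whose coefficient of `T^n` has degree `n`. -/
def IsGraded {K : Type*} [Field K] (f : PowerSeries (Sym K)) : Prop :=
  ∀ n, PowerSeries.coeff n f ∈ homog K n

lemma mul_mem_homog {K : Type*} [Field K] {m n : ℕ} {f g : Sym K} (hf : f ∈ homog K m)
    (hg : g ∈ homog K n) : f * g ∈ homog K (m + n) :=
  MvPolynomial.IsWeightedHomogeneous.mul hf hg

/-- Comparing coefficients of `T^n` expresses `(n+1) g_{n+1}` by lower terms of the right degree.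
Applied to `log Ω`, this supplies the homogeneity required by the pairing formula. -/
lemma IsGraded.of_mul_derivative_eq {K : Type*} [Field K] [CharZero K] {f g : PowerSeries (Sym K)}
    (hf : IsGraded f) (hf0 : PowerSeries.constantCoeff f = 1)
    (hg0 : PowerSeries.constantCoeff g = 0)
    (h : f * PowerSeries.derivative _ g = PowerSeries.derivative _ f) : IsGraded g := by
  intro n
  induction n using Nat.strong_induction_on with
  | _ n ih =>
    cases n with
    | zero => simp [hg0]
    | succ n =>
      have h1 := congrArg (PowerSeries.coeff n) h
      rw [PowerSeries.coeff_mul, PowerSeries.coeff_derivative,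
        Finset.Nat.sum_antidiagonal_eq_sum_range_succ
          (fun i j => PowerSeries.coeff i f * PowerSeries.coeff j (PowerSeries.derivative _ g)),
        Finset.sum_range_succ'] at h1
      simp only [PowerSeries.coeff_derivative, PowerSeries.coeff_zero_eq_constantCoeff, hf0,
        one_mul, Nat.sub_zero] at h1
      have hC : ∀ k : ℕ, ((k : Sym K) + 1) = MvPolynomial.C ((k : K) + 1) := fun k => by simp
      have h2 : PowerSeries.coeff (n + 1) g * ((n : Sym K) + 1) ∈ homog K (n + 1) := by
        rw [← eq_sub_iff_add_eq'] at h1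
        rw [h1]
        refine Submodule.sub_mem _ ?_ (Submodule.sum_mem _ fun i hi => ?_)
        · rw [hC, mul_comm, MvPolynomial.C_mul']
          exact Submodule.smul_mem _ _ (hf _)
        · have hi' := Finset.mem_range.1 hi
          rw [hC, ← mul_assoc, mul_comm, MvPolynomial.C_mul']
          refine Submodule.smul_mem _ _ ?_
          have := mul_mem_homog (hf (i + 1)) (ih (n - (i + 1) + 1) (by omega))
          rwa [show i + 1 + (n - (i + 1) + 1) = n + 1 by omega] at this
      have h3 : (n : K) + 1 ≠ 0 := by exact_mod_cast Nat.succ_ne_zero n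
      rw [hC, mul_comm, MvPolynomial.C_mul'] at h2
      have h4 := Submodule.smul_mem _ ((n : K) + 1)⁻¹ h2
      rwa [smul_smul, inv_mul_cancel₀ h3, one_smul] at h4

lemma adams_C (d : ℕ+) (a : Qzw) : adams d (MvPolynomial.C a) = MvPolynomial.C (adamsQ d a) := by
  simp [adams]

lemma adams_X (d k : ℕ+) : adams d (MvPolynomial.X k) = MvPolynomial.X (d * k) := by
  simp [adams]

lemma adams_mem_homog (d : ℕ+) {n : ℕ} {f : Sym Qzw} (hf : f ∈ homog Qzw n) :
    adams d f ∈ homog Qzw (d * n) := by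
  rw [MvPolynomial.as_sum f, map_sum]
  refine Submodule.sum_mem _ fun m hm => ?_
  have hw : wt m = n := hf (MvPolynomial.mem_support_iff.1 hm)
  rw [MvPolynomial.monomial_eq, map_mul, adams_C, MvPolynomial.C_mul']
  refine Submodule.smul_mem _ _ ?_
  rw [Finsupp.prod, map_prod]
  have := MvPolynomial.IsWeightedHomogeneous.prod (R := Qzw) (w := fun k : ℕ+ => (k : ℕ))
    m.support (fun k => adams d (MvPolynomial.X k ^ m k)) (fun k => m k • ((d * k : ℕ+) : ℕ))
    (fun k _ => by
      rw [map_pow, adams_X]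
      exact (MvPolynomial.isWeightedHomogeneous_X Qzw _ (d * k)).pow (m k))
  have hsum : ∑ k ∈ m.support, m k • ((d * k : ℕ+) : ℕ) = d * n := by
    rw [← hw, wt, Finsupp.weight_apply, Finsupp.sum, Finset.mul_sum]
    refine Finset.sum_congr rfl fun k _ => ?_
    simp only [smul_eq_mul, PNat.mul_coe]
    ring
  rw [hsum] at this
  exact this

/-- The image of `adams d` involves only the `p_k` with `d ∣ k`, so `p_1` does not occur. -/
lemma kappa_adams {d : ℕ+} (hd : d ≠ 1) (f : Sym Qzw) : kappa Qzw (adams d f) = 0 := by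
  have h : MvPolynomial.pderiv 1 (adams d f) = 0 := by
    induction f using MvPolynomial.induction_on with
    | C a => rw [adams_C, MvPolynomial.pderiv_C]
    | add f g hf hg => rw [map_add, map_add, hf, hg, add_zero]
    | mul_X f k hf =>
      have hk : d * k ≠ 1 := fun h => hd (by
        have h1 := congrArg PNat.val h
        rw [PNat.mul_coe, PNat.one_coe] at h1
        exact PNat.eq (Nat.eq_one_of_mul_eq_one_right h1))
      rw [map_mul, adams_X, Derivation.leibniz, hf, MvPolynomial.pderiv_X_of_ne hk, smul_zero,
        smul_zero, add_zero]
  rw [kappa_apply, h, map_zero]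

lemma adams_one (f : Sym Qzw) : adams 1 f = f := by
  have hQ : adamsQ 1 = RingHom.id Qzw := by
    refine IsFractionRing.ringHom_ext (A := MvPolynomial (Fin 2) ℚ) fun x => ?_
    rw [adamsQ, IsFractionRing.map, IsLocalization.map_eq]
    simp
  have : adams 1 = RingHom.id (Sym Qzw) := by
    refine MvPolynomial.ringHom_ext (fun r => ?_) fun k => ?_
    · rw [adams_C, hQ]; rfl
    · rw [adams_X, one_mul]; rfl
  rw [this]; rfl

lemma diagram_zero (lam : (0 : ℕ).Partition) : (diagram lam).cells = ∅ :=
  Finset.card_eq_zero.1 (card_diagram lam)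

lemma constantCoeff_seriesA0 {K : Type*} [Field K] (z w : K) :
    PowerSeries.constantCoeff (seriesA0 z w) = 1 := by
  rw [← PowerSeries.coeff_zero_eq_constantCoeff_apply, seriesA0, PowerSeries.coeff_mk]
  simp [hook, diagram_zero]

lemma constantCoeff_seriesA1 {K : Type*} [Field K] (z w : K) :
    PowerSeries.constantCoeff (seriesA1 z w) = 0 := by
  rw [← PowerSeries.coeff_zero_eq_constantCoeff_apply, seriesA1, PowerSeries.coeff_mk]
  simp [phi, diagram_zero]

lemma map_evOne_Omega :
    PowerSeries.map (evOne Qzw : Sym Qzw →+* Qzw) (Omega 1) = seriesA0 zVar wVar := by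
  ext n
  rw [PowerSeries.coeff_map, Omega, seriesA0, PowerSeries.coeff_mk, PowerSeries.coeff_mk, map_sum]
  refine Finset.sum_congr rfl fun lam _ => ?_
  have := (generic_zVar_wVar n).evOne_macdonald lam
  rw [show (evOne Qzw : Sym Qzw →+* Qzw) (hook 1 zVar wVar (diagram lam) •
    macdonald (zVar ^ 2) (wVar ^ 2) (diagram lam)) = evOne Qzw (hook 1 zVar wVar (diagram lam) •
    macdonald (zVar ^ 2) (wVar ^ 2) (diagram lam)) from rfl, map_smul, this, smul_eq_mul, mul_one]

lemma kappa_coeff_Omega (n : ℕ) :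
    kappa Qzw (PowerSeries.coeff n (Omega 1)) = PowerSeries.coeff n (seriesA1 zVar wVar) := by
  rw [Omega, seriesA1, PowerSeries.coeff_mk, PowerSeries.coeff_mk, map_sum]
  refine Finset.sum_congr rfl fun lam _ => ?_
  rw [map_smul, (generic_zVar_wVar n).kappa_macdonald lam, smul_eq_mul]

lemma isGraded_Omega : IsGraded (Omega 1) := by
  intro n
  rw [Omega, PowerSeries.coeff_mk]
  exact Submodule.sum_mem _ fun lam _ =>
    Submodule.smul_mem _ _ ((generic_zVar_wVar n).macdonald_mem_homog lam)

/-- A homogeneous element of degree `0` is a scalar, hence determined by its evaluation. -/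
lemma constantCoeff_Omega : PowerSeries.constantCoeff (Omega 1) = 1 := by
  have h0 := isGraded_Omega 0
  have h1 : PowerSeries.coeff 0 (Omega 1) =
      MvPolynomial.C ((PowerSeries.coeff 0 (Omega 1)).coeff 0) := by
    ext m
    rw [MvPolynomial.coeff_C]
    split_ifs with h
    · rw [h]
    · by_contra hc
      have hw : wt m = 0 := h0 hc
      refine h ?_
      ext k
      have := Finsupp.le_weight (fun k : ℕ+ => (k : ℕ)) k.ne_zero m
      rw [show Finsupp.weight (fun k : ℕ+ => (k : ℕ)) m = 0 from hw] at this
      simp at this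
      simp [this]
  have h2 := congrArg (PowerSeries.coeff 0) map_evOne_Omega
  rw [PowerSeries.coeff_map, PowerSeries.coeff_zero_eq_constantCoeff_apply (seriesA0 _ _),
    constantCoeff_seriesA0, h1] at h2
  have h3 : (evOne Qzw : Sym Qzw →+* Qzw)
      (MvPolynomial.C ((PowerSeries.coeff 0 (Omega 1)).coeff 0)) =
      (PowerSeries.coeff 0 (Omega 1)).coeff 0 := by
    simp [evOne]
  rw [h3] at h2
  rw [← PowerSeries.coeff_zero_eq_constantCoeff_apply, h1, h2, map_one]

/-- Apply `evOne` and the derivation `kappa` to `Ω (log Ω)' = Ω'`. With `e` and `k` the images of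
`log Ω`, this gives `A_0 e' = A_0'` and `A_1 e' + A_0 k' = A_1'`, whence `k' = (A_1/A_0)'`; both
constant terms are zero. -/
lemma kappa_coeff_logOf_Omega (n : ℕ) :
    kappa Qzw (PowerSeries.coeff n (PowerSeries.logOf (Omega 1))) =
      PowerSeries.coeff n (seriesA1 zVar wVar * (seriesA0 zVar wVar)⁻¹) := by
  set l := PowerSeries.logOf (Omega 1) with hl
  set A0 := seriesA0 zVar wVar with hA0
  set A1 := seriesA1 zVar wVar with hA1
  set k : PowerSeries Qzw := PowerSeries.mk fun n => kappa Qzw (PowerSeries.coeff n l) with hk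
  have hode := mul_derivative_logOf constantCoeff_Omega
  rw [← hl] at hode
  have hl0 : PowerSeries.constantCoeff l = 0 := PowerSeries.constantCoeff_logOf constantCoeff_Omega
  set e := PowerSeries.map (evOne Qzw : Sym Qzw →+* Qzw) l with he
  have h1 : A0 * PowerSeries.derivative Qzw e = PowerSeries.derivative Qzw A0 := by
    have := congrArg (PowerSeries.map (evOne Qzw : Sym Qzw →+* Qzw)) hode
    rwa [map_mul, ← derivative_map, ← derivative_map, map_evOne_Omega] at this
  have hkd : ∀ (F : PowerSeries (Sym Qzw)) (G : PowerSeries Qzw),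
      (∀ n, kappa Qzw (PowerSeries.coeff n F) = PowerSeries.coeff n G) → ∀ n,
      kappa Qzw (PowerSeries.coeff n (PowerSeries.derivative _ F)) =
        PowerSeries.coeff n (PowerSeries.derivative _ G) := by
    intro F G h n
    rw [PowerSeries.coeff_derivative, PowerSeries.coeff_derivative,
      show ((n : Sym Qzw) + 1) = MvPolynomial.C ((n : Qzw) + 1) by simp, mul_comm,
      MvPolynomial.C_mul', map_smul, h, smul_eq_mul, mul_comm]
  have h2 : A1 * PowerSeries.derivative Qzw e + A0 * PowerSeries.derivative Qzw k =
      PowerSeries.derivative Qzw A1 := by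
    ext m
    rw [← hkd (Omega 1) A1 kappa_coeff_Omega, ← hode, PowerSeries.coeff_mul, map_sum, map_add,
      PowerSeries.coeff_mul, PowerSeries.coeff_mul, ← Finset.sum_add_distrib]
    refine Finset.sum_congr rfl fun x _ => ?_
    rw [kappa_mul, kappa_coeff_Omega, hkd l k (fun n => by rw [hk, PowerSeries.coeff_mk]), he,
      derivative_map, PowerSeries.coeff_map, hA0, ← map_evOne_Omega, PowerSeries.coeff_map]
    rfl
  have hA00 : PowerSeries.constantCoeff A0 ≠ 0 := by
    rw [hA0, constantCoeff_seriesA0]; exact one_ne_zero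
  set g := A1 * A0⁻¹ with hg
  have hgA : A1 = g * A0 := by
    rw [hg, mul_assoc, PowerSeries.inv_mul_cancel _ hA00, mul_one]
  have h3 : PowerSeries.derivative Qzw k = PowerSeries.derivative Qzw g := by
    have hA0ne : A0 ≠ 0 := fun h => hA00 (by rw [h, map_zero])
    apply mul_left_cancel₀ hA0ne
    have h4 : PowerSeries.derivative Qzw A1 = g * PowerSeries.derivative Qzw A0 +
        A0 * PowerSeries.derivative Qzw g := by rw [hgA, derivative_mul]
    have h5 : A1 * PowerSeries.derivative Qzw e = g * PowerSeries.derivative Qzw A0 := by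
      rw [hgA, mul_assoc, h1]
    rw [h4, h5] at h2
    exact add_left_cancel h2
  have h4 : k = g := by
    refine PowerSeries.derivative.ext h3 ?_
    rw [hg, map_mul, hA1, constantCoeff_seriesA1, zero_mul,
      ← PowerSeries.coeff_zero_eq_constantCoeff_apply, hk, PowerSeries.coeff_mk,
      PowerSeries.coeff_zero_eq_constantCoeff_apply, hl0, map_zero]
  rw [← h4, hk, PowerSeries.coeff_mk]

lemma ratCast_smul_eq {M : Type*} [AddCommGroup M] [Module Qzw M] [Module ℚ M] (r : ℚ) (x : M) :
    (r : Qzw) • x = r • x := Rat.cast_smul_eq_qsmul Qzw r x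

lemma rat_smul_eq (r : ℚ) (x : Sym Qzw) : r • x = (r : Qzw) • x := by
  ext m
  rw [MvPolynomial.coeff_smul, MvPolynomial.coeff_smul, smul_eq_mul]
  exact (@ratCast_smul_eq Qzw _ _ Algebra.toModule r (MvPolynomial.coeff m x)).symm

lemma coeff_plethLog_Omega_mem_homog {n : ℕ} (hn : 1 ≤ n) :
    PowerSeries.coeff n (plethLog (Omega 1)) ∈ homog Qzw n := by
  have hgr : IsGraded (PowerSeries.logOf (Omega 1)) :=
    isGraded_Omega.of_mul_derivative_eq constantCoeff_Omega
      (PowerSeries.constantCoeff_logOf constantCoeff_Omega) (mul_derivative_logOf constantCoeff_Omega)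
  rw [plethLog, PowerSeries.coeff_mk, Finset.sum_congr rfl fun d _ => rat_smul_eq _ _]
  refine Submodule.sum_mem _ fun d hd => ?_
  have hdn := Nat.dvd_of_mem_divisors hd
  have hd0 : 0 < d := Nat.pos_of_dvd_of_pos hdn hn
  have h1 := adams_mem_homog d.toPNat' (hgr (n / d))
  rw [Nat.toPNat'_coe, if_pos hd0, Nat.mul_div_cancel' hdn] at h1
  exact Submodule.smul_mem _ _ h1

/-- The `(n-1,1)` character in terms of the series `A_0` and `A_1`. -/
lemma charH_almostRow (n : ℕ) (hn : 1 ≤ n) :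
    charH 1 (almostRow n hn) = (zVar ^ 2 - 1) * (1 - wVar ^ 2) *
      PowerSeries.coeff n (seriesA1 zVar wVar * (seriesA0 zVar wVar)⁻¹) := by
  rw [charH, completeProd_almostRow]
  congr 1
  obtain ⟨m, rfl⟩ : ∃ m, n = m + 1 := ⟨n - 1, by omega⟩
  rw [Nat.add_sub_cancel, hall_complete_mul_X (coeff_plethLog_Omega_mem_homog hn),
    ← kappa_coeff_logOf_Omega, plethLog, PowerSeries.coeff_mk,
    Finset.sum_congr rfl fun d _ => rat_smul_eq _ _, map_sum, Finset.sum_eq_single 1]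
  · have : (1 : ℕ).toPNat' = 1 := rfl
    simp [this, adams_one]
  · intro d hd hd1
    have hd0 : 0 < d := Nat.pos_of_mem_divisors hd
    rw [map_smul, kappa_adams, smul_zero]
    intro h
    have := congrArg PNat.val h
    rw [show PNat.val d.toPNat' = d by
      rw [Nat.toPNat'_coe, if_pos hd0]] at this
    exact hd1 this
  · intro h
    simp at h

end HilbChar

end

noncomputable section

namespace HilbChar

/-! ### Specialization of the generating series -/

section Specialization

/-- The constant term is `1`, so the recursion for the inverse needs no division. -/
lemma inv_mem_seriesSpec {K L : Type*} [Field K] [Field L] {S : Subring (K × L)}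
    {f : PowerSeries K} {g : PowerSeries L} (hf : PowerSeries.constantCoeff f = 1)
    (hg : PowerSeries.constantCoeff g = 1)
    (h : ∀ n, (PowerSeries.coeff n f, PowerSeries.coeff n g) ∈ S) (n : ℕ) :
    (PowerSeries.coeff n f⁻¹, PowerSeries.coeff n g⁻¹) ∈ S := by
  induction n using Nat.strong_induction_on with
  | _ n ih =>
    rw [PowerSeries.coeff_inv, PowerSeries.coeff_inv, hf, hg, inv_one, inv_one]
    split_ifs with h0
    · exact one_mem_spec
    · rw [neg_one_mul, neg_one_mul, ← Prod.neg_mk]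
      refine S.neg_mem (sum_mem_spec fun x _ => ?_)
      split_ifs with hx
      · exact mul_mem_spec (h _) (ih _ hx)
      · exact zero_mem_spec

variable {L : Type*} [Field L] [Algebra ℚ L] {a b : L}

lemma hook_mem_specAt (h1 : ∀ k l : ℕ, a ^ (2 * k + 2) - b ^ (2 * l) ≠ 0)
    (h2 : ∀ k l : ℕ, a ^ (2 * k) - b ^ (2 * l + 2) ≠ 0) (D : YoungDiagram) :
    (hook 1 zVar wVar D, hook 1 a b D) ∈ specAt a b := by
  refine prod_mem_spec fun s _ => ?_
  have hsub : ∀ k l : ℕ, (zVar ^ k - wVar ^ l, a ^ k - b ^ l) ∈ specAt a b := fun k l =>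
    sub_mem_spec (pow_mem_spec zVar_mem_specAt k) (pow_mem_spec wVar_mem_specAt l)
  rw [div_eq_mul_inv, div_eq_mul_inv]
  exact mul_mem_spec (pow_mem_spec (hsub _ _) _) (inv_mem_specAt
    (mul_mem_spec (hsub _ _) (hsub _ _)) (mul_ne_zero (h1 _ _) (h2 _ _)))

lemma charH_almostRow_hasValueAt (h1 : ∀ k l : ℕ, a ^ (2 * k + 2) - b ^ (2 * l) ≠ 0)
    (h2 : ∀ k l : ℕ, a ^ (2 * k) - b ^ (2 * l + 2) ≠ 0) (n : ℕ) (hn : 1 ≤ n) :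
    HasValueAt (charH 1 (almostRow n hn)) a b
      ((a ^ 2 - 1) * (1 - b ^ 2) * PowerSeries.coeff n (seriesA1 a b * (seriesA0 a b)⁻¹)) := by
  have hz : (zVar ^ 2, a ^ 2) ∈ specAt a b := pow_mem_spec zVar_mem_specAt 2
  have hw : (wVar ^ 2, b ^ 2) ∈ specAt a b := pow_mem_spec wVar_mem_specAt 2
  rw [charH_almostRow, ← mem_specAt, PowerSeries.coeff_mul, PowerSeries.coeff_mul]
  refine mul_mem_spec (mul_mem_spec (sub_mem_spec hz one_mem_spec) (sub_mem_spec one_mem_spec hw))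
    (sum_mem_spec fun x _ => mul_mem_spec ?_ (inv_mem_seriesSpec (constantCoeff_seriesA0 _ _)
      (constantCoeff_seriesA0 _ _) (fun m => ?_) _))
  · rw [seriesA1, seriesA1, PowerSeries.coeff_mk, PowerSeries.coeff_mk]
    exact sum_mem_spec fun lam _ => mul_mem_spec (hook_mem_specAt h1 h2 _) (phi_mem_spec hz hw _)
  · rw [seriesA0, seriesA0, PowerSeries.coeff_mk, PowerSeries.coeff_mk]
    exact sum_mem_spec fun lam _ => hook_mem_specAt h1 h2 _

lemma X_pow_ne_one {m : ℕ} (hm : m ≠ 0) : (RatFunc.X : RatFunc ℚ) ^ m ≠ 1 := by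
  intro h
  have h1 := one_sub_pow_ne_zero transcendental_X_sq ⟨m, Nat.pos_of_ne_zero hm⟩
  apply h1
  rw [PNat.mk_coe, ← pow_mul, mul_comm, pow_mul, h, one_pow, sub_self]

lemma X_pow_sub_X_inv_pow_ne_zero {m n : ℕ} (h : m + n ≠ 0) :
    (RatFunc.X : RatFunc ℚ) ^ m - (RatFunc.X)⁻¹ ^ n ≠ 0 := by
  intro h0
  apply X_pow_ne_one h
  have hX : (RatFunc.X : RatFunc ℚ) ≠ 0 := RatFunc.X_ne_zero
  rw [pow_add, sub_eq_zero.1 h0, inv_pow, inv_mul_cancel₀ (pow_ne_zero _ hX)]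

lemma zero_pow_sub_X_pow_ne_zero {m n : ℕ} (h : m ≠ 0 ∨ n ≠ 0) :
    (0 : RatFunc ℚ) ^ m - RatFunc.X ^ n ≠ 0 := by
  have hX : (RatFunc.X : RatFunc ℚ) ≠ 0 := RatFunc.X_ne_zero
  rcases eq_or_ne m 0 with rfl | hm
  · rw [pow_zero]
    exact fun h0 => X_pow_ne_one (h.resolve_left (by simp)) (sub_eq_zero.1 h0).symm
  · rw [zero_pow hm, zero_sub]
    exact neg_ne_zero.2 (pow_ne_zero _ hX)

end Specialization

end HilbChar

end

noncomputable section

namespace HilbChar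

/-! ### Generating functions of partitions modulo a power of `T` -/

section GenFun

variable {K : Type*} [Field K]

/-- Reduction of power series modulo `T ^ (N + 1)`. -/
abbrev modX (K : Type*) [Field K] (N : ℕ) :
    PowerSeries K →+* PowerSeries K ⧸ Ideal.span {(PowerSeries.X : PowerSeries K) ^ (N + 1)} :=
  Ideal.Quotient.mk _

lemma modX_eq_iff {N : ℕ} {f g : PowerSeries K} :
    modX K N f = modX K N g ↔ ∀ m ≤ N, PowerSeries.coeff m f = PowerSeries.coeff m g := by
  rw [Ideal.Quotient.eq, Ideal.mem_span_singleton, PowerSeries.X_pow_dvd_iff]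
  simp only [map_sub, sub_eq_zero, Nat.lt_succ_iff]

lemma modX_X_pow_mul {N m : ℕ} (h : N < m) (f : PowerSeries K) :
    modX K N (PowerSeries.X ^ m * f) = 0 := by
  rw [Ideal.Quotient.eq_zero_iff_mem, Ideal.mem_span_singleton]
  exact Dvd.dvd.mul_right (pow_dvd_pow _ h) f

/-- The series `∑ e_m T ^ (k m)`. -/
def stretch (k : ℕ) (e : ℕ → K) : PowerSeries K :=
  PowerSeries.mk fun n => if k ∣ n then e (n / k) else 0

lemma one_sub_mul_stretch (a : K) {k : ℕ} (hk : 0 < k) (e : ℕ → K) :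
    (1 - PowerSeries.C a * PowerSeries.X ^ k) * stretch k e =
      stretch k fun m => e m - a * (if m = 0 then 0 else e (m - 1)) := by
  ext n
  rw [sub_mul, one_mul, map_sub, mul_assoc, PowerSeries.coeff_C_mul, PowerSeries.coeff_X_pow_mul']
  simp only [stretch, PowerSeries.coeff_mk]
  by_cases hn : k ∣ n
  · obtain ⟨m, rfl⟩ := hn
    cases m with
    | zero => simp [hk.ne']
    | succ m =>
      have h1 : k * (m + 1) - k = k * m := by rw [mul_add, mul_one, Nat.add_sub_cancel]
      have h2 : k ≤ k * (m + 1) := Nat.le_mul_of_pos_right _ (Nat.succ_pos _)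
      simp [h1, h2, Nat.mul_div_cancel_left _ hk]
  · have h1 : k ≤ n → ¬ k ∣ n - k := fun h h' => hn (by
      have := dvd_add h' (dvd_refl k)
      rwa [Nat.sub_add_cancel h] at this)
    rw [if_neg hn, if_neg hn]
    by_cases h : k ≤ n
    · simp [h, h1 h]
    · simp [h]

lemma stretch_zero_one {k : ℕ} (hk : 0 < k) {e : ℕ → K} (h0 : e 0 = 1) (h : ∀ m, e (m + 1) = 0) :
    stretch k e = 1 := by
  ext n
  rw [stretch, PowerSeries.coeff_mk, PowerSeries.coeff_one]
  rcases eq_or_ne n 0 with rfl | hn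
  · simp [h0]
  · rw [if_neg hn]
    split_ifs with hd
    · obtain ⟨m, rfl⟩ := hd
      obtain ⟨m, rfl⟩ : ∃ l, m = l + 1 := ⟨m - 1, by
        have : m ≠ 0 := by rintro rfl; simp at hn
        omega⟩
      rw [Nat.mul_div_cancel_left _ hk, h]
    · rfl

open scoped PowerSeries.WithPiTopology in
-- Part sizes above `N` contribute factors that are `1` modulo `T^(N+1)`, so the infinite product
-- may be truncated.
lemma modX_genFun (N : ℕ) {f : ℕ → ℕ → K} (hf : ∀ k, f k 0 = 1) :
    modX K N (Nat.Partition.genFun f) = modX K N (∏ i ∈ Finset.range N, stretch (i + 1) (f (i + 1))) := by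
  -- With discrete coefficients, convergence of the product means that each coefficient is
  -- eventually constant.
  let _ : TopologicalSpace K := ⊥
  have : DiscreteTopology K := ⟨rfl⟩
  have hterm : ∀ i, (1 : PowerSeries K) + ∑' j, f (i + 1) (j + 1) •
      (PowerSeries.X : PowerSeries K) ^ ((i + 1) * (j + 1)) = stretch (i + 1) (f (i + 1)) := by
    intro i
    ext n
    rw [map_add, (Nat.Partition.summable_genFun_term f i).map_tsum _
      (PowerSeries.WithPiTopology.continuous_coeff _ _), stretch, PowerSeries.coeff_mk,
      PowerSeries.coeff_one]
    simp only [map_smul, PowerSeries.coeff_X_pow, smul_eq_mul, mul_ite, mul_one, mul_zero]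
    split_ifs with h0 hd hd
    · subst h0
      rw [Nat.zero_div, hf]
      simp
    · exact absurd (h0 ▸ dvd_zero _) hd
    · obtain ⟨m, rfl⟩ := hd
      obtain ⟨m, rfl⟩ : ∃ l, m = l + 1 := ⟨m - 1, by
        have : m ≠ 0 := by rintro rfl; simp at h0
        omega⟩
      rw [Nat.mul_div_cancel_left _ (Nat.succ_pos _), zero_add, tsum_eq_single m]
      · simp
      · intro b hb
        rw [if_neg]
        intro h
        have := Nat.eq_of_mul_eq_mul_left (Nat.succ_pos i) h
        omega
    · rw [zero_add]
      refine (tsum_congr fun j => if_neg ?_).trans tsum_zero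
      rintro rfl
      exact hd (dvd_mul_right _ _)
  have hp := Nat.Partition.hasProd_genFun f
  simp only [hterm] at hp
  rw [HasProd, PowerSeries.WithPiTopology.tendsto_iff_coeff_tendsto] at hp
  have hone : ∀ i, N ≤ i → modX K N (stretch (i + 1) (f (i + 1))) = 1 := by
    intro i hi
    rw [← map_one (modX K N), modX_eq_iff]
    intro m hm
    rw [stretch, PowerSeries.coeff_mk, PowerSeries.coeff_one]
    split_ifs with hd h0 h0
    · rw [h0, Nat.zero_div, hf]
    · exact absurd (Nat.le_of_dvd (Nat.pos_of_ne_zero h0) hd) (by omega)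
    · exact absurd (h0 ▸ dvd_zero _) hd
    · rfl
  rw [modX_eq_iff]
  intro m hm
  refine tendsto_nhds_unique (hp m) (tendsto_atTop_of_eventually_const (i₀ := Finset.range N) ?_)
  intro s hs
  refine modX_eq_iff.1 ?_ m hm
  rw [← Finset.prod_sdiff (show Finset.range N ⊆ s from hs), map_mul, map_prod,
    Finset.prod_eq_one, one_mul]
  intro i hi
  exact hone i (by simpa using (Finset.mem_sdiff.1 hi).2)

lemma modX_genFun_pow_mul (N : ℕ) (g : ℕ → K) :
    modX K N (Nat.Partition.genFun (fun k c => g k ^ c) *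
      ∏ i ∈ Finset.range N, (1 - PowerSeries.C (g (i + 1)) * PowerSeries.X ^ (i + 1))) = 1 := by
  rw [map_mul, modX_genFun N (fun k => pow_zero _), ← map_mul, ← Finset.prod_mul_distrib,
    Finset.prod_eq_one, map_one]
  intro i _
  rw [mul_comm, one_sub_mul_stretch _ (Nat.succ_pos i)]
  refine stretch_zero_one (Nat.succ_pos i) (by simp) fun m => ?_
  simp [pow_succ']

lemma toFinsupp_prod_pow (m : Multiset ℕ) (g : ℕ → K) :
    (Multiset.toFinsupp m).prod (fun k c => g k ^ c) = (m.map g).prod := by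
  rw [Finset.prod_multiset_map_count, Finsupp.prod, Multiset.toFinsupp_support]
  rfl

lemma prod_map_ite (m : Multiset ℕ) (p : ℕ → Prop) [DecidablePred p] (x : K) :
    (m.map fun k => if p k then x else 1).prod = x ^ (m.filter p).card := by
  induction m using Multiset.induction_on with
  | empty => simp
  | cons a m ih =>
    rw [Multiset.map_cons, Multiset.prod_cons, ih]
    by_cases h : p a
    · rw [if_pos h, Multiset.filter_cons_of_pos _ h, Multiset.card_cons, pow_succ']
    · rw [if_neg h, Multiset.filter_cons_of_neg _ h, one_mul]

lemma lt_colLen_iff {D : YoungDiagram} {i j : ℕ} : i < D.colLen j ↔ j < D.rowLen i := by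
  rw [← YoungDiagram.mem_iff_lt_colLen, YoungDiagram.mem_iff_lt_rowLen]

lemma sum_ite_getElem (L : List ℕ) (p : ℕ → Prop) [DecidablePred p] :
    (∑ i : Fin L.length, if p L[i] then 1 else 0) = L.countP fun b => p b := by
  refine (Fin.sum_univ_fun_getElem L fun a => if p a then 1 else 0).trans ?_
  induction L with
  | nil => simp
  | cons a L ih =>
    rw [List.countP_cons, List.map_cons, List.sum_cons, ih, add_comm]
    simp

lemma colLen_diagram {n : ℕ} (lam : n.Partition) (j : ℕ) :
    (diagram lam).colLen j = (lam.parts.filter (j < ·)).card := by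
  set L := lam.parts.sort (· ≥ ·) with hL
  have h1 : Finset.range ((diagram lam).colLen j) =
      (Finset.range L.length).filter fun i => j < (diagram lam).rowLen i := by
    ext i
    rw [Finset.mem_filter, Finset.mem_range, Finset.mem_range, lt_colLen_iff]
    refine ⟨fun h => ⟨?_, h⟩, fun h => h.2⟩
    by_contra hc
    rw [rowLen_diagram, List.getD_eq_default _ _ (by rw [← hL]; omega)] at h
    omega
  have h2 : lam.parts = (L : Multiset ℕ) := (Multiset.sort_eq _ _).symm
  rw [← Finset.card_range ((diagram lam).colLen j), h1, Finset.card_filter, h2,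
    ← Multiset.countP_eq_card_filter, Multiset.coe_countP,
    ← Fin.sum_univ_eq_sum_range (fun i => if j < (diagram lam).rowLen i then 1 else 0)]
  have h3 : ∀ i : Fin L.length, (diagram lam).rowLen i = L[i] := fun i => by
    rw [rowLen_diagram, List.getD_eq_getElem _ _ i.2]; rfl
  simp only [h3]
  exact sum_ite_getElem L _

end GenFun

end HilbChar

end

noncomputable section

namespace HilbChar

/-! ### The curve `w = 1 / z` -/

section Inverse

variable {K : Type*} [Field K]

/-- The product `(1 - a T) (1 - a T²) ⋯ (1 - a T^N)`. -/
def qPoch (a : K) (N : ℕ) : PowerSeries K :=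
  ∏ i ∈ Finset.range N, (1 - PowerSeries.C a * PowerSeries.X ^ (i + 1))

lemma qPoch_succ (a : K) (N : ℕ) :
    qPoch a (N + 1) = qPoch a N * (1 - PowerSeries.C a * PowerSeries.X ^ (N + 1)) :=
  Finset.prod_range_succ _ _

lemma constantCoeff_qPoch (a : K) (N : ℕ) : PowerSeries.constantCoeff (qPoch a N) = 1 := by
  rw [qPoch, map_prod]
  refine Finset.prod_eq_one fun i _ => ?_
  simp

lemma qPoch_mul_inv (a : K) (N : ℕ) : qPoch a N * (qPoch a N)⁻¹ = 1 :=
  PowerSeries.mul_inv_cancel _ (by rw [constantCoeff_qPoch]; exact one_ne_zero)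

lemma inv_qPoch_eq (a : K) (N : ℕ) :
    (qPoch a N)⁻¹ = (1 - PowerSeries.C a * PowerSeries.X ^ (N + 1)) * (qPoch a (N + 1))⁻¹ := by
  have h : qPoch a N ≠ 0 := fun h => by simpa [h] using constantCoeff_qPoch a N
  apply mul_left_cancel₀ h
  rw [qPoch_mul_inv, ← mul_assoc, ← qPoch_succ, qPoch_mul_inv]

lemma eig_eq_colLen (q t : K) (D : YoungDiagram) {N : ℕ} (hN : D.card ≤ N) :
    eig q t D = q ^ N + (1 - q) * ∑ j ∈ Finset.range N, q ^ j * t ^ D.colLen j := by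
  rw [← eig_transpose, eig_eq t q D.transpose (N := N) (by rwa [card_transpose])]
  simp only [YoungDiagram.rowLen_transpose]

/-- The generating function of `x ^ (λ'_j)`. -/
def colSeries (x : K) (j : ℕ) : PowerSeries K :=
  Nat.Partition.genFun fun k c => (if j < k then x else 1) ^ c

lemma coeff_colSeries (x : K) (j n : ℕ) :
    PowerSeries.coeff n (colSeries x j) = ∑ lam : n.Partition, x ^ (diagram lam).colLen j := by
  rw [colSeries, Nat.Partition.coeff_genFun]
  refine Finset.sum_congr rfl fun lam _ => ?_
  rw [toFinsupp_prod_pow, prod_map_ite, colLen_diagram]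

/-- The length of column `j` counts the parts greater than `j`. Parts of size at most `j` thus
contribute `1/(1 - T^i)` and larger ones `1/(1 - x T^i)`. -/
lemma modX_colSeries (x : K) {j N : ℕ} (hj : j ≤ N) :
    modX K N (colSeries x j * qPoch x N) = modX K N (qPoch x j * (qPoch 1 j)⁻¹) := by
  have h := modX_genFun_pow_mul N (fun k => if j < k then x else (1 : K))
  set R : PowerSeries K := ∏ i ∈ Finset.Ico j N,
    (1 - PowerSeries.C x * PowerSeries.X ^ (i + 1)) with hR
  have h1 : ∏ i ∈ Finset.range N,
      (1 - PowerSeries.C (if j < i + 1 then x else (1 : K)) * PowerSeries.X ^ (i + 1)) =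
      qPoch 1 j * R := by
    rw [← Finset.prod_range_mul_prod_Ico _ hj, hR, qPoch]
    refine congrArg₂ (· * ·) (Finset.prod_congr rfl fun i hi => ?_)
      (Finset.prod_congr rfl fun i hi => ?_)
    · rw [if_neg (by have := Finset.mem_range.1 hi; omega)]
    · rw [if_pos (by have := Finset.mem_Ico.1 hi; omega)]
  have h2 : qPoch x N = qPoch x j * R := (Finset.prod_range_mul_prod_Ico _ hj).symm
  rw [h1] at h
  rw [h2, show colSeries x j * (qPoch x j * R) = (colSeries x j * (qPoch 1 j * R)) *
    (qPoch x j * (qPoch 1 j)⁻¹) by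
      rw [show colSeries x j * (qPoch 1 j * R) * (qPoch x j * (qPoch 1 j)⁻¹) =
        colSeries x j * (qPoch x j * R) * (qPoch 1 j * (qPoch 1 j)⁻¹) by ring, qPoch_mul_inv,
        mul_one], map_mul, colSeries, h, one_mul]

/-- The generating function of the eigenvalues `1 - (1 - q) (1 - t) φ_λ(q, t)`. -/
def eigSeries (q t : K) : PowerSeries K :=
  PowerSeries.mk fun n => ∑ lam : n.Partition, eig q t (diagram lam)

lemma modX_eigSeries (q t : K) (N : ℕ) :
    modX K N (eigSeries q t) = modX K N (PowerSeries.C (q ^ N) * colSeries t N +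
      PowerSeries.C (1 - q) * ∑ j ∈ Finset.range N, PowerSeries.C (q ^ j) * colSeries t j) := by
  rw [modX_eq_iff]
  intro n hn
  rw [eigSeries, PowerSeries.coeff_mk, map_add, PowerSeries.coeff_C_mul, PowerSeries.coeff_C_mul,
    map_sum]
  simp only [PowerSeries.coeff_C_mul, coeff_colSeries]
  rw [Finset.sum_congr rfl fun lam _ => eig_eq_colLen q t (diagram lam) (N := N)
    (by rwa [card_diagram]), Finset.sum_add_distrib, ← Finset.mul_sum]
  refine congrArg₂ (· + ·) ?_ (congrArg _ ?_)
  · rw [Finset.mul_sum]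
    refine Finset.sum_congr rfl fun lam _ => ?_
    -- Column `N`, counted from `0`, is empty in size at most `N`. This lets the boundary term take
    -- the same shape as the other columns.
    rw [show (diagram lam).colLen N = 0 by
      rw [← YoungDiagram.rowLen_transpose]
      exact rowLen_eq_zero (by rwa [card_transpose, card_diagram]), pow_zero, mul_one]
  · rw [Finset.sum_comm]
    refine Finset.sum_congr rfl fun j _ => ?_
    rw [Finset.mul_sum]

/-! ### The `q`-binomial theorem modulo a power of `T` -/

/-- The coefficients of the `q`-binomial series. -/
def binomCoeff (x : K) (k : ℕ) : PowerSeries K :=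
  (∏ i ∈ Finset.range k, (1 - PowerSeries.C x * PowerSeries.X ^ i)) * (qPoch 1 k)⁻¹

lemma binomCoeff_zero (x : K) : binomCoeff x 0 = 1 := by
  simp [binomCoeff, qPoch]

lemma binomCoeff_succ (x : K) (k : ℕ) :
    binomCoeff x (k + 1) * (1 - PowerSeries.X ^ (k + 1)) =
      binomCoeff x k * (1 - PowerSeries.C x * PowerSeries.X ^ k) := by
  have h := inv_qPoch_eq (1 : K) k
  rw [map_one, one_mul] at h
  rw [binomCoeff, binomCoeff, h, Finset.prod_range_succ]
  ring

lemma binomCoeff_succ_eq (x : K) (k : ℕ) :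
    binomCoeff x (k + 1) = PowerSeries.C (1 - x) * qPoch x k * (qPoch 1 (k + 1))⁻¹ := by
  rw [binomCoeff, Finset.prod_range_succ', pow_zero, mul_one, map_sub, map_one]
  change qPoch x k * _ * _ = _
  ring

/-- Summation by parts: consecutive quotients `qPoch x k / qPoch 1 k` differ by `T^k` times the
`k`-th binomial coefficient. -/
lemma sum_qPoch_eq (q x : K) (N : ℕ) :
    PowerSeries.C (q ^ N) * (qPoch x N * (qPoch 1 N)⁻¹) + PowerSeries.C (1 - q) *
      ∑ j ∈ Finset.range N, PowerSeries.C (q ^ j) * (qPoch x j * (qPoch 1 j)⁻¹) =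
    ∑ k ∈ Finset.range (N + 1), PowerSeries.C (q ^ k) * PowerSeries.X ^ k * binomCoeff x k := by
  induction N with
  | zero => simp [qPoch, binomCoeff_zero]
  | succ N ih =>
    rw [Finset.sum_range_succ _ (N + 1), ← ih, Finset.sum_range_succ, binomCoeff_succ_eq,
      qPoch_succ x, inv_qPoch_eq 1 N]
    simp only [map_one, map_sub, map_pow]
    ring

/-- The partial sums of the `q`-binomial series at `q T^k`. -/
def binomSum (q x : K) (N k : ℕ) : PowerSeries K :=
  ∑ n ∈ Finset.range (N + 1), PowerSeries.C (q ^ n) * PowerSeries.X ^ (k * n) * binomCoeff x n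

lemma binomSum_succ (q x : K) (N k : ℕ) : binomSum q x (N + 1) k = binomSum q x N k +
    PowerSeries.C (q ^ (N + 1)) * PowerSeries.X ^ (k * (N + 1)) * binomCoeff x (N + 1) :=
  Finset.sum_range_succ _ _

/-- The functional equation `(1-u) F(u) = (1-xu) F(uT)` of the `q`-binomial series at `u = q T^k`,
where `x u = T^k`. The extra term on the left is the truncation remainder. -/
lemma binomSum_step {q x : K} (hx : q * x = 1) (N k : ℕ) :
    (1 - PowerSeries.C q * PowerSeries.X ^ k) * binomSum q x N k +
      PowerSeries.X ^ (k * (N + 1)) * (PowerSeries.C (q ^ (N + 1)) * binomCoeff x N *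
        (1 - PowerSeries.C x * PowerSeries.X ^ N)) =
      (1 - PowerSeries.X ^ k) * binomSum q x N (k + 1) := by
  have hC : PowerSeries.C q * PowerSeries.C x = 1 := by rw [← map_mul, hx, map_one]
  induction N with
  | zero =>
    simp only [binomSum, zero_add, Finset.sum_range_one, binomCoeff_zero, pow_zero, map_one,
      mul_zero, mul_one, pow_one]
    linear_combination (-PowerSeries.X ^ k) * hC
  | succ N ih =>
    have h1 := binomCoeff_succ x N
    rw [binomSum_succ, binomSum_succ]
    simp only [map_pow] at ih ⊢
    rw [show (k + 1) * (N + 1) = k * (N + 1) + (N + 1) by ring,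
      show k * (N + 1 + 1) = k * (N + 1) + k by ring]
    simp only [pow_add _ (k * (N + 1))]
    linear_combination ih + (PowerSeries.X ^ (k * (N + 1)) * PowerSeries.C q ^ (N + 1)) * h1 -
      (PowerSeries.X ^ (k * (N + 1)) * PowerSeries.C q ^ (N + 1) * binomCoeff x (N + 1) *
        PowerSeries.X ^ k * PowerSeries.X ^ (N + 1)) * hC

/-- Iterating the functional equation from `u = qT` to `u = q T^(N+1)`, all truncation remainders
are divisible by `T^(N+1)`, and the final sum is `1` modulo that power. -/
lemma modX_binomSum {q x : K} (hx : q * x = 1) (N : ℕ) :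
    modX K N (binomSum q x N 1 * qPoch q N) = modX K N (qPoch 1 N) := by
  have h1 : ∀ k, modX K N (binomSum q x N 1 * qPoch q k) =
      modX K N (qPoch 1 k * binomSum q x N (k + 1)) := by
    intro k
    induction k with
    | zero => simp [qPoch]
    | succ k ih =>
      rw [qPoch_succ, ← mul_assoc, map_mul, ih, ← map_mul, qPoch_succ, mul_assoc, mul_assoc,
        map_mul, map_mul _ (qPoch 1 k), map_one, one_mul, ← binomSum_step hx, map_add,
        modX_X_pow_mul (by nlinarith), add_zero, mul_comm (binomSum _ _ _ _)]
  rw [h1, map_mul]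
  have h2 : modX K N (binomSum q x N (N + 1)) = 1 := by
    rw [binomSum, Finset.sum_range_succ', map_add, map_sum, Finset.sum_eq_zero, zero_add]
    · simp [binomCoeff_zero]
    · intro i _
      rw [mul_assoc, mul_left_comm, modX_X_pow_mul (by nlinarith)]
  rw [h2, mul_one]

/-- Multiplying the column expansion by `qPoch x N` leaves the sum of `sum_qPoch_eq`, which the
`q`-binomial theorem turns into a product. -/
lemma modX_eigSeries_mul {q x : K} (hx : q * x = 1) (N : ℕ) :
    modX K N (eigSeries q x * (qPoch q N * qPoch x N)) = modX K N (qPoch 1 N) := by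
  rw [← modX_binomSum hx, show eigSeries q x * (qPoch q N * qPoch x N) =
    eigSeries q x * qPoch x N * qPoch q N by ring, map_mul, map_mul _ (binomSum _ _ _ _)]
  congr 1
  rw [binomSum]
  simp only [one_mul]
  rw [← sum_qPoch_eq, map_mul, modX_eigSeries, ← map_mul, add_mul, mul_assoc, mul_assoc,
    Finset.sum_mul]
  simp only [mul_assoc]
  rw [map_add, map_add, map_mul, modX_colSeries x le_rfl, map_mul _ (PowerSeries.C (1 - q)),
    map_mul _ (PowerSeries.C (1 - q)), map_sum, map_sum, map_mul]
  refine congrArg₂ (· + ·) rfl (congrArg _ (Finset.sum_congr rfl fun j hj => ?_))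
  rw [map_mul, modX_colSeries x (Finset.mem_range.1 hj).le, ← map_mul]

lemma hilbH_eq (n : ℕ) (z w : K) : hilbH n z w = PowerSeries.coeff n
    (qPoch (z * w) n ^ 2 * (qPoch (z ^ 2) n * qPoch (w ^ 2) n)⁻¹) := by
  have hprod : ∀ f : ℕ → PowerSeries K,
      ∏ m ∈ Finset.Icc 1 n, f m = ∏ i ∈ Finset.range n, f (i + 1) := fun f => by
    rw [Finset.range_eq_Ico, Finset.prod_Ico_add' f 0 n 1]
    rfl
  rw [hilbH, hprod, Finset.prod_mul_distrib, Finset.prod_pow]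
  congr 2
  rw [PowerSeries.eq_inv_iff_mul_eq_one (by simp [constantCoeff_qPoch]), qPoch, qPoch,
    ← Finset.prod_mul_distrib, ← Finset.prod_mul_distrib]
  refine Finset.prod_eq_one fun i _ => ?_
  exact PowerSeries.inv_mul_cancel _ (by simp)

/-- Each difference in a cell's factor is `z^(2a+2l+2) - 1` times a power of `z⁻¹`, and everything
cancels. -/
lemma hook_inv_eq_one {z : K} (hz : ∀ m : ℕ, m ≠ 0 → z ^ m ≠ 1) (hz0 : z ≠ 0) (D : YoungDiagram) :
    hook 1 z z⁻¹ D = 1 := by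
  refine Finset.prod_eq_one fun s _ => ?_
  generalize arm D s = a
  generalize leg D s = l
  have h : ∀ m n : ℕ, z ^ m - z⁻¹ ^ n = (z ^ (m + n) - 1) * z⁻¹ ^ n := fun m n => by
    rw [sub_mul, one_mul, pow_add, mul_assoc, ← mul_pow, mul_inv_cancel₀ hz0, one_pow, mul_one]
  have h0 : z ^ (2 * a + 2 * l + 2) - 1 ≠ 0 := sub_ne_zero.2 (hz _ (by omega))
  have hi : z⁻¹ ≠ 0 := inv_ne_zero hz0
  rw [h, h, h, show 2 * a + 1 + (2 * l + 1) = 2 * a + 2 * l + 2 by ring,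
    show 2 * a + 2 + 2 * l = 2 * a + 2 * l + 2 by ring,
    show 2 * a + (2 * l + 2) = 2 * a + 2 * l + 2 by ring, div_eq_one_iff_eq]
  · ring
  · exact mul_ne_zero (mul_ne_zero h0 (pow_ne_zero _ hi)) (mul_ne_zero h0 (pow_ne_zero _ hi))

/-- The generating function identity on the curve `w = 1 / z`. -/
lemma series_inv_eq {z : K} (hz : ∀ m : ℕ, m ≠ 0 → z ^ m ≠ 1) (hz0 : z ≠ 0) :
    1 + PowerSeries.C ((z ^ 2 - 1) * (1 - z⁻¹ ^ 2)) * (seriesA1 z z⁻¹ * (seriesA0 z z⁻¹)⁻¹) =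
      PowerSeries.mk fun n => hilbH n z z⁻¹ := by
  have hc : PowerSeries.constantCoeff (seriesA0 z z⁻¹) ≠ 0 := by
    rw [constantCoeff_seriesA0]; exact one_ne_zero
  have hx : z ^ 2 * z⁻¹ ^ 2 = 1 := by rw [← mul_pow, mul_inv_cancel₀ hz0, one_pow]
  -- The prefactor is `-(1 - z²)(1 - z⁻²)`, so adding `A_0` assembles exactly the eigenvalues.
  have hE : seriesA0 z z⁻¹ + PowerSeries.C ((z ^ 2 - 1) * (1 - z⁻¹ ^ 2)) * seriesA1 z z⁻¹ =
      eigSeries (z ^ 2) (z⁻¹ ^ 2) := by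
    ext n
    rw [map_add, PowerSeries.coeff_C_mul, seriesA0, seriesA1, eigSeries, PowerSeries.coeff_mk,
      PowerSeries.coeff_mk, PowerSeries.coeff_mk, Finset.mul_sum, ← Finset.sum_add_distrib]
    refine Finset.sum_congr rfl fun lam _ => ?_
    rw [hook_inv_eq_one hz hz0, eig]
    ring
  ext n
  rw [PowerSeries.coeff_mk, hilbH_eq, mul_inv_cancel₀ hz0]
  refine modX_eq_iff.1 ?_ n le_rfl
  have hA : modX K n (seriesA0 z z⁻¹ * qPoch 1 n) = 1 := by
    have h0 : seriesA0 z z⁻¹ = colSeries 1 0 := by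
      ext m
      rw [coeff_colSeries, seriesA0, PowerSeries.coeff_mk]
      simp only [one_pow, hook_inv_eq_one hz hz0]
    rw [h0, modX_colSeries 1 (Nat.zero_le n)]
    simp [qPoch]
  set u := qPoch (z ^ 2) n * qPoch (z⁻¹ ^ 2) n with hu
  have hu1 : u * u⁻¹ = 1 := PowerSeries.mul_inv_cancel _ (by simp [hu, constantCoeff_qPoch])
  have hEu := modX_eigSeries_mul hx n
  rw [← hu] at hEu
  have hL : 1 + PowerSeries.C ((z ^ 2 - 1) * (1 - z⁻¹ ^ 2)) *
      (seriesA1 z z⁻¹ * (seriesA0 z z⁻¹)⁻¹) =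
      eigSeries (z ^ 2) (z⁻¹ ^ 2) * (seriesA0 z z⁻¹)⁻¹ := by
    rw [← hE, add_mul, PowerSeries.mul_inv_cancel _ hc, mul_assoc]
  have hA' : modX K n (seriesA0 z z⁻¹)⁻¹ = modX K n (qPoch 1 n) := by
    have h1 := congrArg (modX K n (seriesA0 z z⁻¹)⁻¹ * ·) hA
    simp only [mul_one] at h1
    rw [← h1, ← map_mul, ← mul_assoc, PowerSeries.inv_mul_cancel _ hc, one_mul]
  calc modX K n _ = modX K n (eigSeries (z ^ 2) (z⁻¹ ^ 2) * u * (seriesA0 z z⁻¹)⁻¹ * u⁻¹) := by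
        rw [hL, show eigSeries (z ^ 2) (z⁻¹ ^ 2) * u * (seriesA0 z z⁻¹)⁻¹ * u⁻¹ =
          eigSeries (z ^ 2) (z⁻¹ ^ 2) * (seriesA0 z z⁻¹)⁻¹ * (u * u⁻¹) by ring, hu1, mul_one]
    _ = _ := by
        rw [map_mul, map_mul, hEu, hA', ← map_mul, ← map_mul, pow_two]

end Inverse

end HilbChar

end

noncomputable section

namespace HilbChar

/-! ### The line `z = 0` -/

section Zero

variable {K : Type*} [Field K]

lemma prod_cells_eq_col {M : Type*} [CommMonoid M] (D : YoungDiagram) {N : ℕ} (hN : D.card ≤ N)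
    (f : ℕ × ℕ → M) :
    ∏ s ∈ D.cells, f s = ∏ j ∈ Finset.range N, ∏ i ∈ Finset.range (D.colLen j), f (i, j) := by
  rw [Finset.prod_sigma']
  refine Finset.prod_nbij' (fun s => ⟨s.2, s.1⟩) (fun x => (x.2, x.1)) ?_ ?_ ?_ ?_ ?_
  · intro s hs
    have hs' : (s.1, s.2) ∈ D := hs
    have h := YoungDiagram.mem_iff_lt_colLen.1 hs'
    simp only [Finset.mem_sigma, Finset.mem_range]
    refine ⟨?_, h⟩
    by_contra hc
    rw [← YoungDiagram.rowLen_transpose, rowLen_eq_zero (by rw [card_transpose]; omega)] at h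
    omega
  · intro x hx
    simp only [Finset.mem_sigma, Finset.mem_range] at hx
    exact YoungDiagram.mem_iff_lt_colLen.2 hx.2
  · intro _ _; rfl
  · intro _ _; rfl
  · intro _ _; rfl

/-- The series coefficients `1 / ((1 - u) ⋯ (1 - u^m))`. -/
def invFactorial (u : K) (m : ℕ) : K := ∏ l ∈ Finset.range m, (1 - u ^ (l + 1))⁻¹

lemma card_filter_lt_eq (m : Multiset ℕ) (j : ℕ) :
    (m.filter (j < ·)).card = (m.filter (j + 1 < ·)).card + m.count (j + 1) := by
  induction m using Multiset.induction_on with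
  | empty => simp
  | cons a m ih =>
    rw [Multiset.filter_cons, Multiset.filter_cons, Multiset.count_cons, Multiset.card_add,
      Multiset.card_add, ih]
    split_ifs <;> simp <;> omega

/-- The power `0 ^ (2 * a)` is `1` for arm length `0`. For positive arm length only powers of `w`
remain, and they cancel. -/
lemma hook_factor_zero {w : K} (hw : ∀ m : ℕ, m ≠ 0 → w ^ m ≠ 1) (hw0 : w ≠ 0) (a l : ℕ) :
    ((0 : K) ^ (2 * a + 1) - w ^ (2 * l + 1)) ^ (2 * 1) /
      ((0 ^ (2 * a + 2) - w ^ (2 * l)) * (0 ^ (2 * a) - w ^ (2 * l + 2))) =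
      if a = 0 then (1 - (w ^ 2)⁻¹ ^ (l + 1))⁻¹ else 1 := by
  have h1 : w ^ (2 * l + 2) - 1 ≠ 0 := sub_ne_zero.2 (hw _ (by omega))
  have h2 : w ^ (2 * l) ≠ 0 := pow_ne_zero _ hw0
  have h3 : w ^ (2 * l + 2) ≠ 0 := pow_ne_zero _ hw0
  rw [zero_pow (by omega), zero_pow (by omega)]
  split_ifs with ha
  · have h4 : (1 - (w ^ 2)⁻¹ ^ (l + 1))⁻¹ = w ^ (2 * l + 2) / (w ^ (2 * l + 2) - 1) := by
      rw [inv_pow, ← pow_mul, show 2 * (l + 1) = 2 * l + 2 by ring, inv_eq_iff_eq_inv, inv_div,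
        sub_div, div_self h3, one_div]
    have h5 : 1 - w ^ (2 * l + 2) ≠ 0 := fun h => h1 (by rw [← neg_sub, h, neg_zero])
    rw [ha, mul_zero, pow_zero, h4, div_eq_div_iff (mul_ne_zero (by simpa using h2) h5) h1]
    ring
  · rw [zero_pow (by omega), div_eq_one_iff_eq]
    · ring
    · simp [h2, h3]

/-- The cells of arm length `0` in column `j` are its lowest ones, as many as there are parts equal
to `j + 1`, with leg lengths `0, 1, 2, …` from the bottom up. -/
lemma hook_zero {w : K} (hw : ∀ m : ℕ, m ≠ 0 → w ^ m ≠ 1) (hw0 : w ≠ 0) {n : ℕ}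
    (lam : n.Partition) :
    hook 1 0 w (diagram lam) =
      (Multiset.toFinsupp lam.parts).prod fun _ c => invFactorial (w ^ 2)⁻¹ c := by
  set u := (w ^ 2)⁻¹ with hu
  have hcol : ∀ j, ∏ i ∈ Finset.range ((diagram lam).colLen j),
      (if arm (diagram lam) (i, j) = 0 then (1 - u ^ (leg (diagram lam) (i, j) + 1))⁻¹ else 1) =
      invFactorial u (lam.parts.count (j + 1)) := by
    intro j
    have hc := card_filter_lt_eq lam.parts j
    rw [← colLen_diagram, ← colLen_diagram] at hc
    rw [← Finset.prod_range_mul_prod_Ico _ (show (diagram lam).colLen (j + 1) ≤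
      (diagram lam).colLen j by omega), Finset.prod_eq_one, one_mul]
    · rw [Finset.prod_Ico_eq_prod_range, invFactorial, ← Finset.prod_range_reflect, hc,
        Nat.add_sub_cancel_left]
      refine Finset.prod_congr rfl fun i hi => ?_
      have hi' := Finset.mem_range.1 hi
      rw [if_pos, leg]
      · congr 3
        simp only
        omega
      · have : ¬ (diagram lam).colLen (j + 1) +
            (lam.parts.count (j + 1) - 1 - i) < (diagram lam).colLen (j + 1) := by omega
        rw [lt_colLen_iff] at this
        rw [arm]
        simp only
        omega
    · intro i hi
      have hi' := lt_colLen_iff.1 (Finset.mem_range.1 hi)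
      rw [if_neg]
      rw [arm]
      simp only
      omega
  rw [hook, Finset.prod_congr rfl fun s _ => hook_factor_zero hw hw0 _ _,
    prod_cells_eq_col _ (card_diagram lam).le, Finset.prod_congr rfl fun j _ => hcol j,
    Finsupp.prod_of_support_subset _ (s := (Finset.range n).image (· + 1)),
    Finset.prod_image (fun a _ b _ h => by simpa using h)]
  · rfl
  · intro k hk
    rw [Multiset.toFinsupp_support, Multiset.mem_toFinset] at hk
    have h1 := lam.parts_pos hk
    have h2 := lam.le_of_mem_parts hk
    exact Finset.mem_image.2 ⟨k - 1, Finset.mem_range.2 (by omega), by omega⟩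
  · intro _ _
    simp [invFactorial]

lemma eig_zero (t : K) (D : YoungDiagram) : eig 0 t D = t ^ D.colLen 0 := by
  -- Taking `N = D.card + 1` makes `0 ^ N` vanish even for the empty diagram; only `j = 0` remains
  -- in the sum.
  rw [eig_eq_colLen 0 t D (Nat.le_succ _), Finset.sum_range_succ', Finset.sum_eq_zero]
  · simp
  · intro i _
    simp

/-- Euler's functional equation `(1 - tv) F(tv) = F(v)` for `F(v) = ∑ f_m v^m`, equivalent to
`f_{m-1} = (1 - t^(-m)) f_m`. -/
lemma one_sub_mul_stretch_invFactorial {t : K} (ht : ∀ m : ℕ, m ≠ 0 → t ^ m ≠ 1) (ht0 : t ≠ 0)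
    {k : ℕ} (hk : 0 < k) :
    (1 - PowerSeries.C t * PowerSeries.X ^ k) * stretch k (fun m => invFactorial t⁻¹ m * t ^ m) =
      stretch k (invFactorial t⁻¹) := by
  rw [one_sub_mul_stretch _ hk]
  congr 1
  funext m
  cases m with
  | zero => simp [invFactorial]
  | succ m =>
    have h1 : t ^ (m + 1) - 1 ≠ 0 := sub_ne_zero.2 (ht _ (Nat.succ_ne_zero m))
    have h2 : t ^ (m + 1) ≠ 0 := pow_ne_zero _ ht0
    have h3 : (1 - t⁻¹ ^ (m + 1))⁻¹ = t ^ (m + 1) / (t ^ (m + 1) - 1) := by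
      rw [inv_pow, inv_eq_iff_eq_inv, inv_div, sub_div, div_self h2, one_div]
    rw [if_neg (Nat.succ_ne_zero m), Nat.add_sub_cancel, invFactorial, Finset.prod_range_succ,
      ← invFactorial, h3]
    linear_combination invFactorial t⁻¹ m * div_mul_cancel₀ (t ^ (m + 1)) h1

/-- The generating function identity on the line `z = 0`. -/
lemma series_zero_eq {w : K} (hw : ∀ m : ℕ, m ≠ 0 → w ^ m ≠ 1) (hw0 : w ≠ 0) :
    1 + PowerSeries.C (((0 : K) ^ 2 - 1) * (1 - w ^ 2)) * (seriesA1 0 w * (seriesA0 0 w)⁻¹) =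
      PowerSeries.mk fun n => hilbH n 0 w := by
  have hc : PowerSeries.constantCoeff (seriesA0 0 w) ≠ 0 := by
    rw [constantCoeff_seriesA0]; exact one_ne_zero
  set t := w ^ 2 with ht
  have ht1 : ∀ m : ℕ, m ≠ 0 → t ^ m ≠ 1 := fun m hm => by
    rw [ht, ← pow_mul]; exact hw _ (by omega)
  have ht0 : t ≠ 0 := pow_ne_zero _ hw0
  set f : ℕ → ℕ → K := fun _ c => invFactorial t⁻¹ c with hf
  -- The second factor contributes `t` for each part, which is the eigenvalue at `q = 0`; the
  -- condition `0 < k` matches the formula for the length of column `0`.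
  set g : ℕ → ℕ → K := fun k c => f k c * (if 0 < k then t else 1) ^ c with hg
  have hA0 : seriesA0 0 w = Nat.Partition.genFun f := by
    ext n
    rw [seriesA0, PowerSeries.coeff_mk, Nat.Partition.coeff_genFun]
    exact Finset.sum_congr rfl fun lam _ => hook_zero hw hw0 lam
  have hB : seriesA0 0 w + PowerSeries.C (((0 : K) ^ 2 - 1) * (1 - t)) * seriesA1 0 w =
      Nat.Partition.genFun g := by
    ext n
    rw [map_add, PowerSeries.coeff_C_mul, seriesA0, seriesA1, PowerSeries.coeff_mk,
      PowerSeries.coeff_mk, Nat.Partition.coeff_genFun, Finset.mul_sum, ← Finset.sum_add_distrib]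
    refine Finset.sum_congr rfl fun lam _ => ?_
    have he := eig_zero t (diagram lam)
    rw [colLen_diagram, ← prod_map_ite, ← toFinsupp_prod_pow, eig] at he
    rw [hg, Finsupp.prod_mul, ← he, hf, ← hook_zero hw hw0, ← ht, zero_pow two_ne_zero]
    ring
  -- Euler's equation for each part size shows that inserting the eigenvalue divides `A_0` by `∏ (1
  -- - t T^i)`, the only part of the product formula left at `z = 0`.
  have hmod : ∀ N, modX K N (seriesA0 0 w) =
      modX K N (qPoch t N * Nat.Partition.genFun g) := by
    intro N
    rw [hA0, map_mul, modX_genFun N (f := f) (fun k => by simp [hf, invFactorial]),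
      modX_genFun N (f := g) (fun k => by simp [hg, hf, invFactorial]), ← map_mul, qPoch,
      ← Finset.prod_mul_distrib]
    refine congrArg _ (Finset.prod_congr rfl fun i _ => ?_)
    rw [hg, hf]
    simp only [Nat.succ_pos, if_true]
    exact (one_sub_mul_stretch_invFactorial ht1 ht0 (Nat.succ_pos i)).symm
  ext n
  rw [PowerSeries.coeff_mk, hilbH_eq, ← ht]
  refine modX_eq_iff.1 ?_ n le_rfl
  have h0 : qPoch (0 : K) n = 1 := by simp [qPoch]
  rw [zero_mul, zero_pow two_ne_zero, h0, one_pow, one_mul, one_mul]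
  have hL : 1 + PowerSeries.C (((0 : K) ^ 2 - 1) * (1 - t)) * (seriesA1 0 w * (seriesA0 0 w)⁻¹) =
      Nat.Partition.genFun g * (seriesA0 0 w)⁻¹ := by
    rw [← hB, add_mul, PowerSeries.mul_inv_cancel _ hc, mul_assoc]
  rw [zero_pow two_ne_zero] at hL
  calc modX K n _ = modX K n (qPoch t n * Nat.Partition.genFun g *
        ((qPoch t n)⁻¹ * (seriesA0 0 w)⁻¹)) := by
        rw [hL, show qPoch t n * Nat.Partition.genFun g * ((qPoch t n)⁻¹ * (seriesA0 0 w)⁻¹) =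
          Nat.Partition.genFun g * (seriesA0 0 w)⁻¹ * (qPoch t n * (qPoch t n)⁻¹) by ring,
          qPoch_mul_inv, mul_one]
    _ = _ := by
        rw [map_mul, ← hmod, ← map_mul, mul_left_comm, PowerSeries.mul_inv_cancel _ hc, mul_one]

end Zero

end HilbChar

end

open HilbChar in
theorem theorem4p9 :
    (∀ (n : ℕ) (hn : 1 ≤ n),
      HasValueAt (charH 1 (almostRow n hn)) (RatFunc.X : RatFunc ℚ) (RatFunc.X)⁻¹
        (hilbH n (RatFunc.X : RatFunc ℚ) (RatFunc.X)⁻¹)) ∧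
    (1 + PowerSeries.C (((RatFunc.X : RatFunc ℚ) ^ 2 - 1) * (1 - ((RatFunc.X)⁻¹) ^ 2)) *
        (seriesA1 (RatFunc.X : RatFunc ℚ) (RatFunc.X)⁻¹ *
          (seriesA0 (RatFunc.X : RatFunc ℚ) (RatFunc.X)⁻¹)⁻¹) =
      PowerSeries.mk fun n => hilbH n (RatFunc.X : RatFunc ℚ) (RatFunc.X)⁻¹) ∧
    (∀ (n : ℕ) (hn : 1 ≤ n),
      HasValueAt (charH 1 (almostRow n hn)) (0 : RatFunc ℚ) RatFunc.X
        (hilbH n (0 : RatFunc ℚ) RatFunc.X)) := by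
  have hX0 : (RatFunc.X : RatFunc ℚ) ≠ 0 := RatFunc.X_ne_zero
  have hX : ∀ m : ℕ, m ≠ 0 → (RatFunc.X : RatFunc ℚ) ^ m ≠ 1 := fun m hm => X_pow_ne_one hm
  refine ⟨fun n hn => ?_, series_inv_eq hX hX0, fun n hn => ?_⟩
  · have h := congrArg (PowerSeries.coeff n) (series_inv_eq hX hX0)
    rw [map_add, PowerSeries.coeff_one, if_neg (by omega), zero_add, PowerSeries.coeff_C_mul,
      PowerSeries.coeff_mk] at h
    rw [← h]
    exact charH_almostRow_hasValueAt (fun k l => X_pow_sub_X_inv_pow_ne_zero (by omega))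
      (fun k l => X_pow_sub_X_inv_pow_ne_zero (by omega)) n hn
  · have h := congrArg (PowerSeries.coeff n) (series_zero_eq hX hX0)
    rw [map_add, PowerSeries.coeff_one, if_neg (by omega), zero_add, PowerSeries.coeff_C_mul,
      PowerSeries.coeff_mk] at h
    rw [← h]
    exact charH_almostRow_hasValueAt (fun k l => zero_pow_sub_X_pow_ne_zero (by omega))
      (fun k l => zero_pow_sub_X_pow_ne_zero (by omega)) n hn
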